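/- For $\Bbbk\in\{\mathbb R,\mathbb C\}$ let $\Bbbk\{x,y\}$ be the ring of power series in $x,y$ over $\Bbbk$ that converge absolutely on some polydisc around the origin. Let $g_1,\dots,g_m\in\mathbb R\{x,y\}$ generate a nonzero ideal $J=(g_1,\dots,g_m)$, and assume that every irreducible $p\in\mathbb R\{x,y\}$ dividing $\prod_i g_i$ remains irreducible in $\mathbb C\{x,y\}$. Then there are a polydisc $U=\{(x,y)\in\mathbb C^2: |x|,|y|<r\}$, $r>0$, on which all the $g_i$ converge, and a monomialization $\pi:Y\to U$ of $J$ in which only real points are blown up. Explicitly, this means the following. (1) $\pi$ is a composition of finitely many maps $Y=Y_n\to Y_{n-1}\to\cdots\to Y_0=U$ of complex surfaces (Hausdorff, second countable complex manifolds of dimension two). Each $Y_i$ carries an antiholomorphic involution $\tau_i$, where $\tau_0$ is complex conjugation on $U$. Each $Y_{i+1}\to Y_i$ is the blow-up of a point $p_i\in Y_i$ that lies over the origin and is real, that is, $\tau_i(p_i)=p_i$; and $\tau_{i+1}$ is the lift of $\tau_i$. (2) $\pi$ is holomorphic, proper and bimeromorphic (biholomorphic over the complement of a nowhere dense closed analytic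 subset of $U$ whose preimage in $Y$ is nowhere dense). (3) The pulled back ideal is locally monomial: for every $q\in Y$ there are holomorphic coordinates $(u,v)$ on $Y$ centered at $q$ and integers $a,b\ge 0$ such that the germs at $q$ of $g_1\circ\pi,\dots,g_m\circ\pi$ generate the ideal $(u^av^b)$ of the local ring $\mathcal O_{Y,q}$. -/

import Mathlib

open scoped Manifold ContDiff Topology

noncomputable section

/-! ### Convergent power series in two variables -/

theorem summable_coeff_of_le {𝕜 : Type} [RCLike 𝕜] {f : MvPowerSeries (Fin 2) 𝕜} {r s : ℝ}
    (hs : 0 < s) (hsr : s ≤ r)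
    (hf : Summable fun n : Fin 2 →₀ ℕ => ‖MvPowerSeries.coeff n f‖ * r ^ (n 0 + n 1)) :
    Summable fun n : Fin 2 →₀ ℕ => ‖MvPowerSeries.coeff n f‖ * s ^ (n 0 + n 1) :=
  Summable.of_nonneg_of_le (fun _ => mul_nonneg (norm_nonneg _) (pow_nonneg hs.le _))
    (fun _ => mul_le_mul_of_nonneg_left (pow_le_pow_left₀ hs.le hsr _) (norm_nonneg _)) hf

/-- The ring `𝕜{x,y}` of power series in two variables that converge absolutely on some
polydisc around the origin. -/
def ConvergentSeries (𝕜 : Type) [RCLike 𝕜] : Subring (MvPowerSeries (Fin 2) 𝕜) where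
  carrier := {f | ∃ r : ℝ, 0 < r ∧
    Summable fun n : Fin 2 →₀ ℕ => ‖MvPowerSeries.coeff n f‖ * r ^ (n 0 + n 1)}
  zero_mem' := ⟨1, one_pos, by simp⟩
  one_mem' := by
    classical
    refine ⟨1, one_pos, summable_of_ne_finset_zero (s := {0}) fun n hn => ?_⟩
    have : n ≠ 0 := by simpa using hn
    simp [MvPowerSeries.coeff_one, this]
  neg_mem' := by
    rintro f ⟨r, hr, hf⟩
    exact ⟨r, hr, by simpa using hf⟩
  add_mem' := by
    rintro f g ⟨r, hr, hf⟩ ⟨s, hs, hg⟩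
    have hm : 0 < min r s := lt_min hr hs
    have hf' := summable_coeff_of_le hm (min_le_left _ _) hf
    have hg' := summable_coeff_of_le hm (min_le_right _ _) hg
    refine ⟨min r s, hm, Summable.of_nonneg_of_le
      (fun _ => mul_nonneg (norm_nonneg _) (pow_nonneg hm.le _)) (fun n => ?_) (hf'.add hg')⟩
    rw [map_add, ← add_mul]
    exact mul_le_mul_of_nonneg_right (norm_add_le _ _) (pow_nonneg hm.le _)
  mul_mem' := by
    classical
    rintro f g ⟨r, hr, hf⟩ ⟨s, hs, hg⟩
    have hm : 0 < min r s := lt_min hr hs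
    have hf' := summable_coeff_of_le hm (min_le_left _ _) hf
    have hg' := summable_coeff_of_le hm (min_le_right _ _) hg
    have h0 : ∀ (h : MvPowerSeries (Fin 2) 𝕜) (n : Fin 2 →₀ ℕ),
        0 ≤ ‖MvPowerSeries.coeff n h‖ * min r s ^ (n 0 + n 1) :=
      fun _ _ => mul_nonneg (norm_nonneg _) (pow_nonneg hm.le _)
    have hs := summable_sum_mul_antidiagonal_of_summable_mul
      (f := fun n : Fin 2 →₀ ℕ => ‖MvPowerSeries.coeff n f‖ * min r s ^ (n 0 + n 1))
      (g := fun n : Fin 2 →₀ ℕ => ‖MvPowerSeries.coeff n g‖ * min r s ^ (n 0 + n 1))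
      (hf'.mul_of_nonneg hg' (h0 f) (h0 g))
    refine ⟨min r s, hm, Summable.of_nonneg_of_le (h0 (f * g)) (fun n => ?_) hs⟩
    rw [MvPowerSeries.coeff_mul]
    refine (mul_le_mul_of_nonneg_right (norm_sum_le _ _) (pow_nonneg hm.le _)).trans ?_
    rw [Finset.sum_mul]
    refine Finset.sum_le_sum fun kl hkl => le_of_eq ?_
    rw [Finset.HasAntidiagonal.mem_antidiagonal] at hkl
    rw [← hkl, norm_mul, Finsupp.add_apply, Finsupp.add_apply]
    ring

/-- The inclusion `ℝ{x,y} → ℂ{x,y}`. -/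
def complexify : ConvergentSeries ℝ →+* ConvergentSeries ℂ :=
  ((MvPowerSeries.map (σ := Fin 2) Complex.ofRealHom).comp
    (ConvergentSeries ℝ).subtype).codRestrict (ConvergentSeries ℂ) (by
      rintro ⟨f, r, hr, hf⟩
      exact ⟨r, hr, by simpa using hf⟩)

/-- The terms of the power series `f` at the point `z = (x, y)` of `ℂ²`. -/
def seriesTerm (f : MvPowerSeries (Fin 2) ℂ) (z : ℂ × ℂ) (n : Fin 2 →₀ ℕ) : ℂ :=
  MvPowerSeries.coeff n f * z.1 ^ n 0 * z.2 ^ n 1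

/-- The sum of the power series `f` at the point `z = (x, y)` (meaningful where it converges). -/
def seriesEval (f : MvPowerSeries (Fin 2) ℂ) (z : ℂ × ℂ) : ℂ :=
  ∑' n : Fin 2 →₀ ℕ, seriesTerm f z n

/-! ### Germs of holomorphic functions and ideals on complex surfaces

A complex surface is a charted space over `ℂ × ℂ` with analytic transition maps; holomorphic maps
are `ContMDiff` maps of class `ω`. -/

section Surface

variable {X : Type} [TopologicalSpace X] [ChartedSpace (ℂ × ℂ) X]
variable {Y : Type} [TopologicalSpace Y] [ChartedSpace (ℂ × ℂ) Y]

/-- The local ring `𝒪_{Y,y}` of germs of holomorphic functions at `y`. -/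
def holomorphicGerms (y : Y) : Subring ((𝓝 y).Germ ℂ) where
  carrier := {f | ∃ F : Y → ℂ, ContMDiffAt 𝓘(ℂ, ℂ × ℂ) 𝓘(ℂ, ℂ) ω F y ∧
    f = (F : (𝓝 y).Germ ℂ)}
  zero_mem' := ⟨fun _ => 0, contMDiffAt_const, rfl⟩
  one_mem' := ⟨fun _ => 1, contMDiffAt_const, rfl⟩
  add_mem' := by
    rintro _ _ ⟨F, hF, rfl⟩ ⟨G, hG, rfl⟩
    exact ⟨F + G, hF.add hG, rfl⟩
  neg_mem' := by
    rintro _ ⟨F, hF, rfl⟩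
    exact ⟨-F, hF.neg, rfl⟩
  mul_mem' := by
    rintro _ _ ⟨F, hF, rfl⟩ ⟨G, hG, rfl⟩
    exact ⟨F * G, hF.smul hG, rfl⟩

/-- The stalk at `y` of the ideal sheaf generated by the holomorphic functions `F i`: the ideal of
`𝒪_{Y,y}` generated by their germs. -/
def idealStalk {ι : Type} (F : ι → Y → ℂ) (y : Y) : Ideal (holomorphicGerms y) :=
  Ideal.span {h | ∃ i, (h : (𝓝 y).Germ ℂ) = (F i : (𝓝 y).Germ ℂ)}

/-- The ideal generated by the functions `F i` is monomial at `y`: in suitable holomorphic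
coordinates `φ = (u, v)` centered at `y` it is generated by a single monomial `u ^ a * v ^ b`. -/
def IsMonomialAt {ι : Type} (F : ι → Y → ℂ) (y : Y) : Prop :=
  ∃ φ ∈ IsManifold.maximalAtlas 𝓘(ℂ, ℂ × ℂ) ω Y, y ∈ φ.source ∧ φ y = 0 ∧
    ∃ a b : ℕ, idealStalk F y =
      idealStalk (fun (_ : Unit) (z : Y) => (φ z).1 ^ a * (φ z).2 ^ b) y

/-- A closed analytic subset: locally the common zero set of finitely many holomorphic
functions. -/
def IsAnalyticSubset (A : Set X) : Prop :=
  ∀ x : X, ∃ W : Set X, IsOpen W ∧ x ∈ W ∧ ∃ (k : ℕ) (f : Fin k → X → ℂ),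
    (∀ i, ContMDiffOn 𝓘(ℂ, ℂ × ℂ) 𝓘(ℂ, ℂ) ω (f i) W) ∧
    A ∩ W = {z ∈ W | ∀ i, f i z = 0}

/-- The holomorphic map `π` is biholomorphic from `π⁻¹(V)` onto `V`. -/
def IsBiholomorphicOver (π : Y → X) (V : Set X) : Prop :=
  ∃ s : X → Y, ContMDiffOn 𝓘(ℂ, ℂ × ℂ) 𝓘(ℂ, ℂ × ℂ) ω s V ∧
    (∀ x ∈ V, π (s x) = x) ∧ ∀ y, π y ∈ V → s (π y) = y

/-- A proper bimeromorphic holomorphic map. -/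
structure IsProperBimeromorphic (π : Y → X) : Prop where
  holomorphic : ContMDiff 𝓘(ℂ, ℂ × ℂ) 𝓘(ℂ, ℂ × ℂ) ω π
  proper : IsProperMap π
  bimeromorphic : ∃ A : Set X, IsAnalyticSubset A ∧ interior A = ∅ ∧
    interior (π ⁻¹' A) = ∅ ∧ IsBiholomorphicOver π Aᶜ

/-- `π : Y → X` is a monomialization of the ideal sheaf on `X` generated by the functions `G i`:
it is proper and bimeromorphic and the ideal sheaf generated by the pullbacks `G i ∘ π` is
locally monomial (`Y` is smooth, being a complex manifold). -/
structure IsMonomialization {ι : Type} (G : ι → X → ℂ) (π : Y → X) : Prop where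
  properBimeromorphic : IsProperBimeromorphic π
  monomial : ∀ y : Y, IsMonomialAt (fun i => G i ∘ π) y

/-- `σ : Y → X` is the blow-up of the complex surface `X` at the point `p`: it is biholomorphic
over `X \ {p}`, and for some holomorphic coordinates `φ = (u, v)` centered at `p` the preimage of
their domain is glued from the two standard charts, `ψ₁` with coordinates `(u, v / u)` and `ψ₂`
with coordinates `(u / v, v)`. In other words, over the domain of `φ` the map `σ` is the first
projection of `{(w, ℓ) : w ∈ ℓ} ⊆ φ.target × ℙ¹`. -/
structure IsBlowupAt (σ : Y → X) (p : X) : Prop where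
  holomorphic : ContMDiff 𝓘(ℂ, ℂ × ℂ) 𝓘(ℂ, ℂ × ℂ) ω σ
  biholomorphic : IsBiholomorphicOver σ {p}ᶜ
  charts : ∃ φ ∈ IsManifold.maximalAtlas 𝓘(ℂ, ℂ × ℂ) ω X, p ∈ φ.source ∧ φ p = 0 ∧
    ∃ ψ₁ ∈ IsManifold.maximalAtlas 𝓘(ℂ, ℂ × ℂ) ω Y,
    ∃ ψ₂ ∈ IsManifold.maximalAtlas 𝓘(ℂ, ℂ × ℂ) ω Y,
      ψ₁.source ∪ ψ₂.source = σ ⁻¹' φ.source ∧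
      ψ₁.target = {q | (q.1, q.1 * q.2) ∈ φ.target} ∧
      ψ₂.target = {q | (q.1 * q.2, q.2) ∈ φ.target} ∧
      (∀ z ∈ ψ₁.source, φ (σ z) = ((ψ₁ z).1, (ψ₁ z).1 * (ψ₁ z).2)) ∧
      (∀ z ∈ ψ₂.source, φ (σ z) = ((ψ₂ z).1 * (ψ₂ z).2, (ψ₂ z).2)) ∧
      (∀ z ∈ ψ₁.source, z ∈ ψ₂.source ↔ (ψ₁ z).2 ≠ 0) ∧
      (∀ z ∈ ψ₁.source ∩ ψ₂.source, ψ₂ z = ((ψ₁ z).2⁻¹, (ψ₁ z).1 * (ψ₁ z).2))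

/-- `τ` is antiholomorphic: in local coordinates, its complex conjugate is holomorphic. -/
def IsAntiholomorphic (τ : Y → X) : Prop :=
  Continuous τ ∧ ∀ y : Y, ContMDiffAt 𝓘(ℂ, ℂ × ℂ) 𝓘(ℂ, ℂ × ℂ) ω
    (fun z => star (chartAt (ℂ × ℂ) (τ y) (τ z))) y

end Surface

/-! ### Complex surfaces with a real structure and towers of blow-ups of real points -/

/-- A complex surface (a Hausdorff, second countable complex manifold of dimension two) with a real
structure, that is, an antiholomorphic involution `conj`. -/
structure RealSurface where
  carrier : Type
  [topologicalSpace : TopologicalSpace carrier]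
  [chartedSpace : ChartedSpace (ℂ × ℂ) carrier]
  [isManifold : IsManifold 𝓘(ℂ, ℂ × ℂ) ω carrier]
  [t2Space : T2Space carrier]
  [secondCountable : SecondCountableTopology carrier]
  conj : carrier → carrier
  conj_antiholomorphic : IsAntiholomorphic conj
  conj_involutive : Function.Involutive conj

instance : CoeSort RealSurface Type := ⟨RealSurface.carrier⟩

attribute [instance] RealSurface.topologicalSpace RealSurface.chartedSpace RealSurface.isManifold
  RealSurface.t2Space RealSurface.secondCountable

/-- A point of a surface with a real structure is real if it is fixed by the conjugation. -/
def RealSurface.IsRealPoint (X : RealSurface) (p : X) : Prop := X.conj p = p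

/-- `IsRealBlowupTower o Y π`: the map `π : Y → X` is a composition of finitely many blow-ups of
points that are real and lie over `o`, where at each stage the real structure of the blown-up
surface is the lift of the previous one. -/
inductive IsRealBlowupTower {X : RealSurface} (o : X) : (Y : RealSurface) → (Y → X) → Prop
  | refl : IsRealBlowupTower o X id
  | blowup {Y Z : RealSurface} {π : Y → X} (σ : Z → Y) (p : Y)
      (tower : IsRealBlowupTower o Y π) (is_real : Y.IsRealPoint p) (lies_over : π p = o)
      (isBlowup : IsBlowupAt σ p) (conj_lift : ∀ z, σ (Z.conj z) = Y.conj (σ z)) :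
      IsRealBlowupTower o Z (π ∘ σ)

/-- The open polydisc of radius `r` around the origin of `ℂ²` (the norm of `ℂ × ℂ` is the maximum
norm). -/
def polydiscOpens (r : ℝ) : TopologicalSpace.Opens (ℂ × ℂ) := ⟨Metric.ball 0 r, Metric.isOpen_ball⟩

/-- The open polydisc of radius `r` with complex conjugation as its real structure. -/
def polydisc (r : ℝ) : RealSurface where
  carrier := polydiscOpens r
  conj z := ⟨star z.1, by
    have h : ‖z.1‖ < r := mem_ball_zero_iff.mp z.2
    exact mem_ball_zero_iff.mpr (by rwa [norm_star])⟩
  conj_antiholomorphic := by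
    refine ⟨Continuous.subtype_mk (continuous_star.comp continuous_subtype_val) _, fun y => ?_⟩
    have h := (contMDiff_subtype_val (I := 𝓘(ℂ, ℂ × ℂ)) (n := ω) (U := polydiscOpens r)) y
    refine h.congr_of_eventuallyEq (Filter.Eventually.of_forall fun z => ?_)
    exact star_star z.1
  conj_involutive z := Subtype.ext (star_star z.1)

/-- The origin as a point of the polydisc. -/
def polydiscOrigin {r : ℝ} (hr : 0 < r) : polydisc r :=
  (⟨0, Metric.mem_ball_self hr⟩ : polydiscOpens r)

/-- The holomorphic function on the polydisc that the complex power series `f` sums to. -/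
def polydiscFun (r : ℝ) (f : ConvergentSeries ℂ) : polydisc r → ℂ :=
  fun z : polydiscOpens r => seriesEval f.1 z.1

end

/-! The hypothesis acts through tangent directions. A branch of a real curve germ with a non-real
tangent differs from its complex conjugate, so the real irreducible factor that it belongs to splits
over ℂ. If every real irreducible factor stays irreducible, the strict transform therefore meets the
exceptional curve in real points only. This property is inherited at those points, so the usual
resolution process never needs a non-real center.

To carry the property through blow-ups without a theory of branches, it is phrased topologically in
`HasRealBranches`: a subset of the punctured zero germ that is open and closed in it and disjoint
from its conjugate is empty. For an irreducible real germ this comes from Weierstrass preparation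
(`hasRealBranches_of_weierstrass`). Such a subset divides the roots of the Weierstrass polynomial
into two groups; the two monic factors are holomorphic off x = 0 and bounded, so they extend across
x = 0, and irreducibility makes one of them a unit. The property passes to products, real coordinate
changes and strict transforms at real points. At a non-real point c of the exceptional curve, the
zeros of slope near c form a set of the forbidden kind, so the strict transform is a unit there
(`HasRealBranches.strictTransform_ne_zero`).

Locally, x = 0 is the exceptional curve and every generator divides a power of x * h
(`ResolutionData`). It suffices to make x * h monomial: a divisor of a monomial is a monomial
(`IsMonomialGerm.of_mul`), and an ideal generated by monomials becomes principal after more blow-ups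
of coordinate points (`Resolvable.exists_of_isMonomialGerm`). Let d be the order of h on x = 0. The
invariant is 2d, lowered by one if h has a smooth factor transversal to x = 0. At a finite slope the
new order is the multiplicity of that slope as a root of the initial form; in the vertical direction
the old exceptional curve joins h as a smooth factor, which the correction by one pays for. At a
finite slope the order can stay d only if the initial form is a d-th power. After a shear that
removes the term of degree d - 1, this happens only at slope 0, where the coefficient of y ^ k is
divided by x ^ (d - k); a nonzero coefficient allows this finitely often
(`ResolutionData.exists_resolvable_of_weierstrass`).

Globally, the local process is recorded by the finite tree `Resolvable`. Compactness of the set of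
directions makes the ideal monomial in a punctured neighbourhood of the origin
(`Resolvable.eventually_monoAt`), so on a small polydisc only the origin needs treatment. Blow-ups
are built explicitly from pairs of a point and a direction (`BlowupCenter`), and `exists_tower`
performs them one at a time while the total number still owed decreases. -/

noncomputable section

/-! ### Bounded sequences, shifts and evaluation of power series in one variable -/

/-- The Banach space of bounded complex sequences. -/
def BSeq : Type := BoundedContinuousFunction ℕ ℂ

instance : NormedAddCommGroup BSeq :=
  inferInstanceAs (NormedAddCommGroup (BoundedContinuousFunction ℕ ℂ))

instance : NormedSpace ℂ BSeq := inferInstanceAs (NormedSpace ℂ (BoundedContinuousFunction ℕ ℂ))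

instance : CompleteSpace BSeq := inferInstanceAs (CompleteSpace (BoundedContinuousFunction ℕ ℂ))

instance : FunLike BSeq ℕ ℂ := inferInstanceAs (FunLike (BoundedContinuousFunction ℕ ℂ) ℕ ℂ)

instance : Star BSeq := inferInstanceAs (Star (BoundedContinuousFunction ℕ ℂ))

theorem norm_pow_le_one_of_norm_le_one {E : Type*} [NormedAddCommGroup E] [NormedSpace ℂ E]
    {T : E →L[ℂ] E} (hT : ‖T‖ ≤ 1) (k : ℕ) : ‖T ^ k‖ ≤ 1 := by
  induction k with
  | zero => exact ContinuousLinearMap.norm_id_le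
  | succ k ih =>
    rw [pow_succ]
    exact (norm_mul_le _ _).trans (mul_le_one₀ ih (norm_nonneg _) hT)

theorem AnalyticAt.apply_clm {E F G : Type*} [NormedAddCommGroup E] [NormedSpace ℂ E]
    [NormedAddCommGroup F] [NormedSpace ℂ F] [NormedAddCommGroup G] [NormedSpace ℂ G]
    [CompleteSpace G] {f : E → F →L[ℂ] G} {g : E → F} {z : E}
    (hf : AnalyticAt ℂ f z) (hg : AnalyticAt ℂ g z) : AnalyticAt ℂ (fun w => f w (g w)) z :=
  ((ContinuousLinearMap.id ℂ (F →L[ℂ] G)).analyticAt_bilinear (f z, g z)).comp_of_eq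
    (hf.prod hg) rfl

namespace BSeq

/-- The bounded sequence with the given terms. -/
def mk (a : ℕ → ℂ) (C : ℝ) (h : ∀ n, ‖a n‖ ≤ C) : BSeq :=
  BoundedContinuousFunction.ofNormedAddCommGroup a continuous_of_discreteTopology C h

@[simp] theorem mk_apply (a : ℕ → ℂ) (C : ℝ) (h : ∀ n, ‖a n‖ ≤ C) (n : ℕ) : mk a C h n = a n := rfl

@[ext] theorem ext {a b : BSeq} (h : ∀ n, a n = b n) : a = b := BoundedContinuousFunction.ext h

@[simp] theorem add_apply (a b : BSeq) (n : ℕ) : (a + b) n = a n + b n := rfl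

@[simp] theorem smul_apply (c : ℂ) (a : BSeq) (n : ℕ) : (c • a) n = c * a n := rfl

@[simp] theorem star_apply (a : BSeq) (n : ℕ) : (star a) n = star (a n) := rfl

theorem norm_apply_le (a : BSeq) (n : ℕ) : ‖a n‖ ≤ ‖a‖ :=
  BoundedContinuousFunction.norm_coe_le_norm (f := a) n

theorem norm_le {a : BSeq} {C : ℝ} (hC : 0 ≤ C) (h : ∀ n, ‖a n‖ ≤ C) : ‖a‖ ≤ C :=
  (BoundedContinuousFunction.norm_le hC).2 h

/-- The sequence `(a 0, a 1, …)` with `0` put in front. -/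
def consZero (a : ℕ → ℂ) : ℕ → ℂ
  | 0 => 0
  | n + 1 => a n

theorem norm_consZero_le (a : BSeq) (n : ℕ) : ‖consZero a n‖ ≤ ‖a‖ := by
  cases n with
  | zero => simp [consZero]
  | succ n => exact norm_apply_le a n

/-- The right shift, that is, multiplication by the variable. -/
def shiftRight : BSeq →L[ℂ] BSeq :=
  LinearMap.mkContinuous
    { toFun := fun a => mk (consZero a) ‖a‖ (norm_consZero_le a)
      map_add' := fun a b => by ext n; cases n <;> simp [consZero]
      map_smul' := fun c a => by ext n; cases n <;> simp [consZero] } 1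
    (fun a => by
      rw [one_mul]
      exact norm_le (norm_nonneg a) (norm_consZero_le a))

@[simp] theorem shiftRight_zero (a : BSeq) : shiftRight a 0 = 0 := rfl
@[simp] theorem shiftRight_succ (a : BSeq) (n : ℕ) : shiftRight a (n + 1) = a n := rfl

theorem norm_shiftRight_le : ‖shiftRight‖ ≤ 1 := LinearMap.mkContinuous_norm_le _ zero_le_one _

theorem norm_shiftRight_pow_le (k : ℕ) : ‖shiftRight ^ k‖ ≤ 1 :=
  norm_pow_le_one_of_norm_le_one norm_shiftRight_le k

/-- The left shift. -/
def shiftLeft : BSeq →L[ℂ] BSeq :=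
  LinearMap.mkContinuous
    { toFun := fun a => mk (fun n => a (n + 1)) ‖a‖ (fun n => norm_apply_le a _)
      map_add' := fun a b => by ext n; simp
      map_smul' := fun c a => by ext n; simp } 1
    (fun a => by
      rw [one_mul]
      exact norm_le (norm_nonneg a) fun n => norm_apply_le a (n + 1))

@[simp] theorem shiftLeft_apply (a : BSeq) (n : ℕ) : shiftLeft a n = a (n + 1) := rfl

theorem shiftLeft_pow_apply (a : BSeq) (k n : ℕ) : (shiftLeft ^ k) a n = a (n + k) := by
  induction k generalizing n with
  | zero => simp
  | succ k ih =>
    rw [pow_succ', mul_apply_eq_comp, shiftLeft_apply, ih]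
    congr 1
    omega

theorem shiftRight_pow_apply_add (a : BSeq) (k n : ℕ) : (shiftRight ^ k) a (n + k) = a n := by
  induction k generalizing n with
  | zero => simp
  | succ k ih => rw [pow_succ', mul_apply_eq_comp, ← add_assoc, shiftRight_succ, ih]

theorem shiftRight_pow_apply_of_lt (a : BSeq) {k n : ℕ} (h : n < k) :
    (shiftRight ^ k) a n = 0 := by
  induction k generalizing n with
  | zero => omega
  | succ k ih =>
    rw [pow_succ', mul_apply_eq_comp]
    cases n with
    | zero => rfl
    | succ n => rw [shiftRight_succ, ih (by omega)]

/-- The sequence `(1, 0, 0, …)`. -/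
def one : BSeq := mk (fun n => if n = 0 then 1 else 0) 1 (fun n => by split_ifs <;> simp)

theorem one_apply (n : ℕ) : one n = if n = 0 then 1 else 0 := rfl

/-- The coordinate functionals. -/
def coord (n : ℕ) : BSeq →L[ℂ] ℂ := LinearMap.mkContinuous { toFun := fun a => a n, map_add' := fun _ _ => rfl, map_smul' := fun _ _ => rfl } 1
    (fun a => by rw [one_mul]; exact norm_apply_le a n)

@[simp] theorem coord_apply (n : ℕ) (a : BSeq) : coord n a = a n := rfl

theorem norm_coord_le (n : ℕ) : ‖coord n‖ ≤ 1 :=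
  ContinuousLinearMap.opNorm_le_bound _ zero_le_one fun a => by
    rw [one_mul]; exact norm_apply_le a n

/-- The evaluation `a ↦ ∑ a n * y ^ n` of bounded sequences at a point of the unit disc. -/
def eval (y : ℂ) : BSeq →L[ℂ] ℂ := ∑' n : ℕ, y ^ n • coord n

theorem norm_pow_smul_coord_le (y : ℂ) (n : ℕ) : ‖y ^ n • coord n‖ ≤ ‖y‖ ^ n := by
  rw [norm_smul, norm_pow]
  exact mul_le_of_le_one_right (by positivity) (norm_coord_le n)

theorem summable_eval {y : ℂ} (hy : ‖y‖ < 1) : Summable fun n : ℕ => y ^ n • coord n :=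
  Summable.of_norm_bounded (summable_geometric_of_lt_one (norm_nonneg _) hy)
    (norm_pow_smul_coord_le y)

theorem hasSum_eval {y : ℂ} (hy : ‖y‖ < 1) (a : BSeq) :
    HasSum (fun n : ℕ => y ^ n * a n) (eval y a) := by
  have h := (ContinuousLinearMap.apply ℂ ℂ a).hasSum (summable_eval hy).hasSum
  exact h

theorem eval_shiftRight {y : ℂ} (hy : ‖y‖ < 1) (a : BSeq) :
    eval y (shiftRight a) = y * eval y a := by
  have h := (hasSum_eval hy (shiftRight a))
  have h2 := ((hasSum_eval hy a).mul_left y)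
  refine h.unique ?_
  rw [← hasSum_nat_add_iff' 1]
  simpa [pow_succ', mul_assoc] using h2

theorem eval_shiftRight_pow {y : ℂ} (hy : ‖y‖ < 1) (k : ℕ) (a : BSeq) :
    eval y ((shiftRight ^ k) a) = y ^ k * eval y a := by
  induction k with
  | zero => simp
  | succ k ih =>
    rw [pow_succ', mul_apply_eq_comp, eval_shiftRight hy, ih, pow_succ', mul_assoc]

theorem eval_one {y : ℂ} (hy : ‖y‖ < 1) : eval y one = 1 := by
  refine (hasSum_eval hy one).unique ?_
  convert hasSum_ite_eq (0 : ℕ) (1 : ℂ) using 2 with n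
  by_cases h : n = 0 <;> simp [one_apply, h]

/-- The series defining `eval` converges in operator norm, uniformly on smaller discs, so its sum is
holomorphic as a map into the dual space. This is why `eval` is a sum of functionals and not a
pointwise sum. -/
theorem analyticAt_eval {y : ℂ} (hy : ‖y‖ < 1) : AnalyticAt ℂ eval y := by
  obtain ⟨ρ, h1, h2⟩ := exists_between hy
  have h0 : 0 ≤ ρ := (norm_nonneg _).trans h1.le
  have : DifferentiableOn ℂ eval (Metric.ball 0 ρ) := by
    refine Complex.differentiableOn_tsum_of_summable_norm (u := fun n => ρ ^ n)
      (F := fun n w => w ^ n • coord n)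
      (summable_geometric_of_lt_one h0 h2) (fun n => ?_) Metric.isOpen_ball (fun n w hw => ?_)
    · exact ((differentiable_id.pow n).smul_const (coord n)).differentiableOn
    · refine (norm_pow_smul_coord_le w n).trans (pow_le_pow_left₀ (norm_nonneg _) ?_ n)
      exact (mem_ball_zero_iff.mp hw).le
  exact this.analyticAt (Metric.isOpen_ball.mem_nhds (mem_ball_zero_iff.mpr h1))

end BSeq

/-! ### Sums of convergent power series in two variables -/

/-- Absolute convergence on the polydisc of radius `r`. -/
def ConvergesOn (f : MvPowerSeries (Fin 2) ℂ) (r : ℝ) : Prop :=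
  Summable fun n : Fin 2 →₀ ℕ => ‖MvPowerSeries.coeff n f‖ * r ^ (n 0 + n 1)

namespace ConvergesOn

variable {f g : MvPowerSeries (Fin 2) ℂ} {r : ℝ}

theorem norm_seriesTerm_le (hr : 0 ≤ r) {z : ℂ × ℂ} (hz : ‖z‖ ≤ r) (n : Fin 2 →₀ ℕ) :
    ‖seriesTerm f z n‖ ≤ ‖MvPowerSeries.coeff n f‖ * r ^ (n 0 + n 1) := by
  rw [seriesTerm, norm_mul, norm_mul, norm_pow, norm_pow, mul_assoc, pow_add]
  gcongr
  · exact (norm_fst_le z).trans hz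
  · exact (norm_snd_le z).trans hz

theorem summable (hf : ConvergesOn f r) (hr : 0 ≤ r) {z : ℂ × ℂ} (hz : ‖z‖ ≤ r) :
    Summable (seriesTerm f z) :=
  Summable.of_norm_bounded hf (norm_seriesTerm_le hr hz)

theorem summable_norm (hf : ConvergesOn f r) (hr : 0 ≤ r) {z : ℂ × ℂ} (hz : ‖z‖ ≤ r) :
    Summable fun n => ‖seriesTerm f z n‖ :=
  Summable.of_nonneg_of_le (fun _ => norm_nonneg _) (norm_seriesTerm_le hr hz) hf

/-- Multiplication by `f (x, r * ·)` as an operator on bounded sequences. -/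
def mulOp (f : MvPowerSeries (Fin 2) ℂ) (r : ℝ) (x : ℂ) : BSeq →L[ℂ] BSeq :=
  ∑' n : Fin 2 →₀ ℕ, (MvPowerSeries.coeff n f * x ^ n 0 * (r : ℂ) ^ n 1) • BSeq.shiftRight ^ n 1

theorem norm_mulOp_term_le (hr : 0 ≤ r) {x : ℂ} (hx : ‖x‖ ≤ r) (n : Fin 2 →₀ ℕ) :
    ‖(MvPowerSeries.coeff n f * x ^ n 0 * (r : ℂ) ^ n 1) • BSeq.shiftRight ^ n 1‖ ≤
      ‖MvPowerSeries.coeff n f‖ * r ^ (n 0 + n 1) := by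
  rw [norm_smul, norm_mul, norm_mul, norm_pow, norm_pow, pow_add, ← mul_assoc, Complex.norm_real,
    Real.norm_of_nonneg hr]
  refine (mul_le_of_le_one_right (by positivity) (BSeq.norm_shiftRight_pow_le _)).trans ?_
  gcongr

theorem hasSum_mulOp (hf : ConvergesOn f r) (hr : 0 ≤ r) {x : ℂ} (hx : ‖x‖ ≤ r) :
    HasSum (fun n : Fin 2 →₀ ℕ =>
      (MvPowerSeries.coeff n f * x ^ n 0 * (r : ℂ) ^ n 1) • BSeq.shiftRight ^ n 1)
      (mulOp f r x) :=
  (Summable.of_norm_bounded hf (norm_mulOp_term_le hr hx)).hasSum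

theorem analyticAt_mulOp (hf : ConvergesOn f r) (hr : 0 ≤ r) {x : ℂ} (hx : ‖x‖ < r) :
    AnalyticAt ℂ (mulOp f r) x := by
  have : DifferentiableOn ℂ (mulOp f r) (Metric.ball 0 r) := by
    refine Complex.differentiableOn_tsum_of_summable_norm (F := fun n w =>
      (MvPowerSeries.coeff n f * w ^ n 0 * (r : ℂ) ^ n 1) • BSeq.shiftRight ^ n 1) hf
      (fun n => ?_) Metric.isOpen_ball
      (fun n w hw => norm_mulOp_term_le hr (mem_ball_zero_iff.mp hw).le n)
    exact ((((differentiable_id.pow (n 0)).const_mul _).mul_const _).smul_const _).differentiableOn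
  exact this.analyticAt (Metric.isOpen_ball.mem_nhds (mem_ball_zero_iff.mpr hx))

/-- Evaluation turns the right shift into multiplication by the variable, hence the operator into
multiplication by a function. The second variable is rescaled by `r` so that sequences are evaluated
in the unit disc. -/
theorem eval_mulOp (hf : ConvergesOn f r) (hr : 0 ≤ r) {x y : ℂ} (hx : ‖x‖ ≤ r) (hy : ‖y‖ < 1)
    (a : BSeq) : BSeq.eval y (mulOp f r x a) = seriesEval f (x, r * y) * BSeq.eval y a := by
  have h1 := (ContinuousLinearMap.apply ℂ BSeq a).hasSum (hasSum_mulOp hf hr hx)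
  have h2 := (BSeq.eval y).hasSum h1
  have hz : ‖((x, r * y) : ℂ × ℂ)‖ ≤ r := by
    rw [Prod.norm_def]
    refine max_le hx ?_
    simpa [abs_of_nonneg hr] using mul_le_of_le_one_right hr hy.le
  have h3 := (hf.summable hr hz).hasSum.mul_right (BSeq.eval y a)
  have h4 : ∀ n : Fin 2 →₀ ℕ, BSeq.eval y
      (((MvPowerSeries.coeff n f * x ^ n 0 * (r : ℂ) ^ n 1) • BSeq.shiftRight ^ n 1) a) =
        seriesTerm f (x, r * y) n * BSeq.eval y a := fun n => by
    simp only [smul_apply, map_smul, BSeq.eval_shiftRight_pow hy, seriesTerm, smul_eq_mul, mul_pow]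
    ring
  exact h2.unique ((funext h4).symm ▸ h3)

/-- Applied to the sequence `BSeq.one`, `eval_mulOp` expresses the sum through two holomorphic
functions of one variable with operator values. Joint analyticity thus reduces to the theorem on
uniform limits in one variable. -/
theorem analyticAt_seriesEval (hf : ConvergesOn f r) {z : ℂ × ℂ} (hz : ‖z‖ < r) :
    AnalyticAt ℂ (seriesEval f) z := by
  have hr : 0 < r := (norm_nonneg _).trans_lt hz
  have hz1 : ‖z.1‖ < r := (norm_fst_le z).trans_lt hz
  have hz2 : ‖(r : ℂ)⁻¹ * z.2‖ < 1 := by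
    rw [norm_mul, norm_inv, Complex.norm_real, Real.norm_of_nonneg hr.le, inv_mul_lt_one₀ hr]
    exact (norm_snd_le z).trans_lt hz
  have h1 : AnalyticAt ℂ (fun w : ℂ × ℂ => mulOp f r w.1) z :=
    (analyticAt_mulOp hf hr.le hz1).comp_of_eq analyticAt_fst rfl
  have h2 : AnalyticAt ℂ (fun w : ℂ × ℂ => BSeq.eval ((r : ℂ)⁻¹ * w.2)) z :=
    (BSeq.analyticAt_eval hz2).comp_of_eq (analyticAt_const.mul analyticAt_snd) rfl
  have h3 : AnalyticAt ℂ
      (fun w : ℂ × ℂ => BSeq.eval ((r : ℂ)⁻¹ * w.2) (mulOp f r w.1 BSeq.one)) z :=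
    h2.apply_clm (h1.apply_clm analyticAt_const)
  refine h3.congr ?_
  filter_upwards [Metric.isOpen_ball.mem_nhds
    (mem_ball_zero_iff.mpr hz)] with w hw
  have hw := mem_ball_zero_iff.mp hw
  have hw2 : ‖(r : ℂ)⁻¹ * w.2‖ < 1 := by
    rw [norm_mul, norm_inv, Complex.norm_real, Real.norm_of_nonneg hr.le, inv_mul_lt_one₀ hr]
    exact (norm_snd_le w).trans_lt hw
  rw [eval_mulOp hf hr.le ((norm_fst_le w).trans hw.le) hw2, BSeq.eval_one hw2, mul_one]
  have : (r : ℂ) ≠ 0 := by exact_mod_cast hr.ne'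
  simp [mul_inv_cancel_left₀ this]

end ConvergesOn

/-! ### Convergent series and germs of analytic functions -/

theorem ConvergesOn.mono {f : MvPowerSeries (Fin 2) ℂ} {r s : ℝ} (hf : ConvergesOn f r)
    (hs : 0 < s) (hsr : s ≤ r) : ConvergesOn f s := summable_coeff_of_le hs hsr hf

theorem ConvergesOn.seriesEval_mul {f g : MvPowerSeries (Fin 2) ℂ} {r : ℝ}
    (hf : ConvergesOn f r) (hg : ConvergesOn g r) (hr : 0 ≤ r) {z : ℂ × ℂ} (hz : ‖z‖ ≤ r) :
    seriesEval (f * g) z = seriesEval f z * seriesEval g z := by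
  classical
  rw [seriesEval, seriesEval, seriesEval,
    (hf.summable hr hz).tsum_mul_tsum_eq_tsum_sum_antidiagonal (hg.summable hr hz)
      (summable_mul_of_summable_norm (hf.summable_norm hr hz) (hg.summable_norm hr hz))]
  refine tsum_congr fun n => ?_
  rw [seriesTerm, MvPowerSeries.coeff_mul, Finset.sum_mul, Finset.sum_mul]
  refine Finset.sum_congr rfl fun kl hkl => ?_
  rw [Finset.HasAntidiagonal.mem_antidiagonal] at hkl
  rw [← hkl, seriesTerm, seriesTerm, Finsupp.add_apply, Finsupp.add_apply]
  ring

theorem seriesEval_zero_right (f : MvPowerSeries (Fin 2) ℂ) :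
    seriesEval f 0 = MvPowerSeries.constantCoeff f := by
  rw [seriesEval, tsum_eq_single 0]
  · simp [seriesTerm]
  · intro n hn
    have : n 0 ≠ 0 ∨ n 1 ≠ 0 := by
      by_contra! h
      exact hn (by ext i; fin_cases i <;> simp [h])
    rcases this with h | h <;> simp [seriesTerm, h]

/-- The exponent of the monomial `x ^ i * y ^ j`. -/
def monomialExp : ℕ × ℕ ≃ (Fin 2 →₀ ℕ) where
  toFun p := Finsupp.single 0 p.1 + Finsupp.single 1 p.2
  invFun n := (n 0, n 1)
  left_inv p := by simp
  right_inv n := by ext i; fin_cases i <;> simp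

@[simp] theorem monomialExp_apply_zero (p : ℕ × ℕ) : monomialExp p 0 = p.1 := by
  simp [monomialExp]

@[simp] theorem monomialExp_apply_one (p : ℕ × ℕ) : monomialExp p 1 = p.2 := by
  simp [monomialExp]

/-- A power series in one variable that vanishes near the origin is zero. -/
theorem eq_zero_of_hasSum_eventually_zero {b : ℕ → ℂ}
    (h : ∀ᶠ y in 𝓝 (0 : ℂ), HasSum (fun n => y ^ n * b n) 0) (n : ℕ) : b n = 0 := by
  have hp : HasFPowerSeriesAt (fun _ : ℂ => (0 : ℂ)) (FormalMultilinearSeries.ofScalars ℂ b) 0 := by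
    rw [hasFPowerSeriesAt_iff]
    filter_upwards [h] with y hy
    simpa using hy
  have h0 := hp.eq_zero
  have := congrArg (fun p => FormalMultilinearSeries.coeff p n) h0
  rw [FormalMultilinearSeries.coeff_ofScalars] at this
  exact this

theorem ConvergesOn.hasSum_prod {f : MvPowerSeries (Fin 2) ℂ} {r : ℝ} (hf : ConvergesOn f r)
    (hr : 0 ≤ r) {z : ℂ × ℂ} (hz : ‖z‖ ≤ r) :
    HasSum (fun p : ℕ × ℕ => MvPowerSeries.coeff (monomialExp p) f * z.1 ^ p.1 * z.2 ^ p.2)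
      (seriesEval f z) := by
  have h := monomialExp.hasSum_iff.mpr (hf.summable hr hz).hasSum
  refine h.congr_fun ?_ |> id
  intro p
  simp [seriesTerm]

/-- A convergent power series whose sum vanishes near the origin is zero. -/
theorem ConvergesOn.eq_zero {f : MvPowerSeries (Fin 2) ℂ} {r : ℝ} (hf : ConvergesOn f r)
    (hr : 0 < r) (h : ∀ᶠ z in 𝓝 (0 : ℂ × ℂ), seriesEval f z = 0) : f = 0 := by
  have h1 : ∀ᶠ z : ℂ × ℂ in 𝓝 (0 : ℂ) ×ˢ 𝓝 (0 : ℂ), seriesEval f z = 0 := by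
    rwa [← nhds_prod_eq]
  have hball : ∀ᶠ z : ℂ × ℂ in 𝓝 (0 : ℂ) ×ˢ 𝓝 (0 : ℂ), ‖z‖ < r := by
    rw [← nhds_prod_eq]
    filter_upwards [Metric.ball_mem_nhds (0 : ℂ × ℂ) hr] with z hz using mem_ball_zero_iff.mp hz
  -- Regrouping by powers of y, the inner sums are the Taylor coefficients in y of the zero
  -- function. Each is a power series in x that vanishes near 0, so the argument repeats in x.
  have h2 : ∀ᶠ x in 𝓝 (0 : ℂ), ∀ j : ℕ,
      HasSum (fun i => x ^ i * MvPowerSeries.coeff (monomialExp (i, j)) f) 0 := by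
    filter_upwards [(h1.and hball).curry] with x hx
    have hs : ∀ y : ℂ, ‖(x, y)‖ < r → ∀ j : ℕ,
        Summable fun i => MvPowerSeries.coeff (monomialExp (i, j)) f * x ^ i * y ^ j := by
      intro y hy j
      have := (Equiv.prodComm ℕ ℕ).summable_iff.mpr (hf.hasSum_prod hr.le hy.le).summable
      exact this.prod_factor j
    -- Convergence of the double series at a point with y ≠ 0 lets the factor y ^ j be cancelled,
    -- which gives convergence of each inner series.
    obtain ⟨y0, hy0, hy0'⟩ : ∃ y : ℂ, y ≠ 0 ∧ ‖(x, y)‖ < r := by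
      have h3 : ∀ᶠ y in 𝓝[≠] (0 : ℂ), ‖(x, y)‖ < r :=
        nhdsWithin_le_nhds (hx.mono fun y hy => hy.2)
      exact ((h3.and self_mem_nhdsWithin).exists).imp fun y hy => ⟨hy.2, hy.1⟩
    have hs' : ∀ j : ℕ, Summable fun i => x ^ i * MvPowerSeries.coeff (monomialExp (i, j)) f := by
      intro j
      have := (hs y0 hy0' j).mul_right ((y0 ^ j)⁻¹)
      refine this.congr fun i => ?_
      rw [mul_inv_cancel_right₀ (pow_ne_zero j hy0), mul_comm]
    intro j
    suffices h4 : ∀ j, ∑' i, x ^ i * MvPowerSeries.coeff (monomialExp (i, j)) f = 0 by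
      rw [← h4 j]; exact (hs' j).hasSum
    refine eq_zero_of_hasSum_eventually_zero ?_
    filter_upwards [hx] with y hy
    have h5 := (Equiv.prodComm ℕ ℕ).hasSum_iff.mpr (hf.hasSum_prod hr.le hy.2.le)
    rw [hy.1] at h5
    have h6 := h5.prod_fiberwise (g := fun j =>
      y ^ j * ∑' i, x ^ i * MvPowerSeries.coeff (monomialExp (i, j)) f) (fun j => ?_)
    · exact h6
    · refine ((hs' j).hasSum.mul_left (y ^ j)).congr_fun ?_ |> id
      intro i
      simp [mul_comm, mul_left_comm]
  ext n
  obtain ⟨⟨i, j⟩, rfl⟩ := monomialExp.surjective n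
  simpa using eq_zero_of_hasSum_eventually_zero (h2.mono fun x hx => hx j) i

/-- Every germ of an analytic function is the sum of a convergent power series. -/
theorem AnalyticAt.exists_convergesOn {f : ℂ × ℂ → ℂ} (hf : AnalyticAt ℂ f 0) :
    ∃ (F : MvPowerSeries (Fin 2) ℂ) (r : ℝ), 0 < r ∧ ConvergesOn F r ∧
      ∀ᶠ z in 𝓝 (0 : ℂ × ℂ), f z = seriesEval F z := by
  obtain ⟨p, hp⟩ := hf
  obtain ⟨R, hR⟩ := hp
  -- Expanding the n-th multilinear term in the two coordinates costs a factor 2 ^ n, the sum of the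
  -- binomial coefficients in `hcs`; hence the convergence at radius `2 * r`.
  obtain ⟨r, hr0, hr⟩ : ∃ r : NNReal, 0 < r ∧ ((2 * r : NNReal) : ENNReal) < R := by
    obtain ⟨s, hs0, hs⟩ := ENNReal.lt_iff_exists_nnreal_btwn.mp hR.r_pos
    refine ⟨s / 2, ?_, ?_⟩
    · exact half_pos (by exact_mod_cast hs0)
    · rwa [mul_div_cancel₀ s two_ne_zero]
  have hsum : Summable fun n => ‖p n‖ * ((2 * r : NNReal) : ℝ) ^ n :=
    p.summable_norm_mul_pow (hr.trans_le hR.r_le)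
  let T : (n : ℕ) → Finset (Fin n) → ℂ := fun n s =>
    p n (s.piecewise (fun _ => ((1, 0) : ℂ × ℂ)) (fun _ => ((0, 1) : ℂ × ℂ)))
  have hT : ∀ n s, ‖T n s‖ ≤ ‖p n‖ := by
    intro n s
    refine ((p n).le_opNorm _).trans (mul_le_of_le_one_right (norm_nonneg _) ?_)
    refine Finset.prod_le_one (fun _ _ => norm_nonneg _) fun i _ => ?_
    by_cases hi : i ∈ s <;> simp [hi, Prod.norm_def]
  -- The coefficient of x ^ i * y ^ j collects all ways to put the first basis vector into i of the
  -- i + j slots; no symmetry of `p` is needed.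
  let c : ℕ × ℕ → ℂ := fun q =>
    ∑ s ∈ Finset.powersetCard q.1 (Finset.univ : Finset (Fin (q.1 + q.2))), T (q.1 + q.2) s
  have hc : ∀ q, ‖c q‖ ≤ (q.1 + q.2).choose q.1 * ‖p (q.1 + q.2)‖ := by
    intro q
    refine (norm_sum_le_of_le _ fun s _ => hT _ s).trans ?_
    simp
  have hcs : ∀ n : ℕ, ∑ q ∈ Finset.HasAntidiagonal.antidiagonal n, ‖c q‖ ≤ 2 ^ n * ‖p n‖ := by
    intro n
    calc ∑ q ∈ Finset.HasAntidiagonal.antidiagonal n, ‖c q‖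
        ≤ ∑ q ∈ Finset.HasAntidiagonal.antidiagonal n, ((n.choose q.1 : ℕ) : ℝ) * ‖p n‖ := by
          refine Finset.sum_le_sum fun q hq => ?_
          have := hc q
          rwa [Finset.HasAntidiagonal.mem_antidiagonal.mp hq] at this
      _ = 2 ^ n * ‖p n‖ := by
          rw [← Finset.sum_mul, ← Nat.cast_sum, Finset.Nat.sum_antidiagonal_eq_sum_range_succ_mk,
            Nat.sum_range_choose]
          simp
  have hpz : ∀ (n : ℕ) (z : ℂ × ℂ), (p n fun _ => z) =
      ∑ q ∈ Finset.HasAntidiagonal.antidiagonal n, c q * z.1 ^ q.1 * z.2 ^ q.2 := by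
    intro n z
    have hz : (fun _ : Fin n => z) = (fun _ => (z.1, (0 : ℂ))) + fun _ => ((0 : ℂ), z.2) := by
      ext <;> simp
    rw [hz, (p n).map_add_univ]
    have h1 : ∀ s : Finset (Fin n),
        p n (s.piecewise (fun _ => (z.1, (0 : ℂ))) fun _ => ((0 : ℂ), z.2)) =
          z.1 ^ s.card * z.2 ^ (n - s.card) * T n s := by
      intro s
      have h2 : (s.piecewise (fun _ => (z.1, (0 : ℂ))) fun _ => ((0 : ℂ), z.2)) =
          fun i => (s.piecewise (fun _ => z.1) (fun _ => z.2) : Fin n → ℂ) i •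
            (s.piecewise (fun _ => ((1, 0) : ℂ × ℂ)) (fun _ => ((0, 1) : ℂ × ℂ))
              : Fin n → ℂ × ℂ) i := by
        funext i
        by_cases hi : i ∈ s <;> simp [hi]
      rw [h2, (p n).map_smul_univ, smul_eq_mul]
      congr 1
      rw [Finset.prod_piecewise]
      simp [← Finset.compl_eq_univ_sdiff, Finset.card_compl]
    rw [Finset.sum_congr rfl fun s _ => h1 s, ← Finset.powerset_univ, Finset.sum_powerset,
      Finset.Nat.sum_antidiagonal_eq_sum_range_succ_mk]
    simp only [Finset.card_univ, Fintype.card_fin]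
    refine Finset.sum_congr rfl fun k hk => ?_
    have hk : k ≤ n := by simpa [Nat.lt_succ_iff] using hk
    have hck : c (k, n - k) = ∑ s ∈ Finset.powersetCard k (Finset.univ : Finset (Fin n)), T n s := by
      have : k + (n - k) = n := by omega
      simp only [c]
      rw [this]
    rw [hck, Finset.sum_mul, Finset.sum_mul]
    refine Finset.sum_congr rfl fun s hs => ?_
    rw [(Finset.mem_powersetCard.mp hs).2]
    ring
  have hr' : (0 : ℝ) < r := hr0
  let F : MvPowerSeries (Fin 2) ℂ := fun n => c (n 0, n 1)
  have hF : ∀ q, MvPowerSeries.coeff (monomialExp q) F = c q := fun q => by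
    change c (monomialExp q 0, monomialExp q 1) = c q
    simp
  have hsp : Summable fun q : ℕ × ℕ => ‖c q‖ * (r : ℝ) ^ (q.1 + q.2) := by
    rw [← Finset.HasAntidiagonal.sigmaAntidiagonalEquivProd.summable_iff, summable_sigma_of_nonneg]
    · refine ⟨fun n => Summable.of_finite, ?_⟩
      refine Summable.of_nonneg_of_le (fun n => tsum_nonneg fun q => ?_) (fun n => ?_) hsum
      · dsimp; positivity
      · rw [tsum_fintype]
        refine (Finset.sum_coe_sort (Finset.HasAntidiagonal.antidiagonal n)
          (fun q => ‖c q‖ * (r : ℝ) ^ (q.1 + q.2))).le.trans ?_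
        have : ∀ q ∈ Finset.HasAntidiagonal.antidiagonal n, ‖c q‖ * (r : ℝ) ^ (q.1 + q.2) = ‖c q‖ * (r : ℝ) ^ n :=
          fun q hq => by rw [Finset.HasAntidiagonal.mem_antidiagonal.mp hq]
        rw [Finset.sum_congr rfl this, ← Finset.sum_mul]
        refine (mul_le_mul_of_nonneg_right (hcs n) (by positivity)).trans (le_of_eq ?_)
        push_cast
        ring
    · intro q; dsimp; positivity
  have hconv : ConvergesOn F r := by
    refine (monomialExp.summable_iff).mp (hsp.congr fun q => ?_)
    simp [hF]
  refine ⟨F, r, hr', hconv, ?_⟩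
  have hmem : Metric.eball (0 : ℂ × ℂ) (r : ENNReal) ∈ 𝓝 (0 : ℂ × ℂ) :=
    Metric.eball_mem_nhds _ (by exact_mod_cast hr0)
  filter_upwards [hmem] with z hz
  have hz' : ‖z‖ ≤ (r : ℝ) := by
    have : ‖z‖ < (r : ℝ) := by simpa using hz
    exact this.le
  have hzR : z ∈ Metric.eball (0 : ℂ × ℂ) R := by
    refine Metric.eball_subset_eball ?_ hz
    refine le_trans ?_ hr.le
    exact_mod_cast le_mul_of_one_le_left r.2 one_le_two
  have h1 := hR.hasSum hzR
  rw [zero_add] at h1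
  simp only [hpz] at h1
  have h2 := hconv.hasSum_prod hr'.le hz'
  simp only [hF] at h2
  have h3 := (Finset.HasAntidiagonal.sigmaAntidiagonalEquivProd.hasSum_iff.mpr h2).sigma
    (fun n => hasSum_fintype _)
  refine h1.unique (h3.congr_fun ?_ |> id)
  intro n
  rw [← Finset.sum_coe_sort]
  rfl

/-! ### Units, factorization and divisibility by x of convergent series -/

namespace ConvergentSeries

theorem exists_convergesOn (f : ConvergentSeries ℂ) : ∃ r, 0 < r ∧ ConvergesOn f.1 r := f.2

theorem analyticAt_seriesEval (f : ConvergentSeries ℂ) : AnalyticAt ℂ (seriesEval f.1) 0 := by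
  obtain ⟨r, hr, hf⟩ := exists_convergesOn f
  exact hf.analyticAt_seriesEval (by simpa using hr)

theorem eventually_seriesEval_mul (f g : ConvergentSeries ℂ) :
    ∀ᶠ z in 𝓝 (0 : ℂ × ℂ), seriesEval (f * g).1 z = seriesEval f.1 z * seriesEval g.1 z := by
  obtain ⟨r, hr, hf⟩ := exists_convergesOn f
  obtain ⟨s, hs, hg⟩ := exists_convergesOn g
  have hm := lt_min hr hs
  filter_upwards [Metric.ball_mem_nhds (0 : ℂ × ℂ) hm] with z hz
  exact (hf.mono hm (min_le_left _ _)).seriesEval_mul (hg.mono hm (min_le_right _ _)) hm.le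
    (mem_ball_zero_iff.mp hz).le

theorem ext_of_eventuallyEq {f g : ConvergentSeries ℂ}
    (h : ∀ᶠ z in 𝓝 (0 : ℂ × ℂ), seriesEval f.1 z = seriesEval g.1 z) : f = g := by
  obtain ⟨r, hr, hf⟩ := exists_convergesOn f
  obtain ⟨s, hs, hg⟩ := exists_convergesOn g
  obtain ⟨t, ht, hfg⟩ := exists_convergesOn (f - g)
  have h0 : (f - g).1 = 0 := by
    refine hfg.eq_zero ht ?_
    filter_upwards [h, Metric.ball_mem_nhds (0 : ℂ × ℂ) hr, Metric.ball_mem_nhds (0 : ℂ × ℂ) hs]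
      with z hz hzr hzs
    have h1 := hf.summable hr.le (mem_ball_zero_iff.mp hzr).le
    have h2 := hg.summable hs.le (mem_ball_zero_iff.mp hzs).le
    have h3 : seriesEval (f - g).1 z = seriesEval f.1 z - seriesEval g.1 z := by
      rw [seriesEval, seriesEval, seriesEval, ← h1.tsum_sub h2]
      refine tsum_congr fun n => ?_
      simp [seriesTerm, sub_mul]
    rw [h3, hz, sub_self]
  exact sub_eq_zero.mp (Subtype.ext h0)

theorem exists_of_analyticAt {f : ℂ × ℂ → ℂ} (hf : AnalyticAt ℂ f 0) :
    ∃ F : ConvergentSeries ℂ, ∀ᶠ z in 𝓝 (0 : ℂ × ℂ), f z = seriesEval F.1 z := by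
  obtain ⟨F, r, hr, hF, h⟩ := hf.exists_convergesOn
  exact ⟨⟨F, r, hr, hF⟩, h⟩

theorem seriesEval_one (z : ℂ × ℂ) : seriesEval (1 : ConvergentSeries ℂ).1 z = 1 := by
  classical
  rw [seriesEval, tsum_eq_single 0]
  · simp [seriesTerm]
  · intro n hn
    simp [seriesTerm, MvPowerSeries.coeff_one, hn]

theorem constantCoeff_ne_zero_of_isUnit {f : ConvergentSeries ℂ} (hf : IsUnit f) :
    seriesEval f.1 0 ≠ 0 := by
  rw [seriesEval_zero_right]
  exact ((hf.map (ConvergentSeries ℂ).subtype).map MvPowerSeries.constantCoeff).ne_zero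

theorem coeff_complexify (f : ConvergentSeries ℝ) (n : Fin 2 →₀ ℕ) :
    MvPowerSeries.coeff n (complexify f).1 = ((MvPowerSeries.coeff n f.1 : ℝ) : ℂ) := rfl

theorem seriesEval_complexify_star (f : ConvergentSeries ℝ) (z : ℂ × ℂ) :
    seriesEval (complexify f).1 (star z) = star (seriesEval (complexify f).1 z) := by
  rw [seriesEval, seriesEval, tsum_star]
  refine tsum_congr fun n => ?_
  simp [seriesTerm, coeff_complexify, mul_comm, mul_left_comm]

/-- The reciprocal of the sum is analytic, so it has a convergent expansion over ℂ. Uniqueness of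
inverses among formal series identifies it with the formal inverse of the real series, which is
therefore convergent. -/
theorem isUnit_of_constantCoeff_ne_zero {f : ConvergentSeries ℝ}
    (hf : MvPowerSeries.constantCoeff f.1 ≠ 0) : IsUnit f := by
  have h0 : seriesEval (complexify f).1 0 ≠ 0 := by
    rw [seriesEval_zero_right, ← MvPowerSeries.coeff_zero_eq_constantCoeff_apply, coeff_complexify]
    exact_mod_cast hf
  have ha := analyticAt_seriesEval (complexify f)
  obtain ⟨G, hG⟩ := exists_of_analyticAt (ha.inv h0)
  have h1 : complexify f * G = 1 := by
    refine ext_of_eventuallyEq ?_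
    filter_upwards [hG, eventually_seriesEval_mul (complexify f) G,
      ha.continuousAt.eventually_ne h0] with z hz hz2 hz3
    rw [hz2, ← hz, seriesEval_one]
    exact mul_inv_cancel₀ hz3
  have h2 : MvPowerSeries.map (σ := Fin 2) Complex.ofRealHom f.1⁻¹ = G.1 := by
    have h3 : (complexify f).1 * MvPowerSeries.map (σ := Fin 2) Complex.ofRealHom f.1⁻¹ = 1 := by
      change MvPowerSeries.map (σ := Fin 2) Complex.ofRealHom f.1 * _ = 1
      rw [← map_mul, MvPowerSeries.mul_inv_cancel _ hf, map_one]
    have h4 : G.1 * (complexify f).1 = 1 := by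
      rw [mul_comm]; exact congrArg Subtype.val h1
    exact (left_inv_eq_right_inv h4 h3).symm
  obtain ⟨r, hr, hGr⟩ := exists_convergesOn G
  refine IsUnit.of_mul_eq_one (⟨f.1⁻¹, r, hr, hGr.congr fun n => ?_⟩ : ConvergentSeries ℝ)
    (Subtype.ext (MvPowerSeries.mul_inv_cancel _ hf))
  rw [← h2]
  simp

/-- A nonunit has order at least one, so the order of vanishing grows strictly under proper
divisibility. This provides factorizations into irreducibles; their uniqueness plays no role. -/
instance : WfDvdMonoid (ConvergentSeries ℝ) where
  wf := by
    refine Subrelation.wf (r := fun a b => a.1.order < b.1.order) ?_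
      (InvImage.wf (fun a : ConvergentSeries ℝ => a.1.order) wellFounded_lt)
    rintro a b ⟨ha, x, hx, rfl⟩
    have h1 : (1 : ℕ∞) ≤ x.1.order := by
      rw [MvPowerSeries.one_le_order_iff_constCoeff_eq_zero]
      by_contra h
      exact hx (isUnit_of_constantCoeff_ne_zero h)
    have h2 : a.1.order ≠ ⊤ := fun h => ha (Subtype.ext (MvPowerSeries.order_eq_top_iff.mp h))
    calc a.1.order < a.1.order + 1 := (ENat.lt_add_one_iff h2).mpr le_rfl
      _ ≤ a.1.order + x.1.order := by gcongr
      _ ≤ (a * x).1.order := MvPowerSeries.le_order_mul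

/-- The series `x`. -/
def X (𝕜 : Type) [RCLike 𝕜] : ConvergentSeries 𝕜 :=
  ⟨MvPowerSeries.X 0, 1, one_pos, by
    classical
    refine summable_of_ne_finset_zero (s := {Finsupp.single 0 1}) fun n hn => ?_
    have : n ≠ Finsupp.single 0 1 := by simpa using hn
    simp [MvPowerSeries.coeff_X, this]⟩

theorem complexify_X : complexify (X ℝ) = X ℂ :=
  Subtype.ext (MvPowerSeries.map_X Complex.ofRealHom 0)

theorem seriesEval_X (z : ℂ × ℂ) : seriesEval (X ℂ).1 z = z.1 := by
  classical
  rw [seriesEval, tsum_eq_single (Finsupp.single 0 1)]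
  · simp [seriesTerm, X]
  · intro n hn
    simp [seriesTerm, X, MvPowerSeries.coeff_X, hn]

/-- The formal quotient has the same coefficients with shifted index, and the shift costs only a
factor `r⁻¹` in the convergence estimate. -/
theorem X_dvd {𝕜 : Type} [RCLike 𝕜] {f : ConvergentSeries 𝕜}
    (h : ∀ j, MvPowerSeries.coeff (monomialExp (0, j)) f.1 = 0) : X 𝕜 ∣ f := by
  have h1 : (MvPowerSeries.X 0 : MvPowerSeries (Fin 2) 𝕜) ∣ f.1 := by
    rw [MvPowerSeries.X_dvd_iff]
    intro m hm
    obtain ⟨⟨i, j⟩, rfl⟩ := monomialExp.surjective m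
    obtain rfl : i = 0 := by simpa using hm
    exact h j
  obtain ⟨H, hH⟩ := h1
  obtain ⟨r, hr, hf⟩ := f.2
  have hc : ∀ n, MvPowerSeries.coeff n H =
      MvPowerSeries.coeff (Finsupp.single 0 1 + n) f.1 := by
    intro n
    rw [hH, MvPowerSeries.X, MvPowerSeries.coeff_add_monomial_mul, one_mul]
  have hs : Summable fun n : Fin 2 →₀ ℕ => ‖MvPowerSeries.coeff n H‖ * r ^ (n 0 + n 1) := by
    have h2 := (hf.comp_injective (add_right_injective (Finsupp.single (0 : Fin 2) 1))).mul_left r⁻¹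
    refine h2.congr fun n => ?_
    have : (Finsupp.single (0 : Fin 2) 1 + n : Fin 2 →₀ ℕ) 0 +
        (Finsupp.single (0 : Fin 2) 1 + n : Fin 2 →₀ ℕ) 1 = 1 + (n 0 + n 1) := by
      simp [add_assoc]
    simp only [Function.comp, this, hc]
    rw [pow_add, pow_one]
    field_simp
  exact ⟨⟨H, r, hr, hs⟩, Subtype.ext hH⟩

/-- A nonzero series is a power of `x` times a series that `x` does not divide. -/
theorem exists_eq_X_pow_mul {f : ConvergentSeries ℝ} (hf : f ≠ 0) :
    ∃ (a : ℕ) (g : ConvergentSeries ℝ), f = X ℝ ^ a * g ∧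
      ∃ j, MvPowerSeries.coeff (monomialExp (0, j)) g.1 ≠ 0 := by
  have hX : ¬ IsUnit (X ℝ) := by
    intro h
    have := ((h.map (ConvergentSeries ℝ).subtype).map MvPowerSeries.constantCoeff).ne_zero
    simp [X] at this
  obtain ⟨a, g, hg, h⟩ := WfDvdMonoid.max_power_factor' hf hX
  refine ⟨a, g, h, ?_⟩
  by_contra! h2
  exact hg (X_dvd h2)

end ConvergentSeries

theorem ConvergesOn.hasSum_zero_left {f : MvPowerSeries (Fin 2) ℂ} {r : ℝ} (hf : ConvergesOn f r)
    (hr : 0 ≤ r) {y : ℂ} (hy : ‖y‖ ≤ r) :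
    HasSum (fun j : ℕ => y ^ j * MvPowerSeries.coeff (monomialExp (0, j)) f)
      (seriesEval f (0, y)) := by
  have hz : ‖((0, y) : ℂ × ℂ)‖ ≤ r := by
    rw [Prod.norm_def]
    exact max_le (by simpa using hr) hy
  have h := hf.hasSum_prod hr hz
  have hinj : Function.Injective fun j : ℕ => ((0, j) : ℕ × ℕ) := fun a b h => by simpa using h
  rw [← hinj.hasSum_iff] at h
  · refine h.congr_fun ?_ |> id
    intro j
    simp [mul_comm]
  · rintro ⟨i, j⟩ hij
    have : i ≠ 0 := fun h => hij ⟨j, by simp [h]⟩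
    simp [this]

namespace ConvergentSeries

theorem eventually_zero_left_iff (f : ConvergentSeries ℂ) :
    (∀ᶠ y in 𝓝 (0 : ℂ), seriesEval f.1 (0, y) = 0) ↔
      ∀ j, MvPowerSeries.coeff (monomialExp (0, j)) f.1 = 0 := by
  obtain ⟨r, hr, hf⟩ := exists_convergesOn f
  have hb : ∀ᶠ y in 𝓝 (0 : ℂ), ‖y‖ ≤ r := by
    filter_upwards [Metric.ball_mem_nhds (0 : ℂ) hr] with y hy using (mem_ball_zero_iff.mp hy).le
  constructor
  · intro h
    refine eq_zero_of_hasSum_eventually_zero ?_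
    filter_upwards [h, hb] with y hy hyr
    rw [← hy]
    exact hf.hasSum_zero_left hr.le hyr
  · intro h
    filter_upwards [hb] with y hyr
    refine (hf.hasSum_zero_left hr.le hyr).unique ?_
    simp [h]

end ConvergentSeries

/-! ### Division of germs by the coordinates -/

theorem AnalyticAt.exists_eq_fst_mul {g : ℂ × ℂ → ℂ} (hg : AnalyticAt ℂ g 0)
    (h : ∀ᶠ y in 𝓝 (0 : ℂ), g (0, y) = 0) :
    ∃ g' : ℂ × ℂ → ℂ, AnalyticAt ℂ g' 0 ∧ ∀ᶠ z in 𝓝 (0 : ℂ × ℂ), g z = z.1 * g' z := by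
  obtain ⟨F, hF⟩ := ConvergentSeries.exists_of_analyticAt hg
  have hc : Filter.Tendsto (fun y : ℂ => ((0, y) : ℂ × ℂ)) (𝓝 0) (𝓝 0) :=
    (Continuous.prodMk_right (0 : ℂ)).tendsto' _ _ rfl
  obtain ⟨H, rfl⟩ := ConvergentSeries.X_dvd ((ConvergentSeries.eventually_zero_left_iff F).mp (by
    filter_upwards [h, hc.eventually hF] with y h1 h2
    rw [← h2, h1]))
  refine ⟨seriesEval H.1, ConvergentSeries.analyticAt_seriesEval H, ?_⟩
  filter_upwards [hF, ConvergentSeries.eventually_seriesEval_mul (ConvergentSeries.X ℂ) H]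
    with z h1 h2
  rw [h1, h2, ConvergentSeries.seriesEval_X]

theorem AnalyticAt.comp_swap {g : ℂ × ℂ → ℂ} (hg : AnalyticAt ℂ g 0) :
    AnalyticAt ℂ (fun z : ℂ × ℂ => g z.swap) 0 :=
  hg.comp_of_eq (analyticAt_snd.prod analyticAt_fst) rfl

theorem tendsto_swap_zero : Filter.Tendsto (Prod.swap : ℂ × ℂ → ℂ × ℂ) (𝓝 0) (𝓝 0) :=
  continuous_swap.tendsto' _ _ rfl

theorem AnalyticAt.exists_eq_snd_mul {g : ℂ × ℂ → ℂ} (hg : AnalyticAt ℂ g 0)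
    (h : ∀ᶠ x in 𝓝 (0 : ℂ), g (x, 0) = 0) :
    ∃ g' : ℂ × ℂ → ℂ, AnalyticAt ℂ g' 0 ∧ ∀ᶠ z in 𝓝 (0 : ℂ × ℂ), g z = z.2 * g' z := by
  obtain ⟨g', hg', h'⟩ := hg.comp_swap.exists_eq_fst_mul h
  refine ⟨fun z => g' z.swap, hg'.comp_swap, ?_⟩
  filter_upwards [tendsto_swap_zero.eventually h'] with z hz
  simpa using hz

/-! ### Orders, real germs and the blow-up maps -/

/-- `h (0, y)` vanishes to order exactly `d` at `y = 0`. -/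
def HasRegOrder (h : ℂ × ℂ → ℂ) (d : ℕ) : Prop :=
  ∃ b : ℂ → ℂ, AnalyticAt ℂ b 0 ∧ b 0 ≠ 0 ∧ ∀ᶠ y in 𝓝 (0 : ℂ), h (0, y) = y ^ d * b y

/-- The germ of `h` at the origin commutes with complex conjugation. -/
def IsRealGerm (h : ℂ × ℂ → ℂ) : Prop := ∀ᶠ z in 𝓝 (0 : ℂ × ℂ), h (star z) = star (h z)

/-- The blow-up of the origin in coordinates centered at the point of the exceptional curve with
slope `c`, or at the vertical direction; the exceptional curve is `{w.1 = 0}`. -/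
def blowMap : Option ℂ → ℂ × ℂ → ℂ × ℂ
  | some c, w => (w.1, w.1 * (w.2 + c))
  | none, w => (w.1 * w.2, w.1)

@[simp] theorem blowMap_some (c : ℂ) (w : ℂ × ℂ) :
    blowMap (some c) w = (w.1, w.1 * (w.2 + c)) := rfl

@[simp] theorem blowMap_none (w : ℂ × ℂ) : blowMap none w = (w.1 * w.2, w.1) := rfl

theorem analyticAt_blowMap (c : Option ℂ) (w : ℂ × ℂ) : AnalyticAt ℂ (blowMap c) w := by
  cases c with
  | none => exact (analyticAt_fst.mul analyticAt_snd).prod analyticAt_fst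
  | some c => exact analyticAt_fst.prod (analyticAt_fst.mul (analyticAt_snd.add analyticAt_const))

theorem continuous_blowMap (c : Option ℂ) : Continuous (blowMap c) :=
  continuous_iff_continuousAt.mpr fun w => (analyticAt_blowMap c w).continuousAt

@[simp] theorem blowMap_zero_left (c : Option ℂ) (v : ℂ) : blowMap c (0, v) = 0 := by
  cases c <;> simp

@[simp] theorem blowMap_zero (c : Option ℂ) : blowMap c 0 = 0 := blowMap_zero_left c 0

theorem tendsto_blowMap (c : Option ℂ) : Filter.Tendsto (blowMap c) (𝓝 0) (𝓝 0) :=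
  (continuous_blowMap c).tendsto' _ _ (blowMap_zero c)

theorem blowMap_star {c : Option ℂ} (hc : c.map star = c) (w : ℂ × ℂ) :
    blowMap c (star w) = star (blowMap c w) := by
  cases c with
  | none => ext <;> simp
  | some c =>
    have : star c = c := by simpa using hc
    ext
    · simp
    · simp only [blowMap_some, Prod.fst_star, Prod.snd_star, star_mul', star_add, this]

theorem tendsto_prodMk_zero : Filter.Tendsto (fun y : ℂ => ((0, y) : ℂ × ℂ)) (𝓝 0) (𝓝 0) :=
  (Continuous.prodMk_right (0 : ℂ)).tendsto' _ _ rfl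

theorem tendsto_prodMk_zero' : Filter.Tendsto (fun x : ℂ => ((x, 0) : ℂ × ℂ)) (𝓝 0) (𝓝 0) :=
  (Continuous.prodMk_left (0 : ℂ)).tendsto' _ _ rfl

theorem AnalyticAt.comp_prodMk_zero {h : ℂ × ℂ → ℂ} (hh : AnalyticAt ℂ h 0) :
    AnalyticAt ℂ (fun y => h (0, y)) 0 :=
  hh.comp_of_eq (analyticAt_const.prod analyticAt_id) rfl

theorem AnalyticAt.comp_prodMk_zero' {h : ℂ × ℂ → ℂ} (hh : AnalyticAt ℂ h 0) :
    AnalyticAt ℂ (fun x => h (x, 0)) 0 :=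
  hh.comp_of_eq (analyticAt_id.prod analyticAt_const) rfl

theorem tendsto_star_zero : Filter.Tendsto (star : ℂ × ℂ → ℂ × ℂ) (𝓝 0) (𝓝 0) :=
  continuous_star.tendsto' _ _ (star_zero _)

/-! ### Cancellation -/

/-- By continuity a disagreement would persist on an open set, and no nonempty open set lies in `w.1
= 0`. -/
theorem eventually_eq_zero_fst_of_punctured {F G : ℂ × ℂ → ℂ}
    (hF : ∀ᶠ w in 𝓝 (0 : ℂ × ℂ), ContinuousAt F w) (hG : ∀ᶠ w in 𝓝 (0 : ℂ × ℂ), ContinuousAt G w)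
    (h : ∀ᶠ w in 𝓝 (0 : ℂ × ℂ), w.1 ≠ 0 → F w = G w) : ∀ᶠ w in 𝓝 (0 : ℂ × ℂ), F w = G w := by
  filter_upwards [hF, hG, h.eventually_nhds] with w hFw hGw hw
  by_contra hne
  have h1 : ∀ᶠ z in 𝓝 w, F z ≠ G z := 
    (hFw.prodMk hGw).eventually ((isOpen_ne_fun continuous_fst continuous_snd).mem_nhds hne)
  have h2 : ∀ᶠ z in 𝓝 w, z.1 = 0 := by
    filter_upwards [h1, hw] with z hz1 hz2
    by_contra hz
    exact hz1 (hz2 hz)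
  have h3 : Filter.Tendsto (fun t : ℂ => ((w.1 + t, w.2) : ℂ × ℂ)) (𝓝[≠] 0) (𝓝 w) := by
    refine tendsto_nhdsWithin_of_tendsto_nhds ?_
    exact Continuous.tendsto' (by fun_prop) _ _ (by simp)
  obtain ⟨t, ht, ht0⟩ := ((h3.eventually h2).and self_mem_nhdsWithin).exists
  have := h2.self_of_nhds
  simp_all

theorem eventually_eq_of_pow_mul_eq {F G : ℂ × ℂ → ℂ} {M : ℕ}
    (hF : ∀ᶠ w in 𝓝 (0 : ℂ × ℂ), ContinuousAt F w) (hG : ∀ᶠ w in 𝓝 (0 : ℂ × ℂ), ContinuousAt G w)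
    (h : ∀ᶠ w in 𝓝 (0 : ℂ × ℂ), w.1 ^ M * F w = w.1 ^ M * G w) :
    ∀ᶠ w in 𝓝 (0 : ℂ × ℂ), F w = G w :=
  eventually_eq_zero_fst_of_punctured hF hG
    (h.mono fun _ hw hw0 => mul_left_cancel₀ (pow_ne_zero M hw0) hw)

/-- Comparison of vanishing orders: the right side has order exactly `d`, the left side at least
`m`. Cancelling and letting u tend to 0 through nonzero values needs nothing beyond continuity. -/
theorem le_of_pow_mul_eq {A B : ℂ → ℂ} {m d : ℕ} (hA : ContinuousAt A 0) (hB : ContinuousAt B 0)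
    (hB0 : B 0 ≠ 0) (h : ∀ᶠ u in 𝓝 (0 : ℂ), u ^ m * A u = u ^ d * B u) :
    m ≤ d ∧ (m = d → A 0 = B 0) := by
  have key : ∀ {P Q : ℂ → ℂ}, ContinuousAt P 0 → ContinuousAt Q 0 →
      (∀ᶠ u in 𝓝[≠] (0 : ℂ), P u = Q u) → P 0 = Q 0 := by
    intro P Q hP hQ hPQ
    exact tendsto_nhds_unique ((hP.tendsto.mono_left nhdsWithin_le_nhds).congr' hPQ)
      (hQ.tendsto.mono_left nhdsWithin_le_nhds)
  have h' : ∀ᶠ u in 𝓝[≠] (0 : ℂ), u ≠ 0 ∧ u ^ m * A u = u ^ d * B u :=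
    (Filter.eventually_of_mem self_mem_nhdsWithin fun _ hu => hu).and
      (nhdsWithin_le_nhds h)
  constructor
  · by_contra! hlt
    have : (0 : ℂ) ^ (m - d) * A 0 = B 0 := by
      refine key (P := fun u => u ^ (m - d) * A u) ((continuousAt_id.pow _).mul hA) hB ?_
      filter_upwards [h'] with u hu
      refine mul_left_cancel₀ (pow_ne_zero d hu.1) ?_
      rw [← hu.2, ← mul_assoc, ← pow_add, Nat.add_sub_cancel' hlt.le]
    rw [zero_pow (by omega), zero_mul] at this
    exact hB0 this.symm
  · rintro rfl
    refine key hA hB ?_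
    filter_upwards [h'] with u hu
    exact mul_left_cancel₀ (pow_ne_zero m hu.1) hu.2

/-! ### Regular order -/

theorem HasRegOrder.congr {f g : ℂ × ℂ → ℂ} {d : ℕ} (hf : HasRegOrder f d)
    (h : ∀ᶠ z in 𝓝 (0 : ℂ × ℂ), f z = g z) : HasRegOrder g d := by
  obtain ⟨b, hb, hb0, hfb⟩ := hf
  exact ⟨b, hb, hb0, (hfb.and (tendsto_prodMk_zero.eventually h)).mono fun y hy => by
    rw [← hy.2, hy.1]⟩

theorem HasRegOrder.mul {f g : ℂ × ℂ → ℂ} {d e : ℕ} (hf : HasRegOrder f d)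
    (hg : HasRegOrder g e) : HasRegOrder (fun z => f z * g z) (d + e) := by
  obtain ⟨b, hb, hb0, hfb⟩ := hf
  obtain ⟨c, hc, hc0, hgc⟩ := hg
  refine ⟨fun y => b y * c y, hb.mul hc, mul_ne_zero hb0 hc0, ?_⟩
  filter_upwards [hfb, hgc] with y h1 h2
  rw [h1, h2, pow_add]
  ring

theorem AnalyticAt.exists_hasRegOrder {h : ℂ × ℂ → ℂ} (hh : AnalyticAt ℂ h 0)
    (h0 : ¬ ∀ᶠ y in 𝓝 (0 : ℂ), h (0, y) = 0) : ∃ d, HasRegOrder h d := by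
  obtain ⟨d, b, hb, hb0, h1⟩ :=
    hh.comp_prodMk_zero.exists_eventuallyEq_pow_smul_nonzero_iff.mpr h0
  exact ⟨d, b, hb, hb0, h1.mono fun y hy => by simpa using hy⟩

theorem HasRegOrder.unique {f : ℂ × ℂ → ℂ} {d e : ℕ} (h1 : HasRegOrder f d)
    (h2 : HasRegOrder f e) : d = e := by
  obtain ⟨b, hb, hb0, hfb⟩ := h1
  obtain ⟨c, hc, hc0, hfc⟩ := h2
  refine le_antisymm ?_ ?_
  · exact (le_of_pow_mul_eq hb.continuousAt hc.continuousAt hc0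
      ((hfb.and hfc).mono fun y hy => hy.1.symm.trans hy.2)).1
  · exact (le_of_pow_mul_eq hc.continuousAt hb.continuousAt hb0
      ((hfc.and hfb).mono fun y hy => hy.1.symm.trans hy.2)).1

theorem HasRegOrder.ne_zero_of_zero {f : ℂ × ℂ → ℂ} (h : HasRegOrder f 0) : f 0 ≠ 0 := by
  obtain ⟨b, hb, hb0, hfb⟩ := h
  have := hfb.self_of_nhds
  simp only [pow_zero, one_mul] at this
  rwa [← this] at hb0

theorem HasRegOrder.eq_zero {f : ℂ × ℂ → ℂ} {d : ℕ} (h : HasRegOrder f d) (hd : d ≠ 0) :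
    f 0 = 0 := by
  obtain ⟨b, hb, hb0, hfb⟩ := h
  have := hfb.self_of_nhds
  rwa [zero_pow hd, zero_mul] at this

theorem HasRegOrder.not_eventually_zero {f : ℂ × ℂ → ℂ} {d : ℕ} (h : HasRegOrder f d) :
    ∀ᶠ y in 𝓝[≠] (0 : ℂ), f (0, y) ≠ 0 := by
  obtain ⟨b, hb, hb0, hfb⟩ := h
  filter_upwards [nhdsWithin_le_nhds hfb, nhdsWithin_le_nhds (hb.continuousAt.eventually_ne hb0),
    self_mem_nhdsWithin] with y h1 h2 h3
  rw [h1]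
  exact mul_ne_zero (pow_ne_zero _ h3) h2

theorem HasRegOrder.of_mul {f g : ℂ × ℂ → ℂ} {n : ℕ} (hf : AnalyticAt ℂ f 0)
    (hg : AnalyticAt ℂ g 0) (h : HasRegOrder (fun z => f z * g z) n) :
    ∃ d e, HasRegOrder f d ∧ HasRegOrder g e ∧ d + e = n := by
  have h0 := h.not_eventually_zero
  obtain ⟨d, hd⟩ := hf.exists_hasRegOrder fun h1 => by
    obtain ⟨y, h2, h3⟩ := (h0.and (nhdsWithin_le_nhds h1)).exists
    simp [h3] at h2
  obtain ⟨e, he⟩ := hg.exists_hasRegOrder fun h1 => by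
    obtain ⟨y, h2, h3⟩ := (h0.and (nhdsWithin_le_nhds h1)).exists
    simp [h3] at h2
  exact ⟨d, e, hd, he, (hd.mul he).unique h⟩

/-! ### Initial forms -/

/-- The equation of the tangent cone near the point `c` of the exceptional curve. -/
def excForm (M : ℕ) (p : Polynomial ℂ) : Option ℂ → Polynomial ℂ
  | some c => p.comp (Polynomial.X + Polynomial.C c)
  | none => p.reflect M

/-- The germ `h` vanishes to order at least `M`, and its homogeneous part of degree `M` is
`x ^ M * p (y / x)`: for each point `c` of the exceptional curve, the strict transform of `h` at
`c` restricts to the exceptional curve as prescribed by `p`. -/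
def HasInitialForm (h : ℂ × ℂ → ℂ) (M : ℕ) (p : Polynomial ℂ) : Prop :=
  p.natDegree ≤ M ∧ ∀ c : Option ℂ, ∃ h' : ℂ × ℂ → ℂ, AnalyticAt ℂ h' 0 ∧
    (∀ᶠ w in 𝓝 (0 : ℂ × ℂ), h (blowMap c w) = w.1 ^ M * h' w) ∧
    ∀ᶠ v in 𝓝 (0 : ℂ), h' (0, v) = (excForm M p c).eval v

theorem excForm_mul {M N : ℕ} {p q : Polynomial ℂ} (hp : p.natDegree ≤ M) (hq : q.natDegree ≤ N)
    (c : Option ℂ) : excForm (M + N) (p * q) c = excForm M p c * excForm N q c := by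
  cases c with
  | none => exact Polynomial.reflect_mul p q hp hq
  | some c => exact Polynomial.mul_comp p q _

theorem HasInitialForm.mul {f g : ℂ × ℂ → ℂ} {M N : ℕ} {p q : Polynomial ℂ}
    (hf : HasInitialForm f M p) (hg : HasInitialForm g N q) :
    HasInitialForm (fun z => f z * g z) (M + N) (p * q) := by
  refine ⟨Polynomial.natDegree_mul_le.trans (add_le_add hf.1 hg.1), fun c => ?_⟩
  obtain ⟨f', hf1, hf2, hf3⟩ := hf.2 c
  obtain ⟨g', hg1, hg2, hg3⟩ := hg.2 c
  refine ⟨fun w => f' w * g' w, hf1.mul hg1, ?_, ?_⟩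
  · filter_upwards [hf2, hg2] with w h1 h2
    rw [h1, h2, pow_add]
    ring
  · filter_upwards [hf3, hg3] with v h1 h2
    rw [h1, h2, excForm_mul hf.1 hg.1, Polynomial.eval_mul]

theorem HasInitialForm.congr {f g : ℂ × ℂ → ℂ} {M : ℕ} {p : Polynomial ℂ}
    (hf : HasInitialForm f M p) (h : ∀ᶠ z in 𝓝 (0 : ℂ × ℂ), f z = g z) :
    HasInitialForm g M p := by
  refine ⟨hf.1, fun c => ?_⟩
  obtain ⟨f', hf1, hf2, hf3⟩ := hf.2 c
  refine ⟨f', hf1, ?_, hf3⟩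
  filter_upwards [hf2, (tendsto_blowMap c).eventually h] with w h1 h2
  rw [← h2, h1]

/-- Since `blowMap none (u, 0) = (0, u)`, the strict transform in the vertical chart compares h (0,
u) with u ^ M. Its value at the origin is the constant term of the reflected polynomial, the
coefficient of degree M of `p`. -/
theorem HasInitialForm.le_regOrder {h : ℂ × ℂ → ℂ} {M d : ℕ} {p : Polynomial ℂ}
    (hp : HasInitialForm h M p) (hd : HasRegOrder h d) :
    M ≤ d ∧ (M = d → p.coeff M ≠ 0) := by
  obtain ⟨h', h1, h2, h3⟩ := hp.2 none
  obtain ⟨b, hb, hb0, hbd⟩ := hd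
  have key : ∀ᶠ u in 𝓝 (0 : ℂ), u ^ M * h' (u, 0) = u ^ d * b u := by
    filter_upwards [tendsto_prodMk_zero'.eventually h2, hbd] with u hu1 hu2
    rw [← hu2, ← hu1]
    simp
  have := le_of_pow_mul_eq h1.comp_prodMk_zero'.continuousAt hb.continuousAt hb0 key
  refine ⟨this.1, fun hM => ?_⟩
  have h4 : h' (0, 0) = p.coeff M := by
    rw [h3.self_of_nhds, excForm, ← Polynomial.coeff_zero_eq_eval_zero,
      Polynomial.coeff_reflect, Polynomial.revAt_le (Nat.zero_le M), Nat.sub_zero]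
  rw [← h4, this.2 hM]
  exact hb0

/-- A sum of monomials of degree `M` with analytic coefficients. -/
def homogeneousSum (M : ℕ) (r : ℕ → ℂ × ℂ → ℂ) (z : ℂ × ℂ) : ℂ :=
  ∑ k ∈ Finset.range (M + 1), z.1 ^ (M - k) * z.2 ^ k * r k z

theorem hasInitialForm_homogeneousSum {M : ℕ} {r : ℕ → ℂ × ℂ → ℂ}
    (hr : ∀ k, AnalyticAt ℂ (r k) 0) :
    HasInitialForm (homogeneousSum M r) M
      (∑ k ∈ Finset.range (M + 1), Polynomial.monomial k (r k 0)) := by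
  constructor
  · refine Polynomial.natDegree_sum_le_of_forall_le _ _ fun k hk => ?_
    exact (Polynomial.natDegree_monomial_le _).trans (Nat.lt_succ_iff.mp (Finset.mem_range.mp hk))
  have hb : ∀ (c : Option ℂ) (k : ℕ), AnalyticAt ℂ (fun w => r k (blowMap c w)) 0 := fun c k =>
    (hr k).comp_of_eq (analyticAt_blowMap c 0) (blowMap_zero c)
  rintro (_ | c)
  · refine ⟨fun w => ∑ k ∈ Finset.range (M + 1), w.2 ^ (M - k) * r k (blowMap none w),
      Finset.analyticAt_fun_sum _ fun k _ => (analyticAt_snd.pow _).mul (hb none k), ?_, ?_⟩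
    · refine Filter.Eventually.of_forall fun w => ?_
      rw [homogeneousSum, Finset.mul_sum]
      refine Finset.sum_congr rfl fun k hk => ?_
      have hk : k ≤ M := Nat.lt_succ_iff.mp (Finset.mem_range.mp hk)
      obtain ⟨j, rfl⟩ := Nat.exists_eq_add_of_le hk
      rw [blowMap_none, Nat.add_sub_cancel_left, mul_pow, pow_add]
      ring
    · refine Filter.Eventually.of_forall fun v => ?_
      have h1 : (∑ k ∈ Finset.range (M + 1), Polynomial.monomial k (r k 0)).reflect M =
          ∑ k ∈ Finset.range (M + 1), (Polynomial.monomial k (r k 0)).reflect M := by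
        ext n
        simp only [Polynomial.coeff_reflect, Polynomial.finsetSum_coeff]
      rw [excForm, h1, Polynomial.eval_finsetSum]
      refine Finset.sum_congr rfl fun k hk => ?_
      rw [← Polynomial.C_mul_X_pow_eq_monomial, Polynomial.reflect_C_mul_X_pow,
        Polynomial.revAt_le (Nat.lt_succ_iff.mp (Finset.mem_range.mp hk))]
      rw [Polynomial.eval_mul, Polynomial.eval_C, Polynomial.eval_pow, Polynomial.eval_X, mul_comm,
        blowMap_zero_left]
  · refine ⟨fun w => ∑ k ∈ Finset.range (M + 1), (w.2 + c) ^ k * r k (blowMap (some c) w),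
      Finset.analyticAt_fun_sum _ fun k _ =>
        ((analyticAt_snd.add analyticAt_const).pow _).mul (hb (some c) k), ?_, ?_⟩
    · refine Filter.Eventually.of_forall fun w => ?_
      rw [homogeneousSum, Finset.mul_sum]
      refine Finset.sum_congr rfl fun k hk => ?_
      have hk : k ≤ M := Nat.lt_succ_iff.mp (Finset.mem_range.mp hk)
      obtain ⟨j, rfl⟩ := Nat.exists_eq_add_of_le hk
      rw [blowMap_some, Nat.add_sub_cancel_left, mul_pow, pow_add]
      ring
    · refine Filter.Eventually.of_forall fun v => ?_
      simp [excForm, Polynomial.eval_finsetSum, mul_comm]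

theorem AnalyticAt.exists_eq_fst_mul_add_snd_mul {h : ℂ × ℂ → ℂ} (hh : AnalyticAt ℂ h 0)
    (h0 : h 0 = 0) : ∃ s t : ℂ × ℂ → ℂ, AnalyticAt ℂ s 0 ∧ AnalyticAt ℂ t 0 ∧
      ∀ᶠ z in 𝓝 (0 : ℂ × ℂ), h z = z.1 * s z + z.2 * t z := by
  have h1 : AnalyticAt ℂ (fun z : ℂ × ℂ => h (0, z.2)) 0 :=
    hh.comp_of_eq (analyticAt_const.prod analyticAt_snd) rfl
  obtain ⟨t, ht, ht'⟩ := h1.exists_eq_snd_mul (Filter.Eventually.of_forall fun x => h0)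
  obtain ⟨s, hs, hs'⟩ := (hh.sub h1).exists_eq_fst_mul
    (Filter.Eventually.of_forall fun y => sub_self _)
  refine ⟨s, t, hs, ht, ?_⟩
  filter_upwards [hs', ht'] with z h2 h3
  rw [← h2, ← h3]
  simp

/-- Every germ that is regular in the second variable has a nonzero initial form. -/
theorem AnalyticAt.exists_hasInitialForm {h : ℂ × ℂ → ℂ} {d : ℕ} (hh : AnalyticAt ℂ h 0)
    (hd : HasRegOrder h d) : ∃ M p, p ≠ 0 ∧ HasInitialForm h M p := by
  by_contra! hcon
  -- If all candidates for an initial form vanish, h lies in every power of the maximal ideal: each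
  -- coefficient vanishes at 0, is of the form x * s + y * t, and this raises the degree by one.
  -- Degree `d + 1` contradicts the regularity order.
  have key : ∀ M, ∃ r : ℕ → ℂ × ℂ → ℂ, (∀ k, AnalyticAt ℂ (r k) 0) ∧
      ∀ᶠ z in 𝓝 (0 : ℂ × ℂ), h z = homogeneousSum M r z := by
    intro M
    induction M with
    | zero => exact ⟨fun _ => h, fun _ => hh, by simp [homogeneousSum]⟩
    | succ M ih =>
      obtain ⟨r, hr, hrM⟩ := ih
      have h1 := (hasInitialForm_homogeneousSum (M := M) hr).congr (hrM.mono fun _ h => h.symm)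
      have h2 := by_contra fun h => hcon M _ h h1
      have h3 : ∀ k : Fin (M + 1), r k 0 = 0 := by
        intro k
        have h4 := congrArg (fun p => p.coeff k) h2
        have h5 : (k : ℕ) ≤ M := Nat.lt_succ_iff.mp k.2
        simpa [Polynomial.finsetSum_coeff, Polynomial.coeff_monomial, h5] using h4
      choose s t hs ht hst using fun k : Fin (M + 1) =>
        (hr k).exists_eq_fst_mul_add_snd_mul (h3 k)
      -- The monomial of index k in degree M + 1 arises as x times the old one of index k, with
      -- coefficient `s`, and as y times the old one of index k - 1, with coefficient `t`. The
      -- conditions discard the missing neighbours at both ends.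
      refine ⟨fun k z => (if hk : k < M + 1 then s ⟨k, hk⟩ z else 0) +
        (if hk : k - 1 < M + 1 ∧ k ≠ 0 then t ⟨k - 1, hk.1⟩ z else 0), fun k => ?_, ?_⟩
      · refine AnalyticAt.add ?_ ?_
        · by_cases hk : k < M + 1 <;> simp only [hk, dite_true, dite_false]
          · exact hs _
          · exact analyticAt_const
        · by_cases hk : k - 1 < M + 1 ∧ k ≠ 0
          · exact (ht ⟨k - 1, hk.1⟩).congr (Filter.Eventually.of_forall fun z => by simp only [dif_pos hk])
          · exact (analyticAt_const (v := (0 : ℂ))).congr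
              (Filter.Eventually.of_forall fun z => by simp only [dif_neg hk])
      · filter_upwards [hrM, Filter.eventually_all.mpr hst] with z hz hz2
        rw [hz, homogeneousSum, homogeneousSum]
        simp only [mul_add, Finset.sum_add_distrib]
        rw [Finset.sum_range_succ _ (M + 1), Finset.sum_range_succ' _ (M + 1)]
        simp only [lt_irrefl, dite_false, mul_zero, add_zero, ne_eq, not_true, and_false,
          add_tsub_cancel_right, Nat.add_eq_zero_iff, one_ne_zero, not_false_eq_true, and_true]
        rw [← Finset.sum_add_distrib]
        refine Finset.sum_congr rfl fun k hk => ?_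
        have hk' := Finset.mem_range.mp hk
        simp only [hk', dite_true]
        have h5 := hz2 ⟨k, hk'⟩
        simp only at h5
        rw [h5]
        have e1 : M + 1 - k = (M - k) + 1 := by omega
        have e2 : M + 1 - (k + 1) = M - k := by omega
        rw [e1, e2]
        ring
  obtain ⟨r, hr, hrM⟩ := key (d + 1)
  have h1 := (hasInitialForm_homogeneousSum (M := d + 1) hr).congr (hrM.mono fun _ h => h.symm)
  have := (h1.le_regOrder hd).1
  omega

/-! ### Monomial germs and their divisors -/

theorem eventually_eq_of_fst_mul_eq {F G : ℂ × ℂ → ℂ}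
    (hF : AnalyticAt ℂ F 0) (hG : AnalyticAt ℂ G 0)
    (h : ∀ᶠ w in 𝓝 (0 : ℂ × ℂ), w.1 * F w = w.1 * G w) : ∀ᶠ w in 𝓝 (0 : ℂ × ℂ), F w = G w :=
  eventually_eq_of_pow_mul_eq (M := 1) hF.eventually_continuousAt hG.eventually_continuousAt
    (by simpa using h)

theorem eventually_eq_of_snd_mul_eq {F G : ℂ × ℂ → ℂ}
    (hF : AnalyticAt ℂ F 0) (hG : AnalyticAt ℂ G 0)
    (h : ∀ᶠ w in 𝓝 (0 : ℂ × ℂ), w.2 * F w = w.2 * G w) : ∀ᶠ w in 𝓝 (0 : ℂ × ℂ), F w = G w := by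
  have := eventually_eq_of_fst_mul_eq hF.comp_swap hG.comp_swap (tendsto_swap_zero.eventually h)
  filter_upwards [tendsto_swap_zero.eventually this] with z hz
  simpa using hz

theorem eventually_zero_or_of_mul {f g : ℂ → ℂ} (hf : AnalyticAt ℂ f 0) (hg : AnalyticAt ℂ g 0)
    (h : ∀ᶠ y in 𝓝 (0 : ℂ), f y * g y = 0) :
    (∀ᶠ y in 𝓝 (0 : ℂ), f y = 0) ∨ ∀ᶠ y in 𝓝 (0 : ℂ), g y = 0 := by
  rcases hf.eventually_eq_zero_or_eventually_ne_zero with h1 | h1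
  · exact Or.inl h1
  rcases hg.eventually_eq_zero_or_eventually_ne_zero with h2 | h2
  · exact Or.inr h2
  obtain ⟨y, h3, h4, h5⟩ := (h1.and (h2.and (nhdsWithin_le_nhds h))).exists
  exact absurd h5 (mul_ne_zero h3 h4)

/-- The germ of `F` is a unit times the monomial `x ^ a * y ^ b`. -/
def IsMonomialGerm (F : ℂ × ℂ → ℂ) (a b : ℕ) : Prop :=
  ∃ e : ℂ × ℂ → ℂ, AnalyticAt ℂ e 0 ∧ e 0 ≠ 0 ∧
    ∀ᶠ z in 𝓝 (0 : ℂ × ℂ), F z = z.1 ^ a * z.2 ^ b * e z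

theorem IsMonomialGerm.congr {F G : ℂ × ℂ → ℂ} {a b : ℕ} (hF : IsMonomialGerm F a b)
    (h : ∀ᶠ z in 𝓝 (0 : ℂ × ℂ), F z = G z) : IsMonomialGerm G a b := by
  obtain ⟨e, he, he0, h1⟩ := hF
  exact ⟨e, he, he0, (h1.and h).mono fun z hz => hz.2 ▸ hz.1⟩

theorem IsMonomialGerm.fst_mul {F : ℂ × ℂ → ℂ} {a b : ℕ} (hF : IsMonomialGerm F a b) :
    IsMonomialGerm (fun z => z.1 * F z) (a + 1) b := by
  obtain ⟨e, he, he0, h1⟩ := hF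
  exact ⟨e, he, he0, h1.mono fun z hz => by dsimp only; rw [hz]; ring⟩

theorem IsMonomialGerm.snd_mul {F : ℂ × ℂ → ℂ} {a b : ℕ} (hF : IsMonomialGerm F a b) :
    IsMonomialGerm (fun z => z.2 * F z) a (b + 1) := by
  obtain ⟨e, he, he0, h1⟩ := hF
  exact ⟨e, he, he0, h1.mono fun z hz => by dsimp only; rw [hz]; ring⟩

/-- A divisor of a monomial is a monomial. -/
theorem IsMonomialGerm.of_mul {F G : ℂ × ℂ → ℂ} {a b : ℕ} (hF : AnalyticAt ℂ F 0)
    (hG : AnalyticAt ℂ G 0) (h : IsMonomialGerm (fun z => F z * G z) a b) :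
    ∃ a' b', a' ≤ a ∧ b' ≤ b ∧ IsMonomialGerm F a' b' := by
  induction hn : a + b generalizing a b F G with
  | zero =>
    obtain ⟨rfl, rfl⟩ : a = 0 ∧ b = 0 := by omega
    obtain ⟨e, he, he0, h1⟩ := h
    replace h1 : ∀ᶠ z : ℂ × ℂ in 𝓝 0, F z * G z = z.1 ^ 0 * z.2 ^ 0 * e z := h1
    refine ⟨0, 0, le_rfl, le_rfl, F, hF, fun h0 => he0 ?_, by simp⟩
    have := h1.self_of_nhds
    rw [h0] at this
    simpa using this.symm
  | succ n ih =>
    obtain ⟨e, he, he0, h1⟩ := h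
    replace h1 : ∀ᶠ z : ℂ × ℂ in 𝓝 0, F z * G z = z.1 ^ a * z.2 ^ b * e z := h1
    -- A coordinate that occurs in the monomial vanishes on a line, and on that line the product of
    -- F and G is zero. Germs in one variable have no zero divisors, so the coordinate divides F or
    -- G and can be cancelled, which lowers `a + b`.
    rcases Nat.eq_zero_or_pos a with rfl | ha
    · obtain ⟨b, rfl⟩ : ∃ k, b = k + 1 := ⟨b - 1, by omega⟩
      have h2 : ∀ᶠ x in 𝓝 (0 : ℂ), F (x, 0) * G (x, 0) = 0 :=
        (tendsto_prodMk_zero'.eventually h1).mono fun x hx => by rw [hx]; simp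
      rcases eventually_zero_or_of_mul hF.comp_prodMk_zero' hG.comp_prodMk_zero' h2 with h3 | h3
      · obtain ⟨F', hF', h4⟩ := hF.exists_eq_snd_mul h3
        obtain ⟨a', b', ha', hb', h5⟩ := ih (a := 0) (b := b) hF' hG ⟨e, he, he0, by
          refine eventually_eq_of_snd_mul_eq (hF'.mul hG)
            (((analyticAt_fst.pow _).mul (analyticAt_snd.pow _)).mul he) ?_
          filter_upwards [h1, h4] with z h5 h6
          rw [← mul_assoc, ← h6, h5]; ring⟩ (by omega)
        exact ⟨a', b' + 1, ha', by omega, h5.snd_mul.congr (h4.mono fun _ h => h.symm)⟩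
      · obtain ⟨G', hG', h4⟩ := hG.exists_eq_snd_mul h3
        obtain ⟨a', b', ha', hb', h5⟩ := ih (a := 0) (b := b) hF hG' ⟨e, he, he0, by
          refine eventually_eq_of_snd_mul_eq (hF.mul hG')
            (((analyticAt_fst.pow _).mul (analyticAt_snd.pow _)).mul he) ?_
          filter_upwards [h1, h4] with z h5 h6
          rw [mul_left_comm, ← h6, h5]; ring⟩ (by omega)
        exact ⟨a', b', by omega, by omega, h5⟩
    · obtain ⟨a, rfl⟩ : ∃ k, a = k + 1 := ⟨a - 1, by omega⟩
      have h2 : ∀ᶠ y in 𝓝 (0 : ℂ), F (0, y) * G (0, y) = 0 :=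
        (tendsto_prodMk_zero.eventually h1).mono fun x hx => by rw [hx]; simp
      rcases eventually_zero_or_of_mul hF.comp_prodMk_zero hG.comp_prodMk_zero h2 with h3 | h3
      · obtain ⟨F', hF', h4⟩ := hF.exists_eq_fst_mul h3
        obtain ⟨a', b', ha', hb', h5⟩ := ih (a := a) (b := b) hF' hG ⟨e, he, he0, by
          refine eventually_eq_of_fst_mul_eq (hF'.mul hG)
            (((analyticAt_fst.pow _).mul (analyticAt_snd.pow _)).mul he) ?_
          filter_upwards [h1, h4] with z h5 h6
          rw [← mul_assoc, ← h6, h5]; ring⟩ (by omega)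
        exact ⟨a' + 1, b', by omega, hb', h5.fst_mul.congr (h4.mono fun _ h => h.symm)⟩
      · obtain ⟨G', hG', h4⟩ := hG.exists_eq_fst_mul h3
        obtain ⟨a', b', ha', hb', h5⟩ := ih (a := a) (b := b) hF hG' ⟨e, he, he0, by
          refine eventually_eq_of_fst_mul_eq (hF.mul hG')
            (((analyticAt_fst.pow _).mul (analyticAt_snd.pow _)).mul he) ?_
          filter_upwards [h1, h4] with z h5 h6
          rw [mul_left_comm, ← h6, h5]; ring⟩ (by omega)
        exact ⟨a', b', by omega, by omega, h5⟩

/-! ### The Weierstrass preparation theorem -/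

theorem BSeq.shiftLeft_pow_mul_shiftRight_pow (d k : ℕ) :
    BSeq.shiftLeft ^ d * BSeq.shiftRight ^ (d + k) = BSeq.shiftRight ^ k := by
  ext a n
  rw [mul_apply_eq_comp, BSeq.shiftLeft_pow_apply, pow_add, add_comm n d, add_comm d n,
    mul_apply_eq_comp, BSeq.shiftRight_pow_apply_add]

theorem BSeq.star_shiftRight_pow (a : BSeq) (j k : ℕ) :
    (BSeq.shiftRight ^ j) (star a) k = star ((BSeq.shiftRight ^ j) a k) := by
  by_cases h : k < j
  · rw [BSeq.shiftRight_pow_apply_of_lt _ h, BSeq.shiftRight_pow_apply_of_lt _ h, star_zero]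
  · obtain ⟨n, rfl⟩ := Nat.exists_eq_add_of_le' (not_lt.mp h)
    rw [BSeq.shiftRight_pow_apply_add, BSeq.shiftRight_pow_apply_add, BSeq.star_apply]

namespace ConvergesOn

variable {F : MvPowerSeries (Fin 2) ℂ} {r : ℝ}

theorem hasSum_mulOp_zero (hF : ConvergesOn F r) (hr : 0 ≤ r) :
    HasSum (fun j : ℕ => (MvPowerSeries.coeff (monomialExp (0, j)) F * (r : ℂ) ^ j) •
      BSeq.shiftRight ^ j) (mulOp F r 0) := by
  have h := monomialExp.hasSum_iff.mpr (hF.hasSum_mulOp hr (x := 0) (by simpa using hr))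
  have hinj : Function.Injective fun j : ℕ => ((0, j) : ℕ × ℕ) := fun a b h => by simpa using h
  rw [← hinj.hasSum_iff] at h
  · refine h.congr_fun ?_ |> id
    intro j
    simp
  · rintro ⟨i, j⟩ hij
    have : i ≠ 0 := fun h => hij ⟨j, by simp [h]⟩
    simp [this]

/-- A series in y that starts in degree `d` moves every entry by at least `d` places, so up to place
`d` only its leading coefficient and `a 0` are visible. -/
theorem mulOp_zero_apply (hF : ConvergesOn F r) (hr : 0 ≤ r) {d : ℕ}
    (hd : ∀ j < d, MvPowerSeries.coeff (monomialExp (0, j)) F = 0) (a : BSeq) {k : ℕ}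
    (hk : k ≤ d) : mulOp F r 0 a k =
      if k = d then MvPowerSeries.coeff (monomialExp (0, d)) F * (r : ℂ) ^ d * a 0 else 0 := by
  have h1 := (BSeq.coord k).hasSum ((ContinuousLinearMap.apply ℂ BSeq a).hasSum
    (hF.hasSum_mulOp_zero hr))
  refine h1.unique ?_
  have h2 : ∀ j ≠ d, (BSeq.coord k) ((ContinuousLinearMap.apply ℂ BSeq a)
      ((MvPowerSeries.coeff (monomialExp (0, j)) F * (r : ℂ) ^ j) • BSeq.shiftRight ^ j)) = 0 := by
    intro j hj
    change (MvPowerSeries.coeff (monomialExp (0, j)) F * (r : ℂ) ^ j) *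
      (BSeq.shiftRight ^ j) a k = 0
    rcases lt_or_gt_of_ne hj with h | h
    · simp [hd j h]
    · rw [BSeq.shiftRight_pow_apply_of_lt a (lt_of_le_of_lt hk h), mul_zero]
  convert hasSum_single d h2 using 1
  change _ = (MvPowerSeries.coeff (monomialExp (0, d)) F * (r : ℂ) ^ d) *
      (BSeq.shiftRight ^ d) a k
  split_ifs with h
  · subst h
    have := BSeq.shiftRight_pow_apply_add a k 0
    rw [zero_add] at this
    rw [this]
  · rw [BSeq.shiftRight_pow_apply_of_lt a (lt_of_le_of_ne hk h), mul_zero]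

theorem star_mulOp (hF : ConvergesOn F r) (hr : 0 ≤ r)
    (hreal : ∀ n, star (MvPowerSeries.coeff n F) = MvPowerSeries.coeff n F) {x : ℂ}
    (hx : ‖x‖ ≤ r) (a : BSeq) : mulOp F r (star x) (star a) = star (mulOp F r x a) := by
  ext k
  have h1 := (BSeq.coord k).hasSum ((ContinuousLinearMap.apply ℂ BSeq a).hasSum
    (hF.hasSum_mulOp hr hx))
  have h2 := (BSeq.coord k).hasSum ((ContinuousLinearMap.apply ℂ BSeq (star a)).hasSum
    (hF.hasSum_mulOp hr (x := star x) (by rwa [norm_star])))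
  refine h2.unique ((h1.star).congr_fun ?_ |> id)
  intro n
  change (MvPowerSeries.coeff n F * (star x) ^ n 0 * (r : ℂ) ^ n 1) *
    (BSeq.shiftRight ^ n 1) (star a) k = star ((MvPowerSeries.coeff n F * x ^ n 0 *
      (r : ℂ) ^ n 1) * (BSeq.shiftRight ^ n 1) a k)
  rw [BSeq.star_shiftRight_pow, star_mul', star_mul', star_mul', hreal, star_pow, star_pow]
  congr 3
  simp

/-- For small `r`, multiplication by `f (0, r * ·) / y ^ d` is invertible if `f` is regular of
order `d`. -/
theorem exists_isUnit (hF : ConvergesOn F r) (hr : 0 < r) {d : ℕ}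
    (hd : ∀ j < d, MvPowerSeries.coeff (monomialExp (0, j)) F = 0)
    (hd0 : MvPowerSeries.coeff (monomialExp (0, d)) F ≠ 0) :
    ∃ s, 0 < s ∧ s ≤ r ∧ IsUnit (BSeq.shiftLeft ^ d * mulOp F s 0) := by
  set c : ℕ → ℂ := fun j => MvPowerSeries.coeff (monomialExp (0, j)) F with hc
  have hsum : Summable fun j => ‖c j‖ * r ^ j := by
    have h1 := (monomialExp.summable_iff.mpr hF)
    have hinj : Function.Injective fun j : ℕ => ((0, j) : ℕ × ℕ) := fun a b h => by simpa using h
    refine (h1.comp_injective hinj).congr fun j => ?_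
    simp [hc]
  have hsum' : Summable fun j => ‖c (j + (d + 1))‖ * r ^ j := by
    have := (((summable_nat_add_iff (d + 1)).mpr hsum).mul_right (r ^ (d + 1))⁻¹)
    refine this.congr fun j => ?_
    rw [pow_add]
    field_simp
  set K := ∑' j, ‖c (j + (d + 1))‖ * r ^ j with hK
  have hK0 : 0 ≤ K := tsum_nonneg fun j => by positivity
  have hcd : 0 < ‖c d‖ := norm_pos_iff.mpr hd0
  -- After d left shifts the operator is `c d * s ^ d` times the identity plus a tail of norm at
  -- most `s ^ (d + 1) * K`. The bound on `s` gives `s * K < ‖c d‖`, so a Neumann series inverts it;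
  -- the summand 1 keeps the quotient meaningful when K = 0.
  refine ⟨min r (‖c d‖ / (K + 1)), lt_min hr (by positivity), min_le_left _ _, ?_⟩
  set s := min r (‖c d‖ / (K + 1)) with hs
  have hs0 : 0 < s := lt_min hr (by positivity)
  have hsr : s ≤ r := min_le_left _ _
  have hsK : s * K < ‖c d‖ := by
    have h1 : s * (K + 1) ≤ ‖c d‖ := by
      rw [← le_div_iff₀ (by positivity)]; exact min_le_right _ _
    nlinarith
  have h1 := ((hF.mono hs0 hsr).hasSum_mulOp_zero hs0.le).mul_left (BSeq.shiftLeft ^ d)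
  have h2 := (hasSum_nat_add_iff' (d + 1)).mpr h1
  rw [Finset.sum_range_succ, Finset.sum_eq_zero, zero_add] at h2
  · have h3 : BSeq.shiftLeft ^ d * ((c d * (s : ℂ) ^ d) • BSeq.shiftRight ^ d) =
        (c d * (s : ℂ) ^ d) • (1 : BSeq →L[ℂ] BSeq) := by
      rw [mul_smul_comm]
      congr 1
      simpa using BSeq.shiftLeft_pow_mul_shiftRight_pow d 0
    rw [h3] at h2
    have h4 : ∀ j, ‖BSeq.shiftLeft ^ d * ((c (j + (d + 1)) * (s : ℂ) ^ (j + (d + 1))) •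
        BSeq.shiftRight ^ (j + (d + 1)))‖ ≤ s ^ (d + 1) * (‖c (j + (d + 1))‖ * r ^ j) := by
      intro j
      have e : j + (d + 1) = d + (j + 1) := by ring
      rw [mul_smul_comm, norm_smul, e, BSeq.shiftLeft_pow_mul_shiftRight_pow, norm_mul, norm_pow,
        Complex.norm_real, Real.norm_of_nonneg hs0.le]
      refine (mul_le_of_le_one_right (by positivity) (BSeq.norm_shiftRight_pow_le _)).trans ?_
      have : s ^ (d + (j + 1)) = s ^ (d + 1) * s ^ j := by ring
      rw [this, mul_left_comm]
      gcongr
    have h5 := h2.norm_le_of_bounded (hsum'.hasSum.mul_left (s ^ (d + 1))) h4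
    set B := BSeq.shiftLeft ^ d * mulOp F s 0
    set κ := c d * (s : ℂ) ^ d with hκ
    have hκ0 : κ ≠ 0 := mul_ne_zero hd0 (pow_ne_zero _ (by exact_mod_cast hs0.ne'))
    have hκn : ‖κ‖ = ‖c d‖ * s ^ d := by
      rw [hκ, norm_mul, norm_pow, Complex.norm_real, Real.norm_of_nonneg hs0.le]
    have h6 : ‖(1 : BSeq →L[ℂ] BSeq) - κ⁻¹ • B‖ < 1 := by
      have : (1 : BSeq →L[ℂ] BSeq) - κ⁻¹ • B = -(κ⁻¹ • (B - κ • 1)) := by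
        rw [smul_sub, inv_smul_smul₀ hκ0]; abel
      rw [this, norm_neg, norm_smul, norm_inv, inv_mul_lt_one₀ (norm_pos_iff.mpr hκ0), hκn]
      refine h5.trans_lt ?_
      calc s ^ (d + 1) * K = s ^ d * (s * K) := by ring
        _ < s ^ d * ‖c d‖ := by gcongr
        _ = ‖c d‖ * s ^ d := mul_comm _ _
    have h7 := isUnit_one_sub_of_norm_lt_one h6
    rw [sub_sub_cancel] at h7
    have h8 : B = algebraMap ℂ (BSeq →L[ℂ] BSeq) κ * (κ⁻¹ • B) := by
      rw [Algebra.algebraMap_eq_smul_one, smul_mul_assoc, one_mul, smul_inv_smul₀ hκ0]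
    rw [h8]
    exact ((IsUnit.mk0 κ hκ0).map (algebraMap ℂ (BSeq →L[ℂ] BSeq))).mul h7
  · intro j hj
    have : c j = 0 := hd j (Finset.mem_range.mp hj)
    simp only [hc] at this
    simp [this]

end ConvergesOn

theorem ConvergentSeries.coeff_of_hasRegOrder {F : ConvergentSeries ℂ} {d : ℕ}
    (h : HasRegOrder (seriesEval F.1) d) :
    (∀ j < d, MvPowerSeries.coeff (monomialExp (0, j)) F.1 = 0) ∧
      MvPowerSeries.coeff (monomialExp (0, d)) F.1 ≠ 0 := by
  obtain ⟨r, hr, hF⟩ := ConvergentSeries.exists_convergesOn F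
  set c : ℕ → ℂ := fun j => MvPowerSeries.coeff (monomialExp (0, j)) F.1 with hc
  have hp : HasFPowerSeriesAt (fun y : ℂ => seriesEval F.1 (0, y))
      (FormalMultilinearSeries.ofScalars ℂ c) 0 := by
    rw [hasFPowerSeriesAt_iff]
    filter_upwards [Metric.ball_mem_nhds (0 : ℂ) hr] with y hy
    simpa [FormalMultilinearSeries.coeff_ofScalars] using
      hF.hasSum_zero_left hr.le (mem_ball_zero_iff.mp hy).le
  set p := FormalMultilinearSeries.ofScalars ℂ c with hpdef
  have hpc : ∀ j, p.coeff j = c j := fun j => by rw [hpdef, FormalMultilinearSeries.coeff_ofScalars]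
  obtain ⟨b, hb, hb0, hbd⟩ := h
  have hp0 : p ≠ 0 := by
    intro h0
    rw [h0] at hp
    have h1 := HasFPowerSeriesAt.eventually_eq_zero hp
    have h2 := HasRegOrder.not_eventually_zero ⟨b, hb, hb0, hbd⟩
    obtain ⟨y, h3, h4⟩ := (h2.and (nhdsWithin_le_nhds h1)).exists
    exact h3 h4
  have hord : p.order = d := by
    refine AnalyticAt.unique_eventuallyEq_pow_smul_nonzero (𝕜 := ℂ) (z₀ := 0)
      (f := fun y : ℂ => seriesEval F.1 (0, y)) ?_ ?_
    · exact ⟨_, hp.has_fpower_series_iterate_dslope_fslope p.order |>.analyticAt,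
        hp.iterate_dslope_fslope_ne_zero hp0, Filter.Eventually.of_forall hp.eq_pow_order_mul_iterate_dslope⟩
    · exact ⟨b, hb, hb0, hbd.mono fun y hy => by simpa using hy⟩
  constructor
  · intro j hj
    rw [← hord] at hj
    have h1 : p.coeff j = 0 := by
      rw [FormalMultilinearSeries.coeff, FormalMultilinearSeries.apply_eq_zero_of_lt_order hj]
      rfl
    rw [← h1, hpc]
  · have h1 := FormalMultilinearSeries.apply_order_ne_zero hp0
    rw [hord] at h1
    intro h2
    exact h1 (FormalMultilinearSeries.coeff_eq_zero.mp ((hpc d).trans h2))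

/-- The Weierstrass polynomial `y ^ d + ∑ c k x * y ^ k`. -/
def weierstrassPoly (d : ℕ) (c : ℕ → ℂ → ℂ) (z : ℂ × ℂ) : ℂ :=
  z.2 ^ d + ∑ k ∈ Finset.range d, c k z.1 * z.2 ^ k

/-- Weierstrass preparation; the polynomial is real if the germ is. -/
theorem AnalyticAt.weierstrass_preparation {h : ℂ × ℂ → ℂ} {d : ℕ} (hh : AnalyticAt ℂ h 0)
    (hd : HasRegOrder h d) :
    ∃ c : ℕ → ℂ → ℂ, (∀ k, AnalyticAt ℂ (c k) 0) ∧ (∀ k < d, c k 0 = 0) ∧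
      (∃ V : ℂ × ℂ → ℂ, AnalyticAt ℂ V 0 ∧ V 0 ≠ 0 ∧
        ∀ᶠ z in 𝓝 (0 : ℂ × ℂ), h z = weierstrassPoly d c z * V z) ∧
      (IsRealGerm h → ∀ k, ∀ᶠ x in 𝓝 (0 : ℂ), c k (star x) = star (c k x)) := by
  obtain ⟨F, hF⟩ := ConvergentSeries.exists_of_analyticAt hh
  obtain ⟨hc1, hc2⟩ := ConvergentSeries.coeff_of_hasRegOrder (hd.congr hF)
  obtain ⟨r, hr, hFr⟩ := ConvergentSeries.exists_convergesOn F
  obtain ⟨s, hs, hsr, hu⟩ := hFr.exists_isUnit hr hc1 hc2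
  have hFs := hFr.mono hs hsr
  have hs0 : (s : ℂ) ≠ 0 := by exact_mod_cast hs.ne'
  -- Left shifts discard the part of degree below d. Solving B x (q x) = 1 thus makes the product `m
  -- x` of the germ with q equal to y ^ d plus terms of lower degree. The operator is invertible at
  -- x = 0, hence nearby, and its inverse is analytic in x.
  let B : ℂ → BSeq →L[ℂ] BSeq := fun x => BSeq.shiftLeft ^ d * ConvergesOn.mulOp F.1 s x
  let q : ℂ → BSeq := fun x => Ring.inverse (B x) BSeq.one
  let m : ℂ → BSeq := fun x => ConvergesOn.mulOp F.1 s x (q x)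
  have hM : AnalyticAt ℂ (ConvergesOn.mulOp F.1 s) 0 := hFs.analyticAt_mulOp hs.le (by simpa using hs)
  have hB : AnalyticAt ℂ B 0 :=
    (analyticAt_const (v := BSeq.shiftLeft ^ d)).mul hM
  have hq : AnalyticAt ℂ q 0 := by
    obtain ⟨u, hu⟩ := hu
    have h1 : AnalyticAt ℂ (Ring.inverse : (BSeq →L[ℂ] BSeq) → _) (B 0) := by
      have := contDiffAt_ringInverse (n := ω) ℂ u
      rw [hu] at this
      exact this.analyticAt
    exact (h1.comp hB).apply_clm analyticAt_const
  have hm : AnalyticAt ℂ m 0 := hM.apply_clm hq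
  have hBu : ∀ᶠ x in 𝓝 (0 : ℂ), IsUnit (B x) :=
    hB.continuousAt.eventually (Units.isOpen.mem_nhds hu)
  have hBq : ∀ x, IsUnit (B x) → (BSeq.shiftLeft ^ d) (m x) = BSeq.one := fun x hx => by
    have := congrArg (fun T : BSeq →L[ℂ] BSeq => T BSeq.one) (Ring.mul_inverse_cancel _ hx)
    exact this
  have hmd : ∀ x, IsUnit (B x) → ∀ n, m x (n + d) = if n = 0 then 1 else 0 := fun x hx n => by
    have := congrArg (fun a : BSeq => a n) (hBq x hx)
    simp only [BSeq.shiftLeft_pow_apply, BSeq.one_apply] at this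
    exact this
  -- The factor s ^ d compensates for the rescaling of y by `s`, so that the product with `h` is
  -- monic in y.
  let E : ℂ × ℂ → ℂ := fun z => (s : ℂ) ^ d * BSeq.eval ((s : ℂ)⁻¹ * z.2) (q z.1)
  have hE : AnalyticAt ℂ E 0 := by
    refine analyticAt_const.mul (AnalyticAt.apply_clm ?_ ?_)
    · exact (BSeq.analyticAt_eval (y := 0) (by simp)).comp_of_eq
        (analyticAt_const.mul analyticAt_snd) (by simp)
    · exact hq.comp_of_eq analyticAt_fst rfl
  -- At x = 0 the entries below d vanish, so the coefficients of the Weierstrass polynomial vanish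
  -- there. The entry at d equals 1, which forces `q 0 0 ≠ 0`, so the cofactor is a unit.
  have hm0 : ∀ k ≤ d, m 0 k = if k = d then
      MvPowerSeries.coeff (monomialExp (0, d)) F.1 * (s : ℂ) ^ d * q 0 0 else 0 := fun k hk =>
    hFs.mulOp_zero_apply hs.le hc1 (q 0) hk
  have hE0 : E 0 ≠ 0 := by
    have h1 : m 0 d = 1 := by
      simpa using hmd 0 hu 0
    have h2 : q 0 0 ≠ 0 := by
      intro h
      have := hm0 d le_rfl
      rw [h1, if_pos rfl, h, mul_zero] at this
      exact one_ne_zero this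
    have h3 : BSeq.eval ((s : ℂ)⁻¹ * (0 : ℂ × ℂ).2) (q 0) = q 0 0 := by
      have h4 := BSeq.hasSum_eval (y := 0) (by simp) (q 0)
      have h5 : HasSum (fun n : ℕ => (0 : ℂ) ^ n * q 0 n) (q 0 0) := by
        convert hasSum_single (f := fun n : ℕ => (0 : ℂ) ^ n * q 0 n) 0 fun n hn => by simp [hn]
        simp
      simpa using h4.unique h5
    exact mul_ne_zero (pow_ne_zero _ hs0) (by rw [Prod.fst_zero, h3]; exact h2)
  refine ⟨fun k x => (s : ℂ) ^ (d - k) * m x k, fun k => ?_, fun k hk => ?_, ⟨fun z => (E z)⁻¹,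
    hE.inv hE0, inv_ne_zero hE0, ?_⟩, ?_⟩
  · exact analyticAt_const.mul (((BSeq.coord k).analyticAt _).comp hm)
  · simp [hm0 k hk.le, hk.ne]
  · have h1 : ∀ᶠ z : ℂ × ℂ in 𝓝 0, IsUnit (B z.1) :=
      (continuous_fst.tendsto' (0 : ℂ × ℂ) 0 rfl).eventually hBu
    filter_upwards [h1, hF, Metric.ball_mem_nhds (0 : ℂ × ℂ) hs,
      hE.continuousAt.eventually_ne hE0] with z hz1 hz2 hz3 hz4
    have hz3 := mem_ball_zero_iff.mp hz3
    have hy : ‖(s : ℂ)⁻¹ * z.2‖ < 1 := by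
      rw [norm_mul, norm_inv, Complex.norm_real, Real.norm_of_nonneg hs.le, inv_mul_lt_one₀ hs]
      exact (norm_snd_le z).trans_lt hz3
    have h2 := hFs.eval_mulOp hs.le ((norm_fst_le z).trans hz3.le) hy (q z.1)
    rw [mul_inv_cancel_left₀ hs0, ← hz2] at h2
    have h3 := BSeq.hasSum_eval hy (m z.1)
    rw [eq_mul_inv_iff_mul_eq₀ hz4]
    have h4 : E z * h z = (s : ℂ) ^ d * BSeq.eval ((s : ℂ)⁻¹ * z.2) (m z.1) := by
      change (s : ℂ) ^ d * _ * _ = (s : ℂ) ^ d * BSeq.eval _ (ConvergesOn.mulOp F.1 s z.1 (q z.1))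
      rw [h2]
      ring
    rw [mul_comm, h4]
    have h5 : BSeq.eval ((s : ℂ)⁻¹ * z.2) (m z.1) = (∑ k ∈ Finset.range d,
        ((s : ℂ)⁻¹ * z.2) ^ k * m z.1 k) + ((s : ℂ)⁻¹ * z.2) ^ d := by
      refine h3.unique ?_
      rw [← hasSum_nat_add_iff' d, add_sub_cancel_left]
      have h6 := hmd z.1 hz1
      have h7 := hasSum_single (f := fun n : ℕ => ((s : ℂ)⁻¹ * z.2) ^ (n + d) * m z.1 (n + d)) 0
        fun n hn => by rw [h6, if_neg hn, mul_zero]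
      have h8 : m z.1 d = 1 := by simpa using h6 0
      simp only [zero_add, h8, mul_one] at h7
      exact h7
    rw [h5, weierstrassPoly, mul_add, add_comm, Finset.mul_sum]
    congr 1
    · rw [mul_pow, inv_pow, mul_inv_cancel_left₀ (pow_ne_zero _ hs0)]
    · refine Finset.sum_congr rfl fun k hk => ?_
      obtain ⟨j, rfl⟩ := Nat.exists_eq_add_of_lt (Finset.mem_range.mp hk)
      have e1 : k + j + 1 - k = j + 1 := by omega
      rw [e1, mul_pow, inv_pow, add_assoc, pow_add]
      field_simp
  · intro hreal k
    have hco : ∀ n, star (MvPowerSeries.coeff n F.1) = MvPowerSeries.coeff n F.1 := by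
      let G : ConvergentSeries ℂ := ⟨MvPowerSeries.map (starRingEnd ℂ) F.1, r, hr,
        hFr.congr fun n => by simp⟩
      have h1 : G = F := by
        refine ConvergentSeries.ext_of_eventuallyEq ?_
        filter_upwards [hF, hreal, tendsto_star_zero.eventually hF] with z h1 h2 h3
        rw [← h1, ← star_star (h z), ← h2, h3, seriesEval, seriesEval, tsum_star]
        refine tsum_congr fun n => ?_
        simp [seriesTerm, G, mul_comm, mul_left_comm]
      intro n
      have := congrArg (fun H : ConvergentSeries ℂ => MvPowerSeries.coeff n H.1) h1
      simpa [G] using this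
    have hst : Filter.Tendsto (star : ℂ → ℂ) (𝓝 0) (𝓝 0) :=
      continuous_star.tendsto' _ _ (star_zero _)
    filter_upwards [hBu, hst.eventually hBu, Metric.ball_mem_nhds (0 : ℂ) hs] with x h1 h2 h3
    have h3 := (mem_ball_zero_iff.mp h3).le
    have hone : star BSeq.one = BSeq.one := by
      ext n
      by_cases hn : n = 0 <;> simp [BSeq.one_apply, hn]
    have hB' : B (star x) (star (q x)) = BSeq.one := by
      change (BSeq.shiftLeft ^ d) (ConvergesOn.mulOp F.1 s (star x) (star (q x))) = _
      rw [hFs.star_mulOp hs.le hco h3]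
      ext n
      rw [BSeq.shiftLeft_pow_apply]
      change star (m x (n + d)) = _
      rw [hmd x h1, ← BSeq.one_apply, ← BSeq.star_apply, hone]
    -- With real coefficients, `star (q x)` solves the equation that defines `q (star x)`;
    -- invertibility of the operator makes the two equal.
    have hq' : q (star x) = star (q x) := by
      have h4 := congrArg (fun T : BSeq →L[ℂ] BSeq => T (star (q x)))
        (Ring.inverse_mul_cancel _ h2)
      have h5 : Ring.inverse (B (star x)) (B (star x) (star (q x))) = star (q x) := h4
      rw [hB'] at h5
      exact h5
    have hm' : m (star x) = star (m x) := by
      change ConvergesOn.mulOp F.1 s (star x) (q (star x)) = _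
      rw [hq', hFs.star_mulOp hs.le hco h3]
    rw [hm']
    simp

/-! ### Germs of curves with real branches -/

/-- A locally constant function on a punctured neighbourhood of the origin is constant. -/
theorem exists_eventually_eq_of_locally_constant {α : Type} [Nonempty α] {f : ℂ → α}
    (h : ∀ᶠ x in 𝓝[≠] (0 : ℂ), ∀ᶠ y in 𝓝 x, f y = f x) : ∃ a, ∀ᶠ x in 𝓝[≠] (0 : ℂ), f x = a := by
  -- In the discrete topology locally constant means continuous. The circles around 0 are connected,
  -- and so is the interval of positive radii; together they reach every point of the punctured
  -- disc.
  let _ : TopologicalSpace α := ⊥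
  have _ : DiscreteTopology α := ⟨rfl⟩
  obtain ⟨ε, hε, hball⟩ := Metric.mem_nhdsWithin_iff.mp h
  have hloc : ∀ x : ℂ, x ≠ 0 → ‖x‖ < ε → ContinuousAt f x := fun x hx hxε =>
    (continuousAt_const (y := f x)).congr
      ((hball ⟨mem_ball_zero_iff.mpr hxε, hx⟩).mono fun y hy => hy.symm)
  have hsph : ∀ x : ℂ, x ≠ 0 → ‖x‖ < ε → f x = f (‖x‖ : ℝ) := by
    intro x hx hxε
    have hc : IsPreconnected (Metric.sphere (0 : ℂ) ‖x‖) :=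
      isPreconnected_sphere (by rw [Complex.rank_real_complex]; norm_num) 0 _
    refine hc.constant (f := f) (fun y hy => ?_) (by simp) (by simp)
    have hy' : ‖y‖ = ‖x‖ := by simpa using hy
    exact (hloc y (norm_pos_iff.mp (hy' ▸ norm_pos_iff.mpr hx)) (hy' ▸ hxε)).continuousWithinAt
  refine ⟨f ((ε / 2 : ℝ) : ℂ), Metric.mem_nhdsWithin_iff.mpr ⟨ε, hε, fun x hx => ?_⟩⟩
  have hxε : ‖x‖ < ε := mem_ball_zero_iff.mp hx.1
  change f x = _
  rw [hsph x hx.2 hxε]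
  refine (isPreconnected_Ioo (a := (0 : ℝ)) (b := ε)).constant
    (f := fun t : ℝ => f (t : ℂ)) (fun t ht => ?_)
    ⟨norm_pos_iff.mpr hx.2, hxε⟩ ⟨half_pos hε, half_lt_self hε⟩
  refine ContinuousAt.continuousWithinAt ?_
  refine ContinuousAt.comp (g := f) (hloc _ ?_ ?_) Complex.continuous_ofReal.continuousAt
  · exact_mod_cast ht.1.ne'
  · simpa [abs_of_pos ht.1] using ht.2

/-- No nonempty union of branches of the zero set of `H` at the origin is disjoint from its
complex conjugate. -/
def HasRealBranches (H : ℂ × ℂ → ℂ) : Prop :=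
  ∀ A : Set (ℂ × ℂ),
    (∀ᶠ z in 𝓝[≠] (0 : ℂ × ℂ), H z = 0 → ∀ᶠ w in 𝓝 z, H w = 0 → (w ∈ A ↔ z ∈ A)) →
    (∀ᶠ z in 𝓝[≠] (0 : ℂ × ℂ), H z = 0 → z ∈ A → star z ∉ A) →
    ∀ᶠ z in 𝓝[≠] (0 : ℂ × ℂ), H z = 0 → z ∉ A

namespace HasRealBranches

variable {H K : ℂ × ℂ → ℂ}

theorem congr (hH : HasRealBranches H) (h : ∀ᶠ z in 𝓝 (0 : ℂ × ℂ), H z = 0 ↔ K z = 0) :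
    HasRealBranches K := by
  intro A h1 h2
  have h' := nhdsWithin_le_nhds (s := {(0 : ℂ × ℂ)}ᶜ) h
  have h3 := hH A ?_ ?_
  · filter_upwards [h3, h'] with z hz hz' hK
    exact hz (hz'.mpr hK)
  · filter_upwards [h1, h', nhdsWithin_le_nhds h.eventually_nhds] with z hz hz' hz'' hHz
    filter_upwards [hz (hz'.mp hHz), hz''] with w hw hw' hHw
    exact hw (hw'.mp hHw)
  · filter_upwards [h2, h'] with z hz hz' hHz
    exact hz (hz'.mp hHz)

/-- The conditions on A over the zeros of the product restrict to the zeros of each factor, and the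
two conclusions add up. -/
theorem mul (hH : HasRealBranches H) (hK : HasRealBranches K) :
    HasRealBranches fun z => H z * K z := by
  intro A h1 h2
  have h3 := hH A ?_ ?_
  have h4 := hK A ?_ ?_
  · filter_upwards [h3, h4] with z hz hz' h0
    exact (mul_eq_zero.mp h0).elim hz hz'
  · filter_upwards [h1] with z hz hz0
    filter_upwards [hz (by simp [hz0])] with w hw hw0
    exact hw (by simp [hw0])
  · filter_upwards [h2] with z hz hz0
    exact hz (by simp [hz0])
  · filter_upwards [h1] with z hz hz0
    filter_upwards [hz (by simp [hz0])] with w hw hw0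
    exact hw (by simp [hw0])
  · filter_upwards [h2] with z hz hz0
    exact hz (by simp [hz0])

/-- Invariance under local homeomorphisms that commute with complex conjugation. -/
theorem comp (hH : HasRealBranches H) {L L' : ℂ × ℂ → ℂ × ℂ} (hL0 : L 0 = 0) (hL'0 : L' 0 = 0)
    (hL : ∀ᶠ z in 𝓝 (0 : ℂ × ℂ), ContinuousAt L z) (hL' : ∀ᶠ z in 𝓝 (0 : ℂ × ℂ), ContinuousAt L' z)
    (h1 : ∀ᶠ z in 𝓝 (0 : ℂ × ℂ), L' (L z) = z) (h2 : ∀ᶠ z in 𝓝 (0 : ℂ × ℂ), L (L' z) = z)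
    (hs : ∀ᶠ z in 𝓝 (0 : ℂ × ℂ), L' (star z) = star (L' z)) :
    HasRealBranches fun z => H (L z) := by
  intro A hA1 hA2
  have tL : Filter.Tendsto L (𝓝 0) (𝓝 0) := by simpa [hL0] using hL.self_of_nhds.tendsto
  have tL' : Filter.Tendsto L' (𝓝 0) (𝓝 0) := by simpa [hL'0] using hL'.self_of_nhds.tendsto
  have tL'' : Filter.Tendsto L' (𝓝[≠] 0) (𝓝[≠] 0) := by
    refine tendsto_nhdsWithin_iff.mpr ⟨tL'.mono_left nhdsWithin_le_nhds, ?_⟩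
    filter_upwards [nhdsWithin_le_nhds h2, self_mem_nhdsWithin] with z hz hz0 hz1
    rw [Set.mem_singleton_iff.mp hz1, hL0] at hz
    exact hz0 hz.symm
  have tL3 : Filter.Tendsto L (𝓝[≠] 0) (𝓝[≠] 0) := by
    refine tendsto_nhdsWithin_iff.mpr ⟨tL.mono_left nhdsWithin_le_nhds, ?_⟩
    filter_upwards [nhdsWithin_le_nhds h1, self_mem_nhdsWithin] with z hz hz0 hz1
    rw [Set.mem_singleton_iff.mp hz1, hL'0] at hz
    exact hz0 hz.symm
  have h3 := hH (L' ⁻¹' A) ?_ ?_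
  · filter_upwards [tL3.eventually h3, nhdsWithin_le_nhds h1] with z hz hz1 hz0
    have := hz hz0
    rwa [Set.mem_preimage, hz1] at this
  · filter_upwards [tL''.eventually hA1, nhdsWithin_le_nhds h2, nhdsWithin_le_nhds h2.eventually_nhds,
      nhdsWithin_le_nhds hL'] with z hz hz2 hz3 hz4 hz0
    have h5 := hz4.eventually (hz (by rwa [hz2]))
    filter_upwards [h5, hz3] with w hw hw2 hw0
    exact hw (by rwa [hw2])
  · filter_upwards [tL''.eventually hA2, nhdsWithin_le_nhds h2, nhdsWithin_le_nhds hs]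
      with z hz hz2 hz3 hz0 hzA
    rw [Set.mem_preimage, hz3]
    exact hz (by rwa [hz2]) hzA

theorem comp_swap (hH : HasRealBranches H) : HasRealBranches fun z => H z.swap :=
  hH.comp (L := Prod.swap) (L' := Prod.swap) rfl rfl
    (Filter.Eventually.of_forall fun _ => continuous_swap.continuousAt)
    (Filter.Eventually.of_forall fun _ => continuous_swap.continuousAt)
    (by simp) (by simp) (Filter.Eventually.of_forall fun _ => rfl)

/-- Membership in A is locally constant on the punctured x-axis, which is connected, so A contains
all of it near 0 or nothing. The real points of the axis are their own conjugates and exclude the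
former. -/
theorem snd : HasRealBranches fun z => z.2 := by
  intro A h1 h2
  have t1 : Filter.Tendsto (fun x : ℂ => ((x, 0) : ℂ × ℂ)) (𝓝[≠] 0) (𝓝[≠] 0) :=
    tendsto_nhdsWithin_iff.mpr ⟨tendsto_prodMk_zero'.mono_left nhdsWithin_le_nhds, by
      filter_upwards [self_mem_nhdsWithin] with x hx hx0
      exact hx (by simpa using hx0)⟩
  have h3 : ∀ᶠ x in 𝓝[≠] (0 : ℂ), ∀ᶠ y in 𝓝 x, (((y, 0) : ℂ × ℂ) ∈ A) = (((x, 0) : ℂ × ℂ) ∈ A) := by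
    filter_upwards [t1.eventually h1] with x hx
    have h4 : Filter.Tendsto (fun y : ℂ => ((y, 0) : ℂ × ℂ)) (𝓝 x) (𝓝 (x, 0)) :=
      (Continuous.prodMk_left (0 : ℂ)).tendsto' _ _ rfl
    filter_upwards [h4.eventually (hx rfl)] with y hy
    exact propext (hy rfl)
  obtain ⟨P, hP⟩ := exists_eventually_eq_of_locally_constant h3
  have t2 : Filter.Tendsto (fun t : ℝ => (t : ℂ)) (𝓝[≠] 0) (𝓝[≠] 0) :=
    tendsto_nhdsWithin_iff.mpr ⟨(Complex.continuous_ofReal.tendsto' 0 0 rfl).mono_left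
      nhdsWithin_le_nhds, by
      filter_upwards [self_mem_nhdsWithin] with x hx hx0
      exact hx (by simpa using hx0)⟩
  obtain ⟨t, ht1, ht2⟩ := (t2.eventually (hP.and (t1.eventually h2))).exists
  have hPF : ¬P := by
    rw [← ht1]
    intro h
    refine ht2 rfl h ?_
    have : star (((t : ℂ), 0) : ℂ × ℂ) = ((t : ℂ), 0) := by ext <;> simp
    rwa [this]
  obtain ⟨ε, hε, hball⟩ := Metric.mem_nhdsWithin_iff.mp hP
  refine Metric.mem_nhdsWithin_iff.mpr ⟨ε, hε, ?_⟩
  rintro ⟨x, y⟩ hz (rfl : y = 0)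
  have hx : x ≠ 0 := fun h => hz.2 (by simp [h])
  have := hball ⟨mem_ball_zero_iff.mpr ((norm_fst_le _).trans_lt (mem_ball_zero_iff.mp hz.1)), hx⟩
  change (_ ∈ A) = P at this
  rwa [this]

theorem fst : HasRealBranches fun z => z.1 := snd.comp_swap

theorem of_ne_zero (hH : ContinuousAt H 0) (h0 : H 0 ≠ 0) : HasRealBranches H := by
  intro A _ _
  filter_upwards [nhdsWithin_le_nhds (hH.eventually_ne h0)] with z hz hz0
  exact absurd hz0 hz

end HasRealBranches

/-! ### Small roots of Weierstrass polynomials -/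

/-- For a root with ‖y‖ ≥ ε, division of the equation by y ^ d bounds 1 by the sum of ‖c k x‖ * ε⁻¹
^ (d - k), which tends to 0 with x. -/
theorem eventually_norm_lt_of_weierstrassPoly_eq_zero {d : ℕ} {c : ℕ → ℂ → ℂ}
    (hc : ∀ k < d, ContinuousAt (c k) 0) (hc0 : ∀ k < d, c k 0 = 0) {ε : ℝ} (hε : 0 < ε) :
    ∀ᶠ x in 𝓝 (0 : ℂ), ∀ y, weierstrassPoly d c (x, y) = 0 → ‖y‖ < ε := by
  have h1 : Filter.Tendsto (fun x => ∑ k ∈ Finset.range d, ‖c k x‖ * (ε⁻¹) ^ (d - k)) (𝓝 0)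
      (𝓝 0) := by
    have h2 : Filter.Tendsto (fun x => ∑ k ∈ Finset.range d, ‖c k x‖ * (ε⁻¹) ^ (d - k)) (𝓝 0)
        (𝓝 (∑ k ∈ Finset.range d, 0)) := tendsto_finsetSum _ fun k hk => ?_
    · simpa using h2
    have hk := Finset.mem_range.mp hk
    have := ((hc k hk).norm.tendsto).mul_const (ε⁻¹ ^ (d - k))
    simpa [hc0 k hk] using this
  filter_upwards [h1.eventually_lt_const one_pos] with x hx y hy
  by_contra! hle
  refine hx.not_ge ?_
  have hy0 : 0 < ‖y‖ := hε.trans_le hle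
  have h2 : ‖y‖ ^ d ≤ ∑ k ∈ Finset.range d, ‖c k x‖ * ‖y‖ ^ k := by
    have h3 : y ^ d = -∑ k ∈ Finset.range d, c k x * y ^ k := eq_neg_of_add_eq_zero_left hy
    rw [← norm_pow, h3, norm_neg]
    exact (norm_sum_le _ _).trans_eq (Finset.sum_congr rfl fun k _ => by rw [norm_mul, norm_pow])
  have h4 : ∑ k ∈ Finset.range d, ‖c k x‖ * ‖y‖ ^ k ≤
      (∑ k ∈ Finset.range d, ‖c k x‖ * ε⁻¹ ^ (d - k)) * ‖y‖ ^ d := by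
    rw [Finset.sum_mul]
    refine Finset.sum_le_sum fun k hk => ?_
    rw [mul_assoc]
    refine mul_le_mul_of_nonneg_left ?_ (norm_nonneg _)
    have e : ‖y‖ ^ d = ‖y‖ ^ (d - k) * ‖y‖ ^ k := by
      rw [← pow_add, Nat.sub_add_cancel (Finset.mem_range.mp hk).le]
    rw [e, ← mul_assoc, ← mul_pow]
    refine le_mul_of_one_le_left (by positivity) (one_le_pow₀ ?_)
    rw [inv_mul_eq_div]
    exact (one_le_div hε).mpr hle
  have h5 := h2.trans h4
  have h6 : 0 < ‖y‖ ^ d := by positivity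
  exact le_of_mul_le_mul_right (by simpa using h5) h6

/-- The polynomial `weierstrassPoly d c (x, ·)`. -/
def weierstrassPolynomial (d : ℕ) (c : ℕ → ℂ → ℂ) (x : ℂ) : Polynomial ℂ :=
  Polynomial.X ^ d + ∑ k ∈ Finset.range d, Polynomial.C (c k x) * Polynomial.X ^ k

@[simp] theorem eval_weierstrassPolynomial (d : ℕ) (c : ℕ → ℂ → ℂ) (x y : ℂ) :
    (weierstrassPolynomial d c x).eval y = weierstrassPoly d c (x, y) := by
  simp [weierstrassPolynomial, weierstrassPoly, Polynomial.eval_finsetSum]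

theorem degree_sum_C_mul_X_pow_lt (d : ℕ) (c : ℕ → ℂ → ℂ) (x : ℂ) :
    (∑ k ∈ Finset.range d, Polynomial.C (c k x) * Polynomial.X ^ k).degree < (d : WithBot ℕ) := by
  refine (Polynomial.degree_sum_le _ _).trans_lt ((Finset.sup_lt_iff (WithBot.bot_lt_coe d)).mpr
    fun k hk => ?_)
  exact (Polynomial.degree_C_mul_X_pow_le _ _).trans_lt
    (WithBot.coe_lt_coe.mpr (Finset.mem_range.mp hk))

theorem monic_weierstrassPolynomial (d : ℕ) (c : ℕ → ℂ → ℂ) (x : ℂ) :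
    (weierstrassPolynomial d c x).Monic :=
  Polynomial.monic_X_pow_add (degree_sum_C_mul_X_pow_lt d c x)

@[simp] theorem natDegree_weierstrassPolynomial (d : ℕ) (c : ℕ → ℂ → ℂ) (x : ℂ) :
    (weierstrassPolynomial d c x).natDegree = d := by
  refine Polynomial.natDegree_eq_of_degree_eq_some ?_
  rw [weierstrassPolynomial, Polynomial.degree_add_eq_left_of_degree_lt, Polynomial.degree_X_pow]
  rw [Polynomial.degree_X_pow]
  exact degree_sum_C_mul_X_pow_lt d c x

/-- The zeros of a germ of positive regularity order persist. -/
theorem HasRegOrder.eventually_exists_zero {h : ℂ × ℂ → ℂ} {d : ℕ} (hh : AnalyticAt ℂ h 0)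
    (hd : HasRegOrder h d) (hd0 : d ≠ 0) {ε : ℝ} (hε : 0 < ε) :
    ∀ᶠ x in 𝓝 (0 : ℂ), ∃ y, ‖y‖ < ε ∧ h (x, y) = 0 := by
  obtain ⟨c, hc, hc0, ⟨V, -, -, hV⟩, -⟩ := hh.weierstrass_preparation hd
  obtain ⟨δ, hδ, hball⟩ := Metric.mem_nhds_iff.mp hV
  filter_upwards [eventually_norm_lt_of_weierstrassPoly_eq_zero (fun k _ => (hc k).continuousAt)
    hc0 (lt_min hε hδ), Metric.ball_mem_nhds (0 : ℂ) hδ] with x hx hxδ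
  obtain ⟨y, hy⟩ := IsAlgClosed.exists_root (weierstrassPolynomial d c x) (by
    rw [Polynomial.degree_eq_natDegree (monic_weierstrassPolynomial d c x).ne_zero]
    simpa using hd0)
  rw [Polynomial.IsRoot, eval_weierstrassPolynomial] at hy
  have h1 := hx y hy
  refine ⟨y, h1.trans_le (min_le_left _ _), ?_⟩
  have h2 : h (x, y) = weierstrassPoly d c (x, y) * V (x, y) := hball (by
    rw [mem_ball_zero_iff, Prod.norm_def]
    exact max_lt (mem_ball_zero_iff.mp hxδ) (h1.trans_le (min_le_right _ _)))
  rw [h2, hy, zero_mul]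

/-! ### Blowing up germs with real branches -/

/-- Zeros of h (0, ·) are isolated, so a small circle avoids them, and by compactness of the circle
this persists for small u. The tube over its disc then isolates the zeros near the origin: none can
cross its boundary. -/
theorem exists_circle_ne_zero {h : ℂ × ℂ → ℂ} (hh : AnalyticAt ℂ h 0)
    (h0 : ¬ ∀ᶠ v in 𝓝 (0 : ℂ), h (0, v) = 0) {ρ : ℝ} (hρ : 0 < ρ) :
    ∃ ε, 0 < ε ∧ ε < ρ ∧ (∀ v, v ≠ 0 → ‖v‖ ≤ ε → h (0, v) ≠ 0) ∧
      ∀ᶠ u in 𝓝 (0 : ℂ), ∀ v : ℂ, ‖v‖ = ε → h (u, v) ≠ 0 := by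
  have h1 := hh.comp_prodMk_zero.eventually_eq_zero_or_eventually_ne_zero.resolve_left h0
  obtain ⟨δ, hδ, hball⟩ := Metric.mem_nhdsWithin_iff.mp h1
  obtain ⟨δ', hδ', hball'⟩ := Metric.mem_nhds_iff.mp hh.eventually_continuousAt
  set ε := min (min δ δ') ρ / 2
  have hm : 0 < min (min δ δ') ρ := by positivity
  have e0 : 0 < ε := by positivity
  have e1 : ε < min (min δ δ') ρ := half_lt_self hm
  have e2 : ε < δ := e1.trans_le ((min_le_left _ _).trans (min_le_left _ _))
  have e3 : ε < δ' := e1.trans_le ((min_le_left _ _).trans (min_le_right _ _))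
  have hne : ∀ v : ℂ, v ≠ 0 → ‖v‖ ≤ ε → h (0, v) ≠ 0 := fun v hv hvε =>
    hball ⟨mem_ball_zero_iff.mpr (hvε.trans_lt e2), hv⟩
  refine ⟨ε, e0, e1.trans_le (min_le_right _ _), hne, ?_⟩
  have h2 := (isCompact_sphere (0 : ℂ) ε).eventually_forall_of_forall_eventually
    (x₀ := (0 : ℂ)) (P := fun u v => h (u, v) ≠ 0) fun v hv => by
      have hv' : ‖v‖ = ε := by simpa using hv
      have hc : ContinuousAt h (0, v) := hball' (by
        rw [mem_ball_zero_iff, Prod.norm_def]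
        simpa [hv'] using ⟨hδ', e3⟩)
      exact hc.eventually_ne (hne v (norm_pos_iff.mp (hv' ▸ e0)) hv'.le)
  filter_upwards [h2] with u hu v hv
  exact hu v (by simpa using hv)

/-- Away from the exceptional curve, sets of slopes near `c` in the punctured zero germ of `h` are
open and closed. -/
theorem HasRealBranches.strictTransform_some {h h' : ℂ × ℂ → ℂ} {M : ℕ} {c : ℂ}
    (hR : HasRealBranches h) (hh' : AnalyticAt ℂ h' 0)
    (hM : ∀ᶠ w in 𝓝 (0 : ℂ × ℂ), h (blowMap (some c) w) = w.1 ^ M * h' w)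
    (h0 : ¬ ∀ᶠ v in 𝓝 (0 : ℂ), h' (0, v) = 0) (hc : star c = c) : HasRealBranches h' := by
  intro A' hA1 hA2
  obtain ⟨δ, hδ, hball⟩ := Metric.mem_nhdsWithin_iff.mp (hA1.and (hA2.and (nhdsWithin_le_nhds hM)))
  obtain ⟨ε, hε, hεδ, hne, hcirc⟩ := exists_circle_ne_zero hh' h0 hδ
  obtain ⟨η, hη, hη'⟩ := Metric.mem_nhds_iff.mp hcirc
  -- A is `A'` pushed down to the sector of slopes within ε of c. Zeros of `h` off the y-axis in
  -- this sector correspond to zeros of `h'` in the tube, and there are none on its boundary; so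
  -- cutting off at ε keeps A open and closed in the zero germ.
  let A : Set (ℂ × ℂ) := {z | z.1 ≠ 0 ∧ ‖z.2 / z.1 - c‖ < ε ∧ (z.1, z.2 / z.1 - c) ∈ A'}
  have key : ∀ z : ℂ × ℂ, z.1 ≠ 0 → blowMap (some c) (z.1, z.2 / z.1 - c) = z := by
    intro z hz
    ext
    · rfl
    · simp only [blowMap_some, sub_add_cancel]
      field_simp
  have hmem : ∀ z : ℂ × ℂ, z.1 ≠ 0 → ‖z.1‖ < min δ η → ‖z.2 / z.1 - c‖ ≤ ε →
      (z.1, z.2 / z.1 - c) ∈ Metric.ball (0 : ℂ × ℂ) δ ∩ {0}ᶜ := by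
    intro z hz1 hz2 hz3
    refine ⟨?_, fun h => hz1 (congrArg Prod.fst h)⟩
    rw [mem_ball_zero_iff, Prod.norm_def]
    exact max_lt (hz2.trans_le (min_le_left _ _)) (hz3.trans_lt hεδ)
  have hzero : ∀ z : ℂ × ℂ, z.1 ≠ 0 → ‖z.1‖ < min δ η → ‖z.2 / z.1 - c‖ ≤ ε → h z = 0 →
      h' (z.1, z.2 / z.1 - c) = 0 := by
    intro z hz1 hz2 hz3 hz
    have h1 := (hball (hmem z hz1 hz2 hz3)).2.2
    rw [key z hz1, hz] at h1
    exact (mul_eq_zero.mp h1.symm).resolve_left (pow_ne_zero _ hz1)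
  have hnear : ∀ᶠ z : ℂ × ℂ in 𝓝 0, ‖z.1‖ < min δ η := by
    filter_upwards [Metric.ball_mem_nhds (0 : ℂ × ℂ) (lt_min hδ hη)] with z hz
    exact (norm_fst_le z).trans_lt (mem_ball_zero_iff.mp hz)
  have hslope : ∀ z : ℂ × ℂ, z.1 ≠ 0 → ContinuousAt (fun w : ℂ × ℂ => w.2 / w.1 - c) z :=
    fun z hz => (continuousAt_snd.div continuousAt_fst hz).sub continuousAt_const
  have h3 := hR A ?_ ?_
  · have t : Filter.Tendsto (blowMap (some c)) (𝓝 0) (𝓝 0) := tendsto_blowMap _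
    have h4 := t.eventually (eventually_nhdsWithin_iff.mp h3)
    refine eventually_nhdsWithin_iff.mpr ?_
    filter_upwards [h4, hM, Metric.ball_mem_nhds (0 : ℂ × ℂ) hε] with w hw hwM hwε hw0 hz hwA
    have hwε := mem_ball_zero_iff.mp hwε
    have hw2 : ‖w.2‖ < ε := (norm_snd_le w).trans_lt hwε
    by_cases hw1 : w.1 = 0
    -- Points of the exceptional curve are not seen below, but `h'` has no zero there other than the
    -- center.
    · have hw2' : w.2 ≠ 0 := fun h => hw0 (Prod.ext hw1 h)
      refine hne w.2 hw2' hw2.le ?_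
      have : w = (0, w.2) := Prod.ext hw1 rfl
      rwa [this] at hz
    · have e : w.1 * (w.2 + c) / w.1 - c = w.2 := by field_simp; ring
      refine hw ?_ (by rw [hwM, hz, mul_zero]) ⟨hw1, ?_, ?_⟩
      · exact fun h => hw1 (congrArg Prod.fst h)
      · simpa [e] using hw2
      · simpa [e] using hwA
  · refine nhdsWithin_le_nhds.trans le_rfl |> fun (hle : 𝓝[≠] (0 : ℂ × ℂ) ≤ 𝓝 0) => ?_
    filter_upwards [hle hnear, hle hnear.eventually_nhds, self_mem_nhdsWithin] with z hz hzn hz0 hhz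
    by_cases hz1 : z.1 = 0
    · have hz2 : z.2 ≠ 0 := fun h => hz0 (Prod.ext hz1 h)
      have hzA : z ∉ A := fun h => h.1 hz1
      -- Near a point of the y-axis other than the origin the slopes are large, so A is empty
      -- nearby.
      have hlim : ∀ᶠ w : ℂ × ℂ in 𝓝 z, (‖c‖ + ε) * ‖w.1‖ < ‖w.2‖ := by
        refine ContinuousAt.eventually_lt (by fun_prop) (by fun_prop) ?_
        simpa [hz1] using hz2
      filter_upwards [hlim] with w hw _
      refine iff_of_false (fun h => hw.not_ge ?_) hzA
      have h5 : ‖w.2 / w.1‖ ≤ ‖c‖ + ε := by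
        calc ‖w.2 / w.1‖ = ‖c + (w.2 / w.1 - c)‖ := by congr 1; ring
          _ ≤ ‖c‖ + ‖w.2 / w.1 - c‖ := norm_add_le _ _
          _ ≤ ‖c‖ + ε := by linarith [h.2.1]
      rwa [norm_div, div_le_iff₀ (norm_pos_iff.mpr h.1)] at h5
    · rcases lt_trichotomy ‖z.2 / z.1 - c‖ ε with hlt | heq | hgt
      · have h5 := (hball (hmem z hz1 hz hlt.le)).1 (hzero z hz1 hz hlt.le hhz)
        have hct : ContinuousAt (fun w : ℂ × ℂ => (w.1, w.2 / w.1 - c)) z :=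
          continuousAt_fst.prodMk (hslope z hz1)
        filter_upwards [hct.eventually h5, continuousAt_fst.eventually_ne hz1,
          (hslope z hz1).norm.eventually_lt_const hlt, hzn] with w hw hw1 hw2 hw3 hhw
        have := hw (hzero w hw1 hw3 hw2.le hhw)
        exact ⟨fun h => ⟨hz1, hlt, this.mp h.2.2⟩, fun h => ⟨hw1, hw2, this.mpr h.2.2⟩⟩
      · exact absurd (hzero z hz1 hz heq.le hhz)
          (hη' (mem_ball_zero_iff.mpr (hz.trans_le (min_le_right _ _))) _ heq)
      · filter_upwards [(hslope z hz1).norm.eventually_const_lt hgt] with w hw _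
        exact iff_of_false (fun h => h.2.1.not_gt hw) (fun h => h.2.1.not_gt hgt)
  · filter_upwards [nhdsWithin_le_nhds hnear] with z hz hhz hzA hsA
    have h5 := (hball (hmem z hzA.1 hz hzA.2.1.le)).2.1 (hzero z hzA.1 hz hzA.2.1.le hhz) hzA.2.2
    refine h5 ?_
    have h6 := hsA.2.2
    have : star (z.1, z.2 / z.1 - c) = ((star z).1, (star z).2 / (star z).1 - c) := by
      ext
      · simp
      · simp only [Prod.snd_star, Prod.fst_star, star_sub, star_div₀, hc]
    rwa [this]

/-- The vertical chart `blowMap none` is `blowMap (some 0)` followed by the swap of the coordinates.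
-/
theorem HasRealBranches.strictTransform {h h' : ℂ × ℂ → ℂ} {M : ℕ} {c : Option ℂ}
    (hR : HasRealBranches h) (hh' : AnalyticAt ℂ h' 0)
    (hM : ∀ᶠ w in 𝓝 (0 : ℂ × ℂ), h (blowMap c w) = w.1 ^ M * h' w)
    (h0 : ¬ ∀ᶠ v in 𝓝 (0 : ℂ), h' (0, v) = 0) (hc : c.map star = c) : HasRealBranches h' := by
  cases c with
  | none =>
    refine hR.comp_swap.strictTransform_some hh' (c := 0) (M := M) ?_ h0 (star_zero _)
    filter_upwards [hM] with w hw
    simpa using hw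
  | some c => exact hR.strictTransform_some hh' hM h0 (by simpa using hc)

/-- At a non-real point of the exceptional curve, the strict transform is a unit. -/
theorem HasRealBranches.strictTransform_ne_zero {h h' : ℂ × ℂ → ℂ} {M : ℕ} {c : ℂ}
    (hR : HasRealBranches h) (hh' : AnalyticAt ℂ h' 0)
    (hM : ∀ᶠ w in 𝓝 (0 : ℂ × ℂ), h (blowMap (some c) w) = w.1 ^ M * h' w)
    (h0 : ¬ ∀ᶠ v in 𝓝 (0 : ℂ), h' (0, v) = 0) (hc : star c ≠ c) : h' 0 ≠ 0 := by
  intro h00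
  -- Sectors of slopes around `c` and around its conjugate are disjoint when their radius is at most
  -- half the distance of these two points.
  have hcc : 0 < ‖c - star c‖ / 2 := half_pos (norm_pos_iff.mpr (sub_ne_zero.mpr hc.symm))
  obtain ⟨δ, hδ, hball⟩ := Metric.mem_nhds_iff.mp hM
  obtain ⟨ε, hε, hεδ, hne, hcirc⟩ := exists_circle_ne_zero hh' h0 (lt_min hcc hδ)
  obtain ⟨η, hη, hη'⟩ := Metric.mem_nhds_iff.mp hcirc
  let A : Set (ℂ × ℂ) := {z | z.1 ≠ 0 ∧ ‖z.2 / z.1 - c‖ < ε}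
  have hslope : ∀ z : ℂ × ℂ, z.1 ≠ 0 → ContinuousAt (fun w : ℂ × ℂ => w.2 / w.1 - c) z :=
    fun z hz => (continuousAt_snd.div continuousAt_fst hz).sub continuousAt_const
  have h3 := hR A ?_ ?_
  -- If `h'` vanished at the origin it would have positive order, and its zeros would persist for
  -- small u ≠ 0. Their images are zeros of `h` in the sector A, which has none.
  · obtain ⟨e, he⟩ := hh'.exists_hasRegOrder h0
    have he0 : e ≠ 0 := by
      rintro rfl
      exact he.ne_zero_of_zero h00
    obtain ⟨δ₂, hδ₂, hb2⟩ := Metric.mem_nhds_iff.mp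
      ((tendsto_blowMap (some c)).eventually (eventually_nhdsWithin_iff.mp h3))
    have h4 := he.eventually_exists_zero hh' he0 (lt_min (lt_min hε hδ) hδ₂)
    obtain ⟨u, ⟨⟨v, hv, hhv⟩, hu⟩, hu0⟩ := ((h4.and
      (Metric.ball_mem_nhds (0 : ℂ) (lt_min hδ hδ₂))).filter_mono (nhdsWithin_le_nhds (s := {(0 : ℂ)}ᶜ))
      |>.and self_mem_nhdsWithin).exists
    have hu := mem_ball_zero_iff.mp hu
    have hu0 : u ≠ 0 := hu0
    have m1 : ((u, v) : ℂ × ℂ) ∈ Metric.ball (0 : ℂ × ℂ) δ := by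
      rw [mem_ball_zero_iff, Prod.norm_def]
      exact max_lt (hu.trans_le (min_le_left _ _))
        (hv.trans_le ((min_le_left _ _).trans (min_le_right _ _)))
    have m2 : ((u, v) : ℂ × ℂ) ∈ Metric.ball (0 : ℂ × ℂ) δ₂ := by
      rw [mem_ball_zero_iff, Prod.norm_def]
      exact max_lt (hu.trans_le (min_le_right _ _)) (hv.trans_le (min_le_right _ _))
    have h5 : h (blowMap (some c) (u, v)) = u ^ M * h' (u, v) := hball m1
    refine hb2 m2 (fun h => hu0 (congrArg Prod.fst h)) (by rw [h5, hhv, mul_zero]) ⟨hu0, ?_⟩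
    have e : u * (v + c) / u - c = v := by field_simp; ring
    simpa [e] using hv.trans_le ((min_le_left _ _).trans (min_le_left _ _))
  · have hnear : ∀ᶠ z : ℂ × ℂ in 𝓝 0, ‖z.1‖ < min δ η := by
      filter_upwards [Metric.ball_mem_nhds (0 : ℂ × ℂ) (lt_min hδ hη)] with z hz
      exact (norm_fst_le z).trans_lt (mem_ball_zero_iff.mp hz)
    filter_upwards [nhdsWithin_le_nhds hnear, self_mem_nhdsWithin] with z hz hz0 hhz
    by_cases hz1 : z.1 = 0
    · have hz2 : z.2 ≠ 0 := fun h => hz0 (Prod.ext hz1 h)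
      have hzA : z ∉ A := fun h => h.1 hz1
      have hlim : ∀ᶠ w : ℂ × ℂ in 𝓝 z, (‖c‖ + ε) * ‖w.1‖ < ‖w.2‖ := by
        refine ContinuousAt.eventually_lt (by fun_prop) (by fun_prop) ?_
        simpa [hz1] using hz2
      filter_upwards [hlim] with w hw _
      refine iff_of_false (fun h => hw.not_ge ?_) hzA
      have h5 : ‖w.2 / w.1‖ ≤ ‖c‖ + ε := by
        calc ‖w.2 / w.1‖ = ‖c + (w.2 / w.1 - c)‖ := by congr 1; ring
          _ ≤ ‖c‖ + ‖w.2 / w.1 - c‖ := norm_add_le _ _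
          _ ≤ ‖c‖ + ε := by linarith [h.2]
      rwa [norm_div, div_le_iff₀ (norm_pos_iff.mpr h.1)] at h5
    · rcases lt_trichotomy ‖z.2 / z.1 - c‖ ε with hlt | heq | hgt
      · filter_upwards [continuousAt_fst.eventually_ne hz1,
          (hslope z hz1).norm.eventually_lt_const hlt] with w hw1 hw2 _
        exact iff_of_true ⟨hw1, hw2⟩ ⟨hz1, hlt⟩
      · have m : (z.1, z.2 / z.1 - c) ∈ Metric.ball (0 : ℂ × ℂ) δ := by
          rw [mem_ball_zero_iff, Prod.norm_def]
          exact max_lt (hz.trans_le (min_le_left _ _))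
            (heq.trans_lt (hεδ.trans_le (min_le_right _ _)))
        have h5 : h (blowMap (some c) (z.1, z.2 / z.1 - c)) = z.1 ^ M * h' (z.1, z.2 / z.1 - c) :=
          hball m
        have h6 : blowMap (some c) (z.1, z.2 / z.1 - c) = z := by
          ext
          · rfl
          · simp only [blowMap_some, sub_add_cancel]
            field_simp
        rw [h6, hhz] at h5
        exact absurd ((mul_eq_zero.mp h5.symm).resolve_left (pow_ne_zero _ hz1))
          (hη' (mem_ball_zero_iff.mpr (hz.trans_le (min_le_right _ _))) _ heq)
      · filter_upwards [(hslope z hz1).norm.eventually_const_lt hgt] with w hw _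
        exact iff_of_false (fun h => h.2.not_gt hw) (fun h => h.2.not_gt hgt)
  · refine Filter.Eventually.of_forall fun z _ hzA hsA => ?_
    have h5 := hzA.2
    have h6 : ‖star (star (z.2 / z.1) - c)‖ < ε := by
      rw [norm_star, star_div₀]
      exact hsA.2
    rw [star_sub, star_star] at h6
    have h7 : ‖c - star c‖ < 2 * ε := by
      calc ‖c - star c‖ = ‖(z.2 / z.1 - star c) - (z.2 / z.1 - c)‖ := by congr 1; ring
        _ ≤ _ := norm_sub_le _ _
        _ < 2 * ε := by linarith
    have h8 := hεδ.trans_le (min_le_left _ _)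
    linarith

/-! ### Analytic families of polynomials -/

/-- The coefficients of the polynomials `P x` are analytic functions of `x` at `x₀`. -/
def AnalyticCoeffAt (P : ℂ → Polynomial ℂ) (x₀ : ℂ) : Prop :=
  ∀ k, AnalyticAt ℂ (fun x => (P x).coeff k) x₀

theorem AnalyticCoeffAt.congr {P Q : ℂ → Polynomial ℂ} {x₀ : ℂ} (hP : AnalyticCoeffAt P x₀)
    (h : ∀ᶠ x in 𝓝 x₀, P x = Q x) : AnalyticCoeffAt Q x₀ := fun k =>
  (hP k).congr (h.mono fun x hx => by simp only [hx])

theorem AnalyticCoeffAt.mul {P Q : ℂ → Polynomial ℂ} {x₀ : ℂ} (hP : AnalyticCoeffAt P x₀)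
    (hQ : AnalyticCoeffAt Q x₀) : AnalyticCoeffAt (fun x => P x * Q x) x₀ := fun k => by
  simp only [Polynomial.coeff_mul]
  exact Finset.analyticAt_fun_sum _ fun ij _ => (hP ij.1).mul (hQ ij.2)

theorem AnalyticCoeffAt.prod {ι : Type} {P : ι → ℂ → Polynomial ℂ} {x₀ : ℂ} (s : Finset ι)
    (hP : ∀ i ∈ s, AnalyticCoeffAt (P i) x₀) : AnalyticCoeffAt (fun x => ∏ i ∈ s, P i x) x₀ := by
  classical
  induction s using Finset.induction_on with
  | empty => exact fun k => analyticAt_const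
  | insert i s hi ih =>
    simp only [Finset.prod_insert hi]
    exact (hP i (by simp)).mul (ih fun j hj => hP j (by simp [hj]))

theorem rootMultiplicity_eq_of_mul {P W : Polynomial ℂ} (hP : P ≠ 0) (hW : W ≠ 0) {V : ℂ → ℂ}
    {y : ℂ} (hV : ContinuousAt V y) (hV0 : V y ≠ 0)
    (h : ∀ᶠ t in 𝓝 y, P.eval t = W.eval t * V t) :
    P.rootMultiplicity y = W.rootMultiplicity y := by
  obtain ⟨p, hp, hp0⟩ := Polynomial.exists_eq_pow_rootMultiplicity_mul_and_not_dvd P hP y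
  obtain ⟨w, hw, hw0⟩ := Polynomial.exists_eq_pow_rootMultiplicity_mul_and_not_dvd W hW y
  have hp0 : p.eval y ≠ 0 := fun h => hp0 (Polynomial.dvd_iff_isRoot.mpr h)
  have hw0 : w.eval y ≠ 0 := fun h => hw0 (Polynomial.dvd_iff_isRoot.mpr h)
  set a := P.rootMultiplicity y
  set b := W.rootMultiplicity y
  have t : Filter.Tendsto (fun u : ℂ => y + u) (𝓝 0) (𝓝 y) :=
    (continuous_const.add continuous_id).tendsto' _ _ (add_zero y)
  have h1 : ∀ᶠ u in 𝓝 (0 : ℂ), u ^ a * p.eval (y + u) = u ^ b * (w.eval (y + u) * V (y + u)) := by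
    filter_upwards [t.eventually h] with u hu
    rw [hp, hw] at hu
    simp only [Polynomial.eval_mul, Polynomial.eval_pow, Polynomial.eval_sub, Polynomial.eval_X,
      Polynomial.eval_C, add_sub_cancel_left] at hu
    rw [hu]
    ring
  have c1 : ContinuousAt (fun u => p.eval (y + u)) 0 :=
    (p.continuous.comp (continuous_const.add continuous_id)).continuousAt
  have c2 : ContinuousAt (fun u => w.eval (y + u) * V (y + u)) 0 := by
    refine (w.continuous.comp (continuous_const.add continuous_id)).continuousAt.mul ?_
    exact ContinuousAt.comp (g := V) (by simpa using hV)
      (continuous_const.add continuous_id).continuousAt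
  refine le_antisymm (le_of_pow_mul_eq c1 c2 (by simpa using ⟨hw0, hV0⟩) h1).1
    (le_of_pow_mul_eq c2 c1 (by simpa using hp0) (h1.mono fun _ => Eq.symm)).1

/-- Near a root `y₀` of `P x₀`, the roots of `P x` are those of a monic polynomial of degree the
multiplicity of `y₀`, with analytic coefficients. -/
theorem exists_local_factor {P : ℂ → Polynomial ℂ} {x₀ y₀ : ℂ}
    (hP : AnalyticAt ℂ (fun z : ℂ × ℂ => (P z.1).eval z.2) (x₀, y₀)) (hP0 : ∀ᶠ x in 𝓝 x₀, P x ≠ 0)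
    {U : Set ℂ} (hU : U ∈ 𝓝 y₀) :
    ∃ (W : ℂ → Polynomial ℂ) (T : Set ℂ), T ⊆ U ∧ AnalyticCoeffAt W x₀ ∧
      (∀ x, (W x).Monic) ∧ (∀ x, (W x).natDegree = (P x₀).rootMultiplicity y₀) ∧
      ∀ᶠ x in 𝓝 x₀, (∀ y, (W x).IsRoot y → y ∈ T) ∧
        ∀ y ∈ T, (P x).rootMultiplicity y = (W x).rootMultiplicity y := by
  -- Moved to the origin, the family is a germ of regularity order `m`; its Weierstrass polynomial,
  -- moved back, is the local factor.
  set m := (P x₀).rootMultiplicity y₀ with hm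
  let h : ℂ × ℂ → ℂ := fun z => (P (x₀ + z.1)).eval (y₀ + z.2)
  have hh : AnalyticAt ℂ h 0 := by
    refine AnalyticAt.comp_of_eq (g := fun z : ℂ × ℂ => (P z.1).eval z.2)
      (f := fun z : ℂ × ℂ => (x₀ + z.1, y₀ + z.2)) hP
      ((analyticAt_const.add analyticAt_fst).prod (analyticAt_const.add analyticAt_snd)) (by simp)
  have hreg : HasRegOrder h m := by
    obtain ⟨p, hp, hp0⟩ :=
      Polynomial.exists_eq_pow_rootMultiplicity_mul_and_not_dvd (P x₀) hP0.self_of_nhds y₀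
    have hp0 : p.eval y₀ ≠ 0 := fun h => hp0 (Polynomial.dvd_iff_isRoot.mpr h)
    refine ⟨fun u => p.eval (y₀ + u), ?_, by simpa using hp0, ?_⟩
    · have h1 : AnalyticAt ℂ (fun y => Polynomial.aeval y p) (y₀ + 0) :=
        (AnalyticAt.aeval_polynomial (analyticAt_id (z := y₀ + 0)) p)
      simp only [Polynomial.coe_aeval_eq_eval] at h1
      exact AnalyticAt.comp (g := fun y => p.eval y) (f := fun u => y₀ + u) h1
        (analyticAt_const.add analyticAt_id)
    · refine Filter.Eventually.of_forall fun u => ?_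
      simp only [h, add_zero]
      rw [hp, ← hm]
      simp
  obtain ⟨c, hc, hc0, ⟨V, hV, hV0, hVe⟩, -⟩ := hh.weierstrass_preparation hreg
  obtain ⟨ρ₁, hρ₁, hb1⟩ := Metric.mem_nhds_iff.mp hU
  obtain ⟨ρ₂, hρ₂, hb2⟩ := Metric.mem_nhds_iff.mp
    (hVe.and (hV.eventually_continuousAt.and (hV.continuousAt.eventually_ne hV0)))
  set ρ := min ρ₁ ρ₂
  have hρ : 0 < ρ := lt_min hρ₁ hρ₂
  let W : ℂ → Polynomial ℂ := fun x =>
    (weierstrassPolynomial m c (x - x₀)).comp (Polynomial.X - Polynomial.C y₀)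
  have hWe : ∀ x y, (W x).eval y = weierstrassPoly m c (x - x₀, y - y₀) := fun x y => by
    simp [W]
  have hWm : ∀ x, (W x).Monic := fun x =>
    (monic_weierstrassPolynomial m c _).comp (Polynomial.monic_X_sub_C y₀) (by simp)
  refine ⟨W, Metric.ball y₀ ρ, (Metric.ball_subset_ball (min_le_left _ _)).trans hb1, ?_, hWm,
    fun x => ?_, ?_⟩
  · intro k
    have e : ∀ x, W x = (Polynomial.X - Polynomial.C y₀) ^ m +
        ∑ k ∈ Finset.range m, Polynomial.C (c k (x - x₀)) * (Polynomial.X - Polynomial.C y₀) ^ k :=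
      fun x => by
        simp only [W, weierstrassPolynomial, Polynomial.add_comp, Polynomial.X_pow_comp]
        congr 1
        rw [Polynomial.sum_comp]
        simp
    simp only [e, Polynomial.coeff_add, Polynomial.finsetSum_coeff, Polynomial.coeff_C_mul]
    refine analyticAt_const.add (Finset.analyticAt_fun_sum _ fun j _ => ?_)
    refine AnalyticAt.mul ?_ analyticAt_const
    exact AnalyticAt.comp_of_eq (hc j) (analyticAt_id.sub analyticAt_const) (sub_self _)
  · simp [W, Polynomial.natDegree_comp]
  · have t : Filter.Tendsto (fun x : ℂ => x - x₀) (𝓝 x₀) (𝓝 0) :=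
      (continuous_id.sub continuous_const).tendsto' _ _ (sub_self x₀)
    filter_upwards [t.eventually (eventually_norm_lt_of_weierstrassPoly_eq_zero
      (fun k _ => (hc k).continuousAt) hc0 hρ), hP0, t.eventually (Metric.ball_mem_nhds 0 hρ)]
      with x hx hx0 hxb
    refine ⟨fun y hy => ?_, fun y hy => ?_⟩
    · rw [Metric.mem_ball, dist_eq_norm]
      exact hx _ (by rw [← hWe]; exact hy)
    · have hmem : ∀ t ∈ Metric.ball y₀ ρ, ((x - x₀, t - y₀) : ℂ × ℂ) ∈ Metric.ball (0 : ℂ × ℂ) ρ₂ := by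
        intro t ht
        rw [mem_ball_zero_iff, Prod.norm_def]
        refine max_lt ((mem_ball_zero_iff.mp hxb).trans_le (min_le_right _ _)) ?_
        rw [Metric.mem_ball, dist_eq_norm] at ht
        exact ht.trans_le (min_le_right _ _)
      refine rootMultiplicity_eq_of_mul (V := fun t => V (x - x₀, t - y₀)) hx0 (hWm x).ne_zero
        ?_ (hb2 (hmem y hy)).2.2 ?_
      · exact ContinuousAt.comp (g := V) (f := fun t => (x - x₀, t - y₀)) (hb2 (hmem y hy)).2.1
          (by fun_prop)
      · filter_upwards [Metric.isOpen_ball.mem_nhds hy] with t ht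
        have := (hb2 (hmem t ht)).1
        rw [hWe, ← this]
        simp [h]

/-! ### Splitting the roots of a polynomial along a set of branches -/

theorem exists_finset_pairwiseDisjoint_nhds (S : Finset ℂ) :
    ∃ ρ : ℝ, 0 < ρ ∧ ∀ a ∈ S, ∀ b ∈ S, a ≠ b → Disjoint (Metric.ball a ρ) (Metric.ball b ρ) := by
  obtain ⟨U, hU, hd⟩ := S.finite_toSet.t2_separation
  have h1 : ∀ a ∈ S, ∀ᶠ ρ in 𝓝[>] (0 : ℝ), Metric.ball a ρ ⊆ U a := by
    intro a ha
    obtain ⟨ρ, hρ, hb⟩ := Metric.isOpen_iff.mp (hU a).2 a (hU a).1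
    filter_upwards [Ioo_mem_nhdsGT hρ] with t ht
    exact (Metric.ball_subset_ball ht.2.le).trans hb
  have h2 := (Filter.eventually_all_finset S).mpr h1
  obtain ⟨ρ, h3, h4⟩ := (h2.and self_mem_nhdsWithin).exists
  exact ⟨ρ, h4, fun a ha b hb hab => (hd ha hb hab).mono (h3 a ha) (h3 b hb)⟩

theorem prod_map_filter_sum {ι α β : Type} [CommMonoid β] (s : Finset ι) (R : ι → Multiset α)
    (p : α → Prop) [DecidablePred p] (f : α → β) :
    (((∑ i ∈ s, R i).filter p).map f).prod = ∏ i ∈ s, (((R i).filter p).map f).prod := by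
  classical
  induction s using Finset.induction_on with
  | empty => simp
  | insert a s ha ih => simp [Finset.sum_insert ha, Finset.prod_insert ha, Multiset.filter_add, ih]

open Classical in
/-- The factor of `P x` whose roots are the roots `y` of `P x` with `(x, y) ∈ A`. -/
def rootFactor (P : ℂ → Polynomial ℂ) (A : Set (ℂ × ℂ)) (x : ℂ) : Polynomial ℂ :=
  (((P x).roots.filter fun y => (x, y) ∈ A).map fun y => Polynomial.X - Polynomial.C y).prod

open Classical in
theorem roots_rootFactor (P : ℂ → Polynomial ℂ) (A : Set (ℂ × ℂ)) (x : ℂ) :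
    (rootFactor P A x).roots = (P x).roots.filter fun y => (x, y) ∈ A :=
  Polynomial.roots_multiset_prod_X_sub_C _

theorem monic_rootFactor (P : ℂ → Polynomial ℂ) (A : Set (ℂ × ℂ)) (x : ℂ) :
    (rootFactor P A x).Monic := Polynomial.monic_multisetProd_X_sub_C _

theorem rootFactor_mul_compl {P : ℂ → Polynomial ℂ} {x : ℂ} (hP : (P x).Monic)
    (A : Set (ℂ × ℂ)) : rootFactor P A x * rootFactor P Aᶜ x = P x := by
  classical
  rw [rootFactor, rootFactor, ← Multiset.prod_add, ← Multiset.map_add]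
  simp only [Set.mem_compl_iff]
  rw [Multiset.filter_add_not]
  exact ((IsAlgClosed.splits (P x)).eq_prod_roots_of_monic hP).symm

/-- If `A` is locally constant on the roots, the corresponding factor has analytic coefficients. -/
theorem analyticCoeffAt_rootFactor {P : ℂ → Polynomial ℂ} {x₀ : ℂ} {A : Set (ℂ × ℂ)} {d : ℕ}
    (hP : ∀ y, AnalyticAt ℂ (fun z : ℂ × ℂ => (P z.1).eval z.2) (x₀, y)) (hm : ∀ x, (P x).Monic)
    (hd : ∀ x, (P x).natDegree = d)
    (hA : ∀ y, (P x₀).IsRoot y → ∀ᶠ w in 𝓝 ((x₀, y) : ℂ × ℂ), (P w.1).IsRoot w.2 →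
      (w ∈ A ↔ (x₀, y) ∈ A)) : AnalyticCoeffAt (rootFactor P A) x₀ := by
  classical
  set S := (P x₀).roots.toFinset with hS
  obtain ⟨ρ, hρ, hdisj⟩ := exists_finset_pairwiseDisjoint_nhds S
  have h1 : ∀ y ∈ S, ∃ ε, 0 < ε ∧ ε ≤ ρ ∧ ∀ x ∈ Metric.ball x₀ ε, ∀ t ∈ Metric.ball y ε,
      (P x).IsRoot t → ((x, t) ∈ A ↔ (x₀, y) ∈ A) := by
    intro y hy
    obtain ⟨ε, hε, hb⟩ := Metric.mem_nhds_iff.mp (hA y (by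
      rw [hS, Multiset.mem_toFinset] at hy; exact Polynomial.isRoot_of_mem_roots hy))
    refine ⟨min ε ρ, lt_min hε hρ, min_le_right _ _, fun x hx t ht hr => ?_⟩
    refine hb (a := (x, t)) ?_ hr
    rw [Metric.mem_ball, Prod.dist_eq]
    exact max_lt ((Metric.mem_ball.mp hx).trans_le (min_le_left _ _))
      ((Metric.mem_ball.mp ht).trans_le (min_le_left _ _))
  choose! ε hε hερ hεA using h1
  have h2 := fun y (hy : y ∈ S) => exists_local_factor (hP y)
    (Filter.Eventually.of_forall fun x => (hm x).ne_zero) (Metric.ball_mem_nhds y (hε y hy))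
  choose! W T hTU hW hWm hWd hWe using h2
  have hTd : ∀ a ∈ S, ∀ b ∈ S, a ≠ b → Disjoint (T a) (T b) := fun a ha b hb hab =>
    (hdisj a ha b hb hab).mono ((hTU a ha).trans (Metric.ball_subset_ball (hερ a ha)))
      ((hTU b hb).trans (Metric.ball_subset_ball (hερ b hb)))
  -- Near `x₀` the factor cut out by A is the product of the local factors at those roots of `P x₀`
  -- that lie in A.
  have h3 : AnalyticCoeffAt (fun x => ∏ y ∈ S with (x₀, y) ∈ A, W y x) x₀ :=
    AnalyticCoeffAt.prod _ fun y hy => hW y (Finset.mem_filter.mp hy).1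
  refine h3.congr ?_
  have h4 : ∀ᶠ x in 𝓝 x₀, ∀ y ∈ S, x ∈ Metric.ball x₀ (ε y) ∧
      (∀ t, (W y x).IsRoot t → t ∈ T y) ∧
        ∀ t ∈ T y, (P x).rootMultiplicity t = (W y x).rootMultiplicity t :=
    (Filter.eventually_all_finset S).mpr fun y hy =>
      Filter.Eventually.and (Metric.ball_mem_nhds x₀ (hε y hy)) (hWe y hy)
  filter_upwards [h4] with x hx
  -- The sets `T y` are disjoint and multiplicities agree on each of them, so the local roots are
  -- among those of `P x`. Both sides have `d` roots with multiplicity, hence nothing is missing.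
  have hroots : ∑ y ∈ S, (W y x).roots = (P x).roots := by
    refine Multiset.eq_of_le_of_card_le (Multiset.le_iff_count.mpr fun t => ?_) ?_
    · rw [Multiset.count_sum', Polynomial.count_roots]
      by_cases ht : ∃ y ∈ S, t ∈ T y
      · obtain ⟨y, hy, hty⟩ := ht
        rw [Finset.sum_eq_single_of_mem y hy, Polynomial.count_roots, (hx y hy).2.2 t hty]
        intro b hb hby
        rw [Multiset.count_eq_zero]
        intro hmem
        exact Set.disjoint_left.mp (hTd b hb y hy hby)
          ((hx b hb).2.1 t (Polynomial.isRoot_of_mem_roots hmem)) hty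
      · rw [Finset.sum_eq_zero]
        · exact Nat.zero_le _
        · intro y hy
          rw [Multiset.count_eq_zero]
          exact fun hmem => ht ⟨y, hy, (hx y hy).2.1 t (Polynomial.isRoot_of_mem_roots hmem)⟩
    · rw [Multiset.card_sum, IsAlgClosed.card_roots_eq_natDegree, hd, ← hd x₀,
        ← IsAlgClosed.card_roots_eq_natDegree (p := P x₀), ← Multiset.toFinset_sum_count_eq]
      refine (Finset.sum_congr rfl fun y hy => ?_).le
      rw [Polynomial.count_roots, ← hWd y hy x]
      exact (IsAlgClosed.card_roots_eq_natDegree (p := W y x)).symm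
  rw [rootFactor, ← hroots, Finset.prod_filter, prod_map_filter_sum]
  refine Finset.prod_congr rfl fun y hy => ?_
  have h5 : ∀ t ∈ (W y x).roots, ((x, t) ∈ A ↔ (x₀, y) ∈ A) := by
    intro t ht
    refine hεA y hy x (hx y hy).1 t (hTU y hy
      ((hx y hy).2.1 t (Polynomial.isRoot_of_mem_roots ht))) ?_
    refine Polynomial.isRoot_of_mem_roots (p := P x) ?_
    rw [← hroots, Multiset.mem_sum]
    exact ⟨y, hy, ht⟩
  split_ifs with hyA
  · rw [Multiset.filter_eq_self.mpr fun t ht => (h5 t ht).mpr hyA]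
    exact (IsAlgClosed.splits (W y x)).eq_prod_roots_of_monic (hWm y hy x)
  · rw [Multiset.filter_eq_nil.mpr fun t ht h => hyA ((h5 t ht).mp h)]
    simp

/-! ### Riemann extension and the branches of irreducible real germs -/

theorem exists_analyticAt_of_punctured {f : ℂ → ℂ} (hf : ∀ᶠ x in 𝓝[≠] (0 : ℂ), AnalyticAt ℂ f x)
    {C : ℝ} (hb : ∀ᶠ x in 𝓝[≠] (0 : ℂ), ‖f x‖ ≤ C) :
    ∃ g : ℂ → ℂ, AnalyticAt ℂ g 0 ∧ ∀ᶠ x in 𝓝[≠] (0 : ℂ), f x = g x := by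
  obtain ⟨ε, hε, hball⟩ := Metric.mem_nhdsWithin_iff.mp (hf.and hb)
  have h1 := Complex.differentiableOn_update_limUnder_of_bddAbove (f := f)
    (Metric.ball_mem_nhds (0 : ℂ) hε)
    (fun x hx => (hball ⟨hx.1, hx.2⟩).1.differentiableAt.differentiableWithinAt)
    ⟨C, by rintro _ ⟨x, hx, rfl⟩; exact (hball ⟨hx.1, hx.2⟩).2⟩
  refine ⟨_, h1.analyticAt (Metric.ball_mem_nhds (0 : ℂ) hε), ?_⟩
  filter_upwards [self_mem_nhdsWithin] with x hx
  exact (Function.update_of_ne hx _ _).symm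

/-- A family of polynomials whose coefficients are analytic and bounded near `0`, outside `0`,
extends analytically. -/
theorem exists_analyticAt_eval {q : ℂ → Polynomial ℂ} {d : ℕ} (hq : ∀ᶠ x in 𝓝[≠] (0 : ℂ),
    AnalyticCoeffAt q x) (hd : ∀ x, (q x).natDegree ≤ d) (hm : ∀ x, (q x).Monic)
    (hr : ∀ᶠ x in 𝓝[≠] (0 : ℂ), ∀ y, (q x).IsRoot y → ‖y‖ ≤ 1) :
    ∃ Q : ℂ × ℂ → ℂ, AnalyticAt ℂ Q 0 ∧
      ∀ᶠ z in 𝓝 (0 : ℂ × ℂ), z.1 ≠ 0 → Q z = (q z.1).eval z.2 := by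
  have h1 : ∀ k, ∃ g : ℂ → ℂ, AnalyticAt ℂ g 0 ∧ ∀ᶠ x in 𝓝[≠] (0 : ℂ), (q x).coeff k = g x := by
    intro k
    -- The coefficients of a monic polynomial of degree at most d with roots in the unit disc are
    -- bounded by binomial coefficients, the largest of which is the central one.
    refine exists_analyticAt_of_punctured (hq.mono fun x hx => hx k)
      (C := max 1 1 ^ d * d.choose (d / 2)) ?_
    filter_upwards [hr] with x hx
    have := Polynomial.coeff_bdd_of_roots_le (B := 1) (d := d) (RingHom.id ℂ) (hm x)
      (IsAlgClosed.splits _) (hd x) (fun y hy => hx y ?_) k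
    · simpa using this
    · simpa using Polynomial.isRoot_of_mem_roots hy
  choose g hg hge using h1
  refine ⟨fun z => ∑ k ∈ Finset.range (d + 1), g k z.1 * z.2 ^ k, ?_, ?_⟩
  · refine Finset.analyticAt_fun_sum _ fun k _ => AnalyticAt.mul ?_ (analyticAt_snd.pow k)
    exact AnalyticAt.comp_of_eq (hg k) analyticAt_fst rfl
  · have h2 := (Filter.eventually_all_finset (Finset.range (d + 1))).mpr fun k _ => hge k
    have t : Filter.Tendsto (Prod.fst : ℂ × ℂ → ℂ) (𝓝 0) (𝓝 0) := continuous_fst.tendsto' _ _ rfl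
    filter_upwards [t.eventually (eventually_nhdsWithin_iff.mp h2)] with z hz hz1
    rw [Polynomial.eval_eq_sum_range' (Nat.lt_succ_of_le (hd z.1))]
    exact Finset.sum_congr rfl fun k hk => by rw [hz hz1 k hk]

/-- The roots in A and those outside split the Weierstrass polynomial into two monic factors. Off x
= 0 they are analytic because A is locally constant on the roots; bounded roots let them extend. By
`hirr` one of them is a unit near the origin. If it is the factor of A, then A has no zeros of p. If
it is the other one, A contains all zeros of p near the origin, so it contains a zero together with
its conjugate, contrary to the assumption on A. -/
theorem hasRealBranches_of_weierstrass {p V : ℂ × ℂ → ℂ} {d : ℕ} {c : ℕ → ℂ → ℂ}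
    (hd0 : d ≠ 0) (hc : ∀ k, AnalyticAt ℂ (c k) 0) (hc0 : ∀ k < d, c k 0 = 0)
    (hV : AnalyticAt ℂ V 0) (hV0 : V 0 ≠ 0)
    (hp : ∀ᶠ z in 𝓝 (0 : ℂ × ℂ), p z = weierstrassPoly d c z * V z)
    (hreal : IsRealGerm p)
    (hirr : ∀ Q R : ℂ × ℂ → ℂ, AnalyticAt ℂ Q 0 → AnalyticAt ℂ R 0 →
      (∀ᶠ z in 𝓝 (0 : ℂ × ℂ), p z = Q z * R z) → Q 0 ≠ 0 ∨ R 0 ≠ 0) : HasRealBranches p := by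
  intro A hA1 hA2
  set P := weierstrassPolynomial d c with hP
  have hPm : ∀ x, (P x).Monic := monic_weierstrassPolynomial d c
  have hPd : ∀ x, (P x).natDegree = d := natDegree_weierstrassPolynomial d c
  have hPe : ∀ z : ℂ × ℂ, (P z.1).eval z.2 = weierstrassPoly d c z := fun z =>
    eval_weierstrassPolynomial d c z.1 z.2
  have hsmall : ∀ {ε : ℝ}, 0 < ε → ∀ᶠ x in 𝓝 (0 : ℂ), ∀ y, (P x).IsRoot y → ‖y‖ < ε := by
    intro ε hε
    filter_upwards [eventually_norm_lt_of_weierstrassPoly_eq_zero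
      (fun k _ => (hc k).continuousAt) hc0 hε] with x hx y hy
    exact hx y (by rw [← hPe]; exact hy)
  have hPan : ∀ᶠ x in 𝓝 (0 : ℂ), ∀ y,
      AnalyticAt ℂ (fun z : ℂ × ℂ => (P z.1).eval z.2) (x, y) := by
    have h1 : ∀ᶠ x in 𝓝 (0 : ℂ), ∀ k ∈ Finset.range d, AnalyticAt ℂ (c k) x :=
      (Filter.eventually_all_finset _).mpr fun k _ => (hc k).eventually_analyticAt
    filter_upwards [h1] with x hx y
    simp only [hPe]
    refine (analyticAt_snd.pow d).add (Finset.analyticAt_fun_sum _ fun k hk => ?_)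
    refine AnalyticAt.mul ?_ (analyticAt_snd.pow k)
    exact AnalyticAt.comp_of_eq (hx k hk) analyticAt_fst rfl
  -- zeros of `p` and roots of `P x` near the origin
  have hroot : ∀ᶠ z in 𝓝 (0 : ℂ × ℂ), p z = 0 ↔ (P z.1).IsRoot z.2 := by
    filter_upwards [hp, hV.continuousAt.eventually_ne hV0] with z hz hz0
    rw [hz, Polynomial.IsRoot, hPe, mul_eq_zero, or_iff_left hz0]
  have hnear : ∀ {B : ℂ × ℂ → Prop}, (∀ᶠ z in 𝓝[≠] (0 : ℂ × ℂ), B z) →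
      ∀ᶠ x in 𝓝[≠] (0 : ℂ), ∀ y, (P x).IsRoot y → B (x, y) := by
    intro B hB
    obtain ⟨ε, hε, hball⟩ := Metric.mem_nhdsWithin_iff.mp hB
    filter_upwards [nhdsWithin_le_nhds (hsmall hε), nhdsWithin_le_nhds (Metric.ball_mem_nhds 0 hε),
      self_mem_nhdsWithin] with x hx hxε hx0 y hy
    refine hball ⟨?_, fun h => hx0 (congrArg Prod.fst h)⟩
    rw [mem_ball_zero_iff, Prod.norm_def]
    exact max_lt (mem_ball_zero_iff.mp hxε) (hx y hy)
  have hlc : ∀ᶠ x in 𝓝[≠] (0 : ℂ), ∀ y, (P x).IsRoot y → ∀ᶠ w in 𝓝 ((x, y) : ℂ × ℂ),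
      (P w.1).IsRoot w.2 → (w ∈ A ↔ (x, y) ∈ A) := by
    have := hnear (hA1.and (nhdsWithin_le_nhds (hroot.and hroot.eventually_nhds)))
    filter_upwards [this] with x hx y hy
    obtain ⟨h1, h2, h3⟩ := hx y hy
    filter_upwards [h1 (h2.mpr hy), h3] with w hw hw' hwr
    exact hw (hw'.mpr hwr)
  have hfac : ∀ B : Set (ℂ × ℂ), (∀ᶠ x in 𝓝[≠] (0 : ℂ), ∀ y, (P x).IsRoot y →
      ∀ᶠ w in 𝓝 ((x, y) : ℂ × ℂ), (P w.1).IsRoot w.2 → (w ∈ B ↔ (x, y) ∈ B)) →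
      ∃ Q : ℂ × ℂ → ℂ, AnalyticAt ℂ Q 0 ∧
        ∀ᶠ z in 𝓝 (0 : ℂ × ℂ), z.1 ≠ 0 → Q z = (rootFactor P B z.1).eval z.2 := by
    intro B hB
    have hsub : ∀ x y, (rootFactor P B x).IsRoot y → (P x).IsRoot y := by
      intro x y hy
      rw [← rootFactor_mul_compl (hPm x) B, Polynomial.IsRoot,
        Polynomial.eval_mul, hy, zero_mul]
    refine exists_analyticAt_eval (d := d) ?_ (fun x => ?_) (monic_rootFactor P B) ?_
    · filter_upwards [hB, nhdsWithin_le_nhds hPan] with x hx hxP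
      exact analyticCoeffAt_rootFactor hxP hPm
        hPd hx
    · have h1 := rootFactor_mul_compl (hPm x) B
      have h2 := (monic_rootFactor P B x).natDegree_mul (monic_rootFactor P Bᶜ x)
      have h3 := hPd x
      rw [← h3, ← h1]
      change _ ≤ (rootFactor P B x * rootFactor P Bᶜ x).natDegree
      omega
    · filter_upwards [nhdsWithin_le_nhds (hsmall one_pos)] with x hx y hy
      exact (hx y (hsub x y hy)).le
  obtain ⟨Q, hQ, hQe⟩ := hfac A hlc
  obtain ⟨R, hR, hRe⟩ := hfac Aᶜ (by
    filter_upwards [hlc] with x hx y hy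
    filter_upwards [hx y hy] with w hw hwr
    exact not_congr (hw hwr))
  have hmem : ∀ B : Set (ℂ × ℂ), ∀ x y, (P x).IsRoot y → (x, y) ∈ B →
      (rootFactor P B x).eval y = 0 := by
    intro B x y hy hB
    classical
    have : y ∈ (rootFactor P B x).roots := by
      rw [roots_rootFactor, Multiset.mem_filter]
      exact ⟨(Polynomial.mem_roots (hPm x).ne_zero).mpr hy, hB⟩
    exact Polynomial.isRoot_of_mem_roots this
  have hprod : ∀ᶠ z in 𝓝 (0 : ℂ × ℂ), p z = Q z * (R z * V z) := by
    have h1 : ∀ᶠ z in 𝓝 (0 : ℂ × ℂ), weierstrassPoly d c z = Q z * R z := by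
      refine eventually_eq_zero_fst_of_punctured ?_ (hQ.mul hR).eventually_continuousAt ?_
      · have : AnalyticAt ℂ (fun z : ℂ × ℂ => (P z.1).eval z.2) 0 := hPan.self_of_nhds 0
        simp only [hPe] at this
        exact this.eventually_continuousAt
      · filter_upwards [hQe, hRe] with z h1 h2 hz
        rw [h1 hz, h2 hz, ← hPe, ← Polynomial.eval_mul,
          rootFactor_mul_compl (hPm z.1)]
    filter_upwards [hp, h1] with z h1 h2
    rw [h1, h2]
    ring
  -- if a factor is a unit, the corresponding roots disappear
  have hunit : ∀ (B : Set (ℂ × ℂ)) (S : ℂ × ℂ → ℂ), ContinuousAt S 0 → S 0 ≠ 0 →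
      (∀ᶠ z in 𝓝 (0 : ℂ × ℂ), z.1 ≠ 0 → S z = (rootFactor P B z.1).eval z.2) →
      ∀ᶠ z in 𝓝[≠] (0 : ℂ × ℂ), p z = 0 → z ∉ B := by
    intro B S hS hS0 hSe
    filter_upwards [nhdsWithin_le_nhds (hS.eventually_ne hS0), nhdsWithin_le_nhds hSe,
      nhdsWithin_le_nhds hroot, self_mem_nhdsWithin] with z h1 h2 h3 hz hpz hzB
    have h4 := h3.mp hpz
    by_cases hz1 : z.1 = 0
    · refine hz (Prod.ext hz1 ?_)
      rw [Polynomial.IsRoot, hPe, weierstrassPoly, hz1] at h4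
      rw [Finset.sum_eq_zero (fun k hk => by rw [hc0 k (Finset.mem_range.mp hk), zero_mul]),
        add_zero] at h4
      exact pow_eq_zero_iff hd0 |>.mp h4
    · exact h1 (by rw [h2 hz1]; exact hmem B z.1 z.2 h4 hzB)
  rcases hirr Q (fun z => R z * V z) hQ (hR.mul hV) hprod with h0 | h0
  · exact hunit A Q hQ.continuousAt h0 hQe
  · exfalso
    have hall := hunit Aᶜ R hR.continuousAt (left_ne_zero_of_mul h0) hRe
    have h1 := hnear (hall.and (hA2.and (nhdsWithin_le_nhds (hroot.and
      (hreal.and (tendsto_star_zero.eventually (eventually_nhdsWithin_iff.mp hall)))))))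
    have t2 : Filter.Tendsto (fun t : ℝ => (t : ℂ)) (𝓝[≠] 0) (𝓝[≠] 0) :=
      tendsto_nhdsWithin_iff.mpr ⟨(Complex.continuous_ofReal.tendsto' 0 0 rfl).mono_left
        nhdsWithin_le_nhds, by
        filter_upwards [self_mem_nhdsWithin] with x hx hx0
        exact hx (by simpa using hx0)⟩
    obtain ⟨t, ht, ht0⟩ := ((t2.eventually h1).and self_mem_nhdsWithin).exists
    obtain ⟨y, hy⟩ := IsAlgClosed.exists_root (P t) (by
      rw [Polynomial.degree_eq_natDegree (hPm t).ne_zero]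
      simpa [hP] using hd0)
    obtain ⟨k1, k2, k3, k4, k5⟩ := ht y hy
    have hp0 : p ((t : ℂ), y) = 0 := k3.mpr hy
    have hA : (((t : ℂ), y) : ℂ × ℂ) ∈ A := not_not.mp (k1 hp0)
    refine k5 (fun h => ht0 ?_) (by rw [k4, hp0, star_zero]) (k2 hp0 hA)
    have := congrArg Prod.fst h
    simpa using this

namespace ConvergentSeries

/-- Weierstrass preparation requires regularity in y. An irreducible series that is not regular is x
times a unit, whose zero set is the y-axis. -/
theorem hasRealBranches_of_irreducible {p : ConvergentSeries ℂ} (hp : Irreducible p)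
    (hreal : IsRealGerm (seriesEval p.1)) : HasRealBranches (seriesEval p.1) := by
  have hpa := analyticAt_seriesEval p
  by_cases h0 : ∀ᶠ y in 𝓝 (0 : ℂ), seriesEval p.1 (0, y) = 0
  · obtain ⟨g, rfl⟩ := X_dvd ((eventually_zero_left_iff p).mp h0)
    have hX : ¬ IsUnit (X ℂ) := fun h => constantCoeff_ne_zero_of_isUnit h (by simp [seriesEval_X])
    have hg := constantCoeff_ne_zero_of_isUnit ((hp.isUnit_or_isUnit rfl).resolve_left hX)
    refine HasRealBranches.fst.congr ?_
    filter_upwards [eventually_seriesEval_mul (X ℂ) g,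
      (analyticAt_seriesEval g).continuousAt.eventually_ne hg] with z h1 h2
    rw [h1, seriesEval_X, mul_eq_zero, or_iff_left h2]
  · obtain ⟨d, hd⟩ := hpa.exists_hasRegOrder h0
    have key : ∀ Q R : ℂ × ℂ → ℂ, AnalyticAt ℂ Q 0 → AnalyticAt ℂ R 0 →
        (∀ᶠ z in 𝓝 (0 : ℂ × ℂ), seriesEval p.1 z = Q z * R z) → Q 0 ≠ 0 ∨ R 0 ≠ 0 := by
      intro Q R hQ hR h
      obtain ⟨a, ha⟩ := exists_of_analyticAt hQ
      obtain ⟨b, hb⟩ := exists_of_analyticAt hR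
      have hab : p = a * b := by
        refine ext_of_eventuallyEq ?_
        filter_upwards [h, ha, hb, eventually_seriesEval_mul a b] with z h1 h2 h3 h4
        rw [h1, h4, h2, h3]
      rw [ha.self_of_nhds, hb.self_of_nhds]
      exact (hp.isUnit_or_isUnit hab).imp constantCoeff_ne_zero_of_isUnit
        constantCoeff_ne_zero_of_isUnit
    have hd0 : d ≠ 0 := by
      rintro rfl
      have h1 := hd.ne_zero_of_zero
      refine hp.not_isUnit ?_
      obtain ⟨G, hG⟩ := exists_of_analyticAt (hpa.inv h1)
      refine IsUnit.of_mul_eq_one G (ext_of_eventuallyEq ?_)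
      filter_upwards [hG, eventually_seriesEval_mul p G, hpa.continuousAt.eventually_ne h1]
        with z h2 h3 h4
      rw [h3, ← h2, seriesEval_one, Pi.inv_apply, mul_inv_cancel₀ h4]
    obtain ⟨c, hc, hc0, ⟨V, hV, hV0, hVe⟩, -⟩ := hpa.weierstrass_preparation hd
    exact hasRealBranches_of_weierstrass hd0 hc hc0 hV hV0 hVe hreal key

/-- The only use of the hypothesis on irreducible factors: each factor in a real factorization stays
irreducible over ℂ, and the property is multiplicative. -/
theorem hasRealBranches_complexify {g : ConvergentSeries ℝ} (hg : g ≠ 0)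
    (hirr : ∀ p : ConvergentSeries ℝ, Irreducible p → p ∣ g → Irreducible (complexify p)) :
    HasRealBranches (seriesEval (complexify g).1) := by
  induction g using WfDvdMonoid.induction_on_irreducible with
  | zero => exact absurd rfl hg
  | unit u hu =>
    exact HasRealBranches.of_ne_zero (analyticAt_seriesEval _).continuousAt
      (constantCoeff_ne_zero_of_isUnit (hu.map complexify))
  | mul a i ha hi ih =>
    have h1 := hasRealBranches_of_irreducible (hirr i hi (dvd_mul_right _ _))
      (Filter.Eventually.of_forall (seriesEval_complexify_star i))
    have h2 := ih ha fun p hp hpa => hirr p hp (hpa.mul_left _)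
    refine (h1.mul h2).congr ?_
    rw [map_mul]
    filter_upwards [eventually_seriesEval_mul (complexify i) (complexify a)] with z hz
    rw [hz]

end ConvergentSeries

/-! ### Local biholomorphisms of `ℂ²` -/

theorem mem_contDiffGroupoid_iff {e : OpenPartialHomeomorph (ℂ × ℂ) (ℂ × ℂ)} :
    e ∈ contDiffGroupoid ω 𝓘(ℂ, ℂ × ℂ) ↔
      ContDiffOn ℂ ω e e.source ∧ ContDiffOn ℂ ω e.symm e.target := by
  rw [contDiffGroupoid, mem_groupoid_of_pregroupoid, contDiffPregroupoid]
  simp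

theorem analyticAt_of_mem_contDiffGroupoid {e : OpenPartialHomeomorph (ℂ × ℂ) (ℂ × ℂ)}
    (he : e ∈ contDiffGroupoid ω 𝓘(ℂ, ℂ × ℂ)) {z : ℂ × ℂ} (hz : z ∈ e.source) :
    AnalyticAt ℂ e z :=
  ((mem_contDiffGroupoid_iff.mp he).1.contDiffAt (e.open_source.mem_nhds hz)).analyticAt

theorem mem_contDiffGroupoid_of_analyticAt {e : OpenPartialHomeomorph (ℂ × ℂ) (ℂ × ℂ)}
    (h1 : ∀ z ∈ e.source, AnalyticAt ℂ e z) (h2 : ∀ z ∈ e.target, AnalyticAt ℂ e.symm z) :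
    e ∈ contDiffGroupoid ω 𝓘(ℂ, ℂ × ℂ) :=
  mem_contDiffGroupoid_iff.mpr ⟨fun z hz => (h1 z hz).contDiffAt.contDiffWithinAt,
    fun z hz => (h2 z hz).contDiffAt.contDiffWithinAt⟩

/-- The shear `(x, y) ↦ (x, y + a x)`. -/
def shear (a : ℂ → ℂ) (z : ℂ × ℂ) : ℂ × ℂ := (z.1, z.2 + a z.1)

theorem AnalyticAt.shear {a : ℂ → ℂ} {z : ℂ × ℂ} (ha : AnalyticAt ℂ a z.1) :
    AnalyticAt ℂ (shear a) z :=
  analyticAt_fst.prod (analyticAt_snd.add (ha.comp_of_eq analyticAt_fst rfl))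

theorem shear_apply_zero {a : ℂ → ℂ} (ha : a 0 = 0) : shear a 0 = 0 := by
  simp [shear, ha]

/-- The shear as a local biholomorphism. -/
def shearHomeo (a : ℂ → ℂ) (s : Set ℂ) (hs : IsOpen s) (ha : ∀ x ∈ s, AnalyticAt ℂ a x) :
    OpenPartialHomeomorph (ℂ × ℂ) (ℂ × ℂ) where
  toFun := shear a
  invFun := shear fun x => -a x
  source := Prod.fst ⁻¹' s
  target := Prod.fst ⁻¹' s
  map_source' _ hz := hz
  map_target' _ hz := hz
  left_inv' z _ := by simp [shear]
  right_inv' z _ := by simp [shear]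
  open_source := hs.preimage continuous_fst
  open_target := hs.preimage continuous_fst
  continuousOn_toFun z hz := (ha z.1 hz).shear.continuousAt.continuousWithinAt
  continuousOn_invFun z hz := (ha z.1 hz).neg.shear.continuousAt.continuousWithinAt

theorem shearHomeo_mem (a : ℂ → ℂ) (s : Set ℂ) (hs : IsOpen s) (ha : ∀ x ∈ s, AnalyticAt ℂ a x) :
    shearHomeo a s hs ha ∈ contDiffGroupoid ω 𝓘(ℂ, ℂ × ℂ) :=
  mem_contDiffGroupoid_of_analyticAt (fun z hz => (ha z.1 hz).shear)
    fun z hz => (ha z.1 hz).neg.shear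

/-- The inverse of `blowMap c` away from the exceptional curve. -/
def blowInv : Option ℂ → ℂ × ℂ → ℂ × ℂ
  | some c, z => (z.1, z.2 / z.1 - c)
  | none, z => (z.2, z.1 / z.2)

/-- The complement of the line through the origin that the chart of `blowMap c` misses. -/
def blowDomain : Option ℂ → Set (ℂ × ℂ)
  | some _ => {z | z.1 ≠ 0}
  | none => {z | z.2 ≠ 0}

theorem isOpen_blowDomain (c : Option ℂ) : IsOpen (blowDomain c) := by
  cases c with
  | none => exact isOpen_ne_fun continuous_snd continuous_const
  | some c => exact isOpen_ne_fun continuous_fst continuous_const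

theorem blowMap_blowInv {c : Option ℂ} {z : ℂ × ℂ} (hz : z ∈ blowDomain c) :
    blowMap c (blowInv c z) = z := by
  cases c with
  | none =>
    have hz : z.2 ≠ 0 := hz
    ext
    · simp only [blowInv, blowMap_none]; field_simp
    · rfl
  | some c =>
    have hz : z.1 ≠ 0 := hz
    ext
    · rfl
    · simp only [blowInv, blowMap_some]; field_simp; ring

theorem blowInv_blowMap {c : Option ℂ} {w : ℂ × ℂ} (hw : w.1 ≠ 0) :
    blowInv c (blowMap c w) = w := by
  cases c with
  | none =>
    ext
    · rfl
    · simp only [blowInv, blowMap_none]; field_simp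
  | some c =>
    ext
    · rfl
    · simp only [blowInv, blowMap_some]; field_simp; ring

theorem analyticAt_blowInv {c : Option ℂ} {z : ℂ × ℂ} (hz : z ∈ blowDomain c) :
    AnalyticAt ℂ (blowInv c) z := by
  cases c with
  | none => exact analyticAt_snd.prod (analyticAt_fst.div analyticAt_snd hz)
  | some c =>
    exact analyticAt_fst.prod ((analyticAt_snd.div analyticAt_fst hz).sub analyticAt_const)

/-- The blow-up map as a local biholomorphism away from the exceptional curve. -/
def blowHomeo (c : Option ℂ) : OpenPartialHomeomorph (ℂ × ℂ) (ℂ × ℂ) where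
  toFun := blowMap c
  invFun := blowInv c
  source := {w | w.1 ≠ 0}
  target := blowDomain c
  map_source' w hw := by cases c <;> exact hw
  map_target' z hz := by cases c <;> exact hz
  left_inv' w hw := blowInv_blowMap hw
  right_inv' z hz := blowMap_blowInv hz
  open_source := isOpen_ne_fun continuous_fst continuous_const
  open_target := isOpen_blowDomain c
  continuousOn_toFun := (continuous_blowMap c).continuousOn
  continuousOn_invFun z hz := (analyticAt_blowInv hz).continuousAt.continuousWithinAt

theorem blowHomeo_mem (c : Option ℂ) : blowHomeo c ∈ contDiffGroupoid ω 𝓘(ℂ, ℂ × ℂ) :=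
  mem_contDiffGroupoid_of_analyticAt (fun w _ => analyticAt_blowMap c w)
    fun _ hz => analyticAt_blowInv hz

/-! ### Locally monomial ideals in `ℂ²` -/

/-- In suitable local coordinates centered at `z`, the functions `F i` are multiples of a single
monomial, one of them by a unit. -/
def MonoAt {ι : Type} (F : ι → ℂ × ℂ → ℂ) (z : ℂ × ℂ) : Prop :=
  ∃ e ∈ contDiffGroupoid ω 𝓘(ℂ, ℂ × ℂ), z ∈ e.source ∧ e z = 0 ∧
    ∃ (a b : ℕ) (c : ι → ℂ × ℂ → ℂ), (∀ i, AnalyticAt ℂ (c i) z) ∧ (∃ i, c i z ≠ 0) ∧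
      ∀ i, ∀ᶠ w in 𝓝 z, F i w = c i w * ((e w).1 ^ a * (e w).2 ^ b)

/-- Monomiality is invariant under local biholomorphisms. -/
theorem MonoAt.of_comp {ι : Type} {F : ι → ℂ × ℂ → ℂ} {f : OpenPartialHomeomorph (ℂ × ℂ) (ℂ × ℂ)}
    (hf : f ∈ contDiffGroupoid ω 𝓘(ℂ, ℂ × ℂ)) {z : ℂ × ℂ} (hz : z ∈ f.source)
    (h : MonoAt (fun i w => F i (f w)) z) : MonoAt F (f z) := by
  obtain ⟨e, he, hze, he0, a, b, c, hc, ⟨i, hi⟩, hF⟩ := h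
  have hfz := f.map_source hz
  have hsymm := (contDiffGroupoid ω 𝓘(ℂ, ℂ × ℂ)).symm hf
  have hcont : Filter.Tendsto f.symm (𝓝 (f z)) (𝓝 z) := by
    have := f.symm.continuousAt (x := f z) hfz
    rwa [ContinuousAt, f.left_inv hz] at this
  refine ⟨f.symm.trans e, (contDiffGroupoid ω 𝓘(ℂ, ℂ × ℂ)).trans hsymm he, ?_, ?_, a, b,
    fun i w => c i (f.symm w), fun i => ?_, ⟨i, ?_⟩, fun i => ?_⟩
  · simp [hfz, f.left_inv hz, hze]
  · simp [f.left_inv hz, he0]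
  · exact (hc i).comp_of_eq (analyticAt_of_mem_contDiffGroupoid hsymm hfz) (f.left_inv hz)
  · simpa [f.left_inv hz] using hi
  · filter_upwards [hcont.eventually (hF i), f.open_target.mem_nhds hfz] with w hw hwt
    rw [f.right_inv hwt] at hw
    simpa using hw

theorem MonoAt.comp {ι : Type} {F : ι → ℂ × ℂ → ℂ} {f : OpenPartialHomeomorph (ℂ × ℂ) (ℂ × ℂ)}
    (hf : f ∈ contDiffGroupoid ω 𝓘(ℂ, ℂ × ℂ)) {z : ℂ × ℂ} (hz : z ∈ f.source)
    (h : MonoAt F (f z)) : MonoAt (fun i w => F i (f w)) z := by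
  obtain ⟨e, he, hze, he0, a, b, c, hc, ⟨i, hi⟩, hF⟩ := h
  refine ⟨f.trans e, (contDiffGroupoid ω 𝓘(ℂ, ℂ × ℂ)).trans hf he, ⟨hz, hze⟩, he0, a, b,
    fun i w => c i (f w), fun i => ?_, ⟨i, hi⟩, fun i => ?_⟩
  · exact (hc i).comp (analyticAt_of_mem_contDiffGroupoid hf hz)
  · filter_upwards [(f.continuousAt hz).eventually (hF i)] with w hw
    exact hw

theorem MonoAt.congr {ι : Type} {F G : ι → ℂ × ℂ → ℂ} {z : ℂ × ℂ} (h : MonoAt F z)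
    (hFG : ∀ i, ∀ᶠ w in 𝓝 z, F i w = G i w) : MonoAt G z := by
  obtain ⟨e, he, hze, he0, a, b, c, hc, hi, hF⟩ := h
  refine ⟨e, he, hze, he0, a, b, c, hc, hi, fun i => ?_⟩
  filter_upwards [hF i, hFG i] with w h1 h2
  rw [← h2, h1]

/-- The translation that moves `p` to the origin. -/
def translationHomeo (p : ℂ × ℂ) : OpenPartialHomeomorph (ℂ × ℂ) (ℂ × ℂ) :=
  (Homeomorph.addRight (-p)).toOpenPartialHomeomorph

theorem translationHomeo_apply (p z : ℂ × ℂ) : translationHomeo p z = z - p :=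
  (sub_eq_add_neg z p).symm

theorem translationHomeo_mem (p : ℂ × ℂ) :
    translationHomeo p ∈ contDiffGroupoid ω 𝓘(ℂ, ℂ × ℂ) :=
  mem_contDiffGroupoid_of_analyticAt
    (fun z _ => (analyticAt_id.add analyticAt_const : AnalyticAt ℂ (fun w => w + -p) z))
    (fun z _ => (analyticAt_id.add analyticAt_const : AnalyticAt ℂ (fun w => w + - -p) z))

/-- Monomiality is an open condition. -/
theorem MonoAt.eventually {ι : Type} [Finite ι] {F : ι → ℂ × ℂ → ℂ} {z : ℂ × ℂ}
    (h : MonoAt F z) : ∀ᶠ w in 𝓝 z, MonoAt F w := by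
  obtain ⟨e, he, hze, he0, a, b, c, hc, ⟨i, hi⟩, hF⟩ := h
  have h1 : ∀ᶠ w in 𝓝 z, ∀ i, AnalyticAt ℂ (c i) w :=
    Filter.eventually_all.mpr fun i => (hc i).eventually_analyticAt
  have h2 : ∀ᶠ w in 𝓝 z, ∀ i, ∀ᶠ w' in 𝓝 w, F i w' = c i w' * ((e w').1 ^ a * (e w').2 ^ b) :=
    Filter.eventually_all.mpr fun i => (hF i).eventually_nhds
  filter_upwards [h1, h2, (hc i).continuousAt.eventually_ne hi, e.open_source.mem_nhds hze]
    with w hcw hFw hiw hwe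
  -- At a nearby point each coordinate has to be recentered. One that vanishes there keeps its
  -- exponent; the power of one that does not vanish is absorbed into the unit.
  have key : ∀ {g : ℂ × ℂ → ℂ} (n : ℕ), AnalyticAt ℂ g w → ∃ (m : ℕ) (u : ℂ × ℂ → ℂ),
      AnalyticAt ℂ u w ∧ u w ≠ 0 ∧ ∀ w', g w' ^ n = u w' * (g w' - g w) ^ m := by
    intro g n hg
    by_cases h0 : g w = 0
    · exact ⟨n, fun _ => 1, analyticAt_const, one_ne_zero, fun w' => by rw [h0, sub_zero, one_mul]⟩
    · exact ⟨0, fun w' => g w' ^ n, hg.pow n, pow_ne_zero _ h0, fun w' => by rw [pow_zero, mul_one]⟩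
  have hea := analyticAt_of_mem_contDiffGroupoid he hwe
  obtain ⟨a', u, hu, hu0, hua⟩ := key (g := fun w => (e w).1) a
    (analyticAt_fst.comp hea)
  obtain ⟨b', v, hv, hv0, hvb⟩ := key (g := fun w => (e w).2) b
    (analyticAt_snd.comp hea)
  refine ⟨e.trans (translationHomeo (e w)),
    (contDiffGroupoid ω 𝓘(ℂ, ℂ × ℂ)).trans he (translationHomeo_mem _), ?_, ?_, a', b',
    fun i w' => c i w' * (u w' * v w'), fun i => (hcw i).mul (hu.mul hv),
    ⟨i, mul_ne_zero hiw (mul_ne_zero hu0 hv0)⟩, fun i => ?_⟩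
  · exact ⟨hwe, Set.mem_univ _⟩
  · simp [translationHomeo_apply]
  · filter_upwards [hFw i] with w' hw'
    rw [hw', hua, hvb]
    simp only [OpenPartialHomeomorph.coe_trans, Function.comp, translationHomeo_apply,
      Prod.fst_sub, Prod.snd_sub]
    ring

/-! ### Ideals that are resolved by blowing up real points -/

/-- The ideal generated by the germs `F i` at the origin becomes monomial after `n` blow-ups of
real points: either it is monomial (and `n = 0`), or after one blow-up, in suitable real
coordinates, it is monomial at all but finitely many points of the exceptional curve, and the
remaining ones are real and the ideal can be resolved there. -/
inductive Resolvable {ι : Type} : (ι → ℂ × ℂ → ℂ) → ℕ → Prop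
  | monomial {F : ι → ℂ × ℂ → ℂ} (h : MonoAt F 0) : Resolvable F 0
  | blowup {F : ι → ℂ × ℂ → ℂ} (a : ℂ → ℂ) (ha : AnalyticAt ℂ a 0) (ha0 : a 0 = 0)
      (hreal : ∀ᶠ x in 𝓝 (0 : ℂ), a (star x) = star (a x)) (k : Option ℂ →₀ ℕ)
      (hk : ∀ c, k c ≠ 0 → c.map star = c)
      (h : ∀ c, Resolvable (fun i w => F i (shear a (blowMap c w))) (k c)) :
      Resolvable F (k.sum (fun _ n => n) + 1)

theorem exists_shearHomeo {a : ℂ → ℂ} (ha : AnalyticAt ℂ a 0) :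
    ∃ f ∈ contDiffGroupoid ω 𝓘(ℂ, ℂ × ℂ), (0 : ℂ × ℂ) ∈ f.source ∧ (f : ℂ × ℂ → ℂ × ℂ) = shear a ∧
      (f.symm : ℂ × ℂ → ℂ × ℂ) = shear (fun x => -a x) := by
  obtain ⟨ε, hε, hb⟩ := Metric.mem_nhds_iff.mp ha.eventually_analyticAt
  exact ⟨_, shearHomeo_mem a (Metric.ball 0 ε) Metric.isOpen_ball fun x hx => hb hx,
    Metric.mem_ball_self hε, rfl, rfl⟩

/-- Shears compose by addition, so the extra one merges into the shear before the first blow-up.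
With no blow-up, monomiality does not depend on coordinates. -/
theorem Resolvable.of_shear {ι : Type} {F : ι → ℂ × ℂ → ℂ} {n : ℕ} {a : ℂ → ℂ}
    (ha : AnalyticAt ℂ a 0) (ha0 : a 0 = 0)
    (hreal : ∀ᶠ x in 𝓝 (0 : ℂ), a (star x) = star (a x))
    (h : Resolvable (fun i z => F i (shear a z)) n) : Resolvable F n := by
  cases h with
  | monomial h =>
    obtain ⟨f, hf, hf0, hfa, -⟩ := exists_shearHomeo ha
    rw [← hfa] at h
    have := h.of_comp hf hf0
    rw [hfa, shear_apply_zero ha0] at this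
    exact .monomial this
  | blowup a' ha' ha'0 hreal' k hk h =>
    refine .blowup (fun x => a' x + a x) (ha'.add ha) (by simp [ha0, ha'0]) ?_ k hk fun c => ?_
    · filter_upwards [hreal, hreal'] with x h1 h2
      rw [h1, h2, star_add]
    · have := h c
      simpa only [shear, add_assoc] using this

/-- Away from the origin, a resolvable ideal is monomial. -/
theorem Resolvable.eventually_monoAt {ι : Type} [Finite ι] {F : ι → ℂ × ℂ → ℂ} {n : ℕ}
    (h : Resolvable F n) : ∀ᶠ z in 𝓝[≠] (0 : ℂ × ℂ), MonoAt F z := by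
  induction h with
  | monomial h => exact nhdsWithin_le_nhds h.eventually
  | @blowup F a ha ha0 hreal k hk h ih =>
    set F' : ι → ℂ × ℂ → ℂ := fun i z => F i (shear a z) with hF'
    -- A unit vector σ determines a point c of the exceptional curve. Scaling by t multiplies only
    -- the first coordinate in the chart at c, so `t • σ'` with small t ≠ 0 and σ' near σ falls into
    -- the punctured neighbourhood given by induction. Compactness of the sphere makes the bound on
    -- t uniform.
    have h1 : ∀ σ ∈ Metric.sphere (0 : ℂ × ℂ) 1, ∀ᶠ x : ℝ × (ℂ × ℂ) in 𝓝 (0, σ),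
        x.1 ≠ 0 → MonoAt F' (x.1 • x.2) := by
      intro σ hσ
      have hσ0 : σ ≠ 0 := fun h => by simp [h] at hσ
      obtain ⟨c, hc, hc0⟩ : ∃ c : Option ℂ, σ ∈ blowDomain c ∧ (blowInv c σ).2 = 0 := by
        by_cases h : σ.1 = 0
        · exact ⟨none, fun h2 => hσ0 (Prod.ext h h2), by simp [blowInv, h]⟩
        · exact ⟨some (σ.2 / σ.1), h, by simp [blowInv]⟩
      have hdom : ∀ (t : ℝ) (z : ℂ × ℂ), t ≠ 0 → z ∈ blowDomain c →
          blowInv c (t • z) = ((t : ℂ) * (blowInv c z).1, (blowInv c z).2) ∧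
          t • z ∈ blowDomain c := by
        intro t z ht hz
        have ht' : (t : ℂ) ≠ 0 := by exact_mod_cast ht
        cases c with
        | none =>
          have hz : z.2 ≠ 0 := hz
          refine ⟨?_, smul_ne_zero ht hz⟩
          ext
          · simp [blowInv]
          · simp only [blowInv, Prod.smul_fst, Prod.smul_snd, Complex.real_smul]
            field_simp
        | some c =>
          have hz : z.1 ≠ 0 := hz
          refine ⟨?_, smul_ne_zero ht hz⟩
          ext
          · simp [blowInv]
          · simp only [blowInv, Prod.smul_fst, Prod.smul_snd, Complex.real_smul]
            field_simp
      have hne : ∀ z ∈ blowDomain c, (blowInv c z).1 ≠ 0 := by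
        intro z hz
        cases c <;> exact hz
      have hcont : ContinuousAt (fun x : ℝ × (ℂ × ℂ) =>
          (((x.1 : ℂ) * (blowInv c x.2).1, (blowInv c x.2).2) : ℂ × ℂ)) (0, σ) := by
        have hi : ContinuousAt (fun x : ℝ × (ℂ × ℂ) => blowInv c x.2) (0, σ) :=
          ContinuousAt.comp (g := blowInv c) (analyticAt_blowInv hc).continuousAt continuousAt_snd
        exact ((Complex.continuous_ofReal.continuousAt.comp continuousAt_fst).mul hi.fst).prodMk
          hi.snd
      have hlim : Filter.Tendsto (fun x : ℝ × (ℂ × ℂ) =>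
          (((x.1 : ℂ) * (blowInv c x.2).1, (blowInv c x.2).2) : ℂ × ℂ)) (𝓝 (0, σ)) (𝓝 0) := by
        have := hcont.tendsto
        simpa [hc0, ← Prod.zero_eq_mk] using this
      have hd : ∀ᶠ x : ℝ × (ℂ × ℂ) in 𝓝 (0, σ), x.2 ∈ blowDomain c :=
        continuousAt_snd.eventually ((isOpen_blowDomain c).mem_nhds hc)
      filter_upwards [hlim.eventually (eventually_nhdsWithin_iff.mp (ih c)), hd] with x hx hxd hx0
      obtain ⟨e1, e2⟩ := hdom x.1 x.2 hx0 hxd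
      rw [← e1] at hx
      have hw0 : (blowInv c (x.1 • x.2)).1 ≠ 0 := hne _ e2
      have h2 := hx fun h => hw0 (by rw [Set.mem_singleton_iff.mp h]; rfl)
      have h3 := MonoAt.of_comp (F := F') (blowHomeo_mem c) (z := blowInv c (x.1 • x.2)) hw0 h2
      change MonoAt F' (blowMap c _) at h3
      rwa [blowMap_blowInv e2] at h3
    have h2 := (isCompact_sphere (0 : ℂ × ℂ) 1).eventually_forall_of_forall_eventually
      (P := fun (t : ℝ) (σ : ℂ × ℂ) => t ≠ 0 → MonoAt F' (t • σ)) h1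
    obtain ⟨ε, hε, hb⟩ := Metric.mem_nhds_iff.mp h2
    have h3 : ∀ᶠ z in 𝓝[≠] (0 : ℂ × ℂ), MonoAt F' z := by
      refine Metric.mem_nhdsWithin_iff.mpr ⟨ε, hε, fun z hz => ?_⟩
      have hz0 : ‖z‖ ≠ 0 := norm_ne_zero_iff.mpr hz.2
      have := hb (a := ‖z‖) (by simpa using hz.1) (‖z‖⁻¹ • z)
        (by simp [norm_smul, hz0]) hz0
      change MonoAt F' z
      rwa [smul_inv_smul₀ hz0] at this
    obtain ⟨f, hf, hf0, hfa, hfs⟩ := exists_shearHomeo ha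
    have hft : (0 : ℂ × ℂ) ∈ f.target := by
      have := f.map_source hf0
      rwa [hfa, shear_apply_zero ha0] at this
    have hs0 : f.symm 0 = 0 := by rw [hfs]; exact shear_apply_zero (by simp [ha0])
    have t : Filter.Tendsto f.symm (𝓝[≠] 0) (𝓝[≠] 0) := by
      refine tendsto_nhdsWithin_iff.mpr ⟨?_, ?_⟩
      · have := (f.symm.continuousAt (x := 0) hft).tendsto
        rw [hs0] at this
        exact this.mono_left nhdsWithin_le_nhds
      · filter_upwards [nhdsWithin_le_nhds (f.open_target.mem_nhds hft), self_mem_nhdsWithin]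
          with z hz hz0 hz1
        have := f.right_inv hz
        rw [Set.mem_singleton_iff.mp hz1, hfa, shear_apply_zero ha0] at this
        exact hz0 this.symm
    filter_upwards [t.eventually h3, nhdsWithin_le_nhds (f.open_target.mem_nhds hft)] with z hz hzt
    rw [hF', ← hfa] at hz
    have := hz.of_comp hf (f.map_target hzt)
    rwa [f.right_inv hzt] at this

/-! ### Resolution of germs of ideals: monomial generators -/

theorem contDiffGroupoid_refl_mem :
    OpenPartialHomeomorph.refl (ℂ × ℂ) ∈ contDiffGroupoid ω 𝓘(ℂ, ℂ × ℂ) :=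
  (contDiffGroupoid ω 𝓘(ℂ, ℂ × ℂ)).id_mem

theorem monoAt_of_isMonomialGerm {ι : Type} {F : ι → ℂ × ℂ → ℂ} {a b : ι → ℕ}
    (hF : ∀ i, IsMonomialGerm (F i) (a i) (b i)) (j : ι) (hj : ∀ i, a j ≤ a i ∧ b j ≤ b i) :
    MonoAt F 0 := by
  choose e he he0 hFe using hF
  refine ⟨_, contDiffGroupoid_refl_mem, Set.mem_univ _, rfl, a j, b j,
    fun i z => z.1 ^ (a i - a j) * z.2 ^ (b i - b j) * e i z,
    fun i => ((analyticAt_fst.pow _).mul (analyticAt_snd.pow _)).mul (he i),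
    ⟨j, by simpa using he0 j⟩, fun i => ?_⟩
  filter_upwards [hFe i] with z hz
  have h1 : z.1 ^ a i = z.1 ^ (a i - a j) * z.1 ^ a j := by
    rw [← pow_add, Nat.sub_add_cancel (hj i).1]
  have h2 : z.2 ^ b i = z.2 ^ (b i - b j) * z.2 ^ b j := by
    rw [← pow_add, Nat.sub_add_cancel (hj i).2]
  rw [hz, h1, h2]
  change _ = _ * (z.1 ^ a j * z.2 ^ b j)
  ring

/-- One blow-up, in the given coordinates. -/
theorem Resolvable.exists_of_blowMap {ι : Type} {F : ι → ℂ × ℂ → ℂ} (S : Finset (Option ℂ))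
    (h1 : ∀ c ∉ S, MonoAt (fun i w => F i (blowMap c w)) 0)
    (h2 : ∀ c ∈ S, c.map star = c ∧ ∃ n, Resolvable (fun i w => F i (blowMap c w)) n) :
    ∃ n, Resolvable F n := by
  classical
  choose! hS n hn using h2
  refine ⟨_, .blowup (fun _ => 0) analyticAt_const rfl (by simp)
    (Finsupp.onFinset S (fun c => if c ∈ S then n c else 0) fun c hc => by
      by_contra h; simp [h] at hc) (fun c hc => ?_) fun c => ?_⟩
  · by_cases h : c ∈ S
    · exact hS c h
    · simp [h] at hc
  · simp only [shear, add_zero, Finsupp.onFinset_apply]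
    split_ifs with h
    · exact hn c h
    · exact .monomial (h1 c h)

/-- The distance of two incomparable pairs of exponents. -/
def pairWeight (p q : ℕ × ℕ) : ℕ :=
  if p.1 ≤ q.1 ∧ p.2 ≤ q.2 ∨ q.1 ≤ p.1 ∧ q.2 ≤ p.2 then 0
  else (p.1 - q.1) + (q.1 - p.1) + ((p.2 - q.2) + (q.2 - p.2))

/-- For an incomparable pair the two exponent differences have opposite signs. After the blow-up the
first is replaced by their sum: either the pair becomes comparable, or the absolute value of the
first difference drops by that of the second. -/
theorem pairWeight_le_some (p q : ℕ × ℕ) :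
    pairWeight (p.1 + p.2, p.2) (q.1 + q.2, q.2) ≤ pairWeight p q ∧
      (pairWeight p q ≠ 0 → pairWeight (p.1 + p.2, p.2) (q.1 + q.2, q.2) < pairWeight p q) := by
  unfold pairWeight
  dsimp only
  split_ifs <;> omega

theorem pairWeight_le_none (p q : ℕ × ℕ) :
    pairWeight (p.1 + p.2, p.1) (q.1 + q.2, q.1) ≤ pairWeight p q ∧
      (pairWeight p q ≠ 0 → pairWeight (p.1 + p.2, p.1) (q.1 + q.2, q.1) < pairWeight p q) := by
  unfold pairWeight
  dsimp only
  split_ifs <;> omega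

/-- When all pairs are comparable, an element of minimal total degree is below all others. -/
theorem exists_forall_le_of_pairWeight {ι : Type} [Finite ι] [Nonempty ι] (p : ι → ℕ × ℕ)
    (h : ∀ i j, pairWeight (p i) (p j) = 0) :
    ∃ j, ∀ i, (p j).1 ≤ (p i).1 ∧ (p j).2 ≤ (p i).2 := by
  obtain ⟨j, hj⟩ := Finite.exists_min fun i => (p i).1 + (p i).2
  refine ⟨j, fun i => ?_⟩
  have h1 := h i j
  have h2 := hj i
  unfold pairWeight at h1
  split_ifs at h1 <;> omega

theorem IsMonomialGerm.comp_blowMap_zero {f : ℂ × ℂ → ℂ} {a b : ℕ} (hf : IsMonomialGerm f a b) :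
    IsMonomialGerm (fun w => f (blowMap (some 0) w)) (a + b) b := by
  obtain ⟨e, he, he0, h⟩ := hf
  refine ⟨fun w => e (blowMap (some 0) w), he.comp_of_eq (analyticAt_blowMap _ _)
    (blowMap_zero _), by simpa using he0, ?_⟩
  filter_upwards [(tendsto_blowMap (some 0)).eventually h] with w hw
  rw [hw]
  simp only [blowMap_some]
  ring

theorem IsMonomialGerm.comp_blowMap_none {f : ℂ × ℂ → ℂ} {a b : ℕ} (hf : IsMonomialGerm f a b) :
    IsMonomialGerm (fun w => f (blowMap none w)) (a + b) a := by
  obtain ⟨e, he, he0, h⟩ := hf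
  refine ⟨fun w => e (blowMap none w), he.comp_of_eq (analyticAt_blowMap _ _)
    (blowMap_zero _), by simpa using he0, ?_⟩
  filter_upwards [(tendsto_blowMap none).eventually h] with w hw
  rw [hw]
  simp only [blowMap_none]
  ring

theorem IsMonomialGerm.comp_blowMap_ne {f : ℂ × ℂ → ℂ} {a b : ℕ} (hf : IsMonomialGerm f a b)
    {c : ℂ} (hc : c ≠ 0) : IsMonomialGerm (fun w => f (blowMap (some c) w)) (a + b) 0 := by
  obtain ⟨e, he, he0, h⟩ := hf
  refine ⟨fun w => (w.2 + c) ^ b * e (blowMap (some c) w),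
    ((analyticAt_snd.add analyticAt_const).pow b).mul
      (he.comp_of_eq (analyticAt_blowMap _ _) (blowMap_zero _)), by simpa [hc] using he0, ?_⟩
  filter_upwards [(tendsto_blowMap (some c)).eventually h] with w hw
  rw [hw]
  simp only [blowMap_some]
  rw [mul_pow]
  ring

/-- Ideals generated by monomials can be resolved. -/
theorem Resolvable.exists_of_isMonomialGerm {ι : Type} [Finite ι] [Nonempty ι] {F : ι → ℂ × ℂ → ℂ} (p : ι → ℕ × ℕ)
    (hF : ∀ i, IsMonomialGerm (F i) (p i).1 (p i).2) : ∃ n, Resolvable F n := by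
  have := Fintype.ofFinite ι
  induction hN : ∑ x : ι × ι, pairWeight (p x.1) (p x.2) using Nat.strong_induction_on
    generalizing F p with
  | _ N ih =>
    by_cases h0 : ∀ i j, pairWeight (p i) (p j) = 0
    · obtain ⟨j, hj⟩ := exists_forall_le_of_pairWeight p h0
      exact ⟨0, .monomial (monoAt_of_isMonomialGerm hF j hj)⟩
    push Not at h0
    obtain ⟨i, j, hij⟩ := h0
    -- Only slope 0 and the vertical direction need care. At any other slope the second coordinate
    -- pulls back to the exceptional coordinate times a unit, so all generators become powers of one
    -- coordinate and the lowest generates.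
    refine Resolvable.exists_of_blowMap {some 0, none} (fun c hc => ?_) fun c hc => ?_
    · simp only [Finset.mem_insert, Finset.mem_singleton, not_or] at hc
      obtain ⟨c, rfl⟩ := Option.ne_none_iff_exists'.mp hc.2
      have hc0 : c ≠ 0 := fun h => hc.1 (by rw [h])
      obtain ⟨j, hj⟩ := Finite.exists_min fun i => (p i).1 + (p i).2
      exact monoAt_of_isMonomialGerm (fun i => (hF i).comp_blowMap_ne hc0) j
        fun i => ⟨hj i, le_rfl⟩
    · simp only [Finset.mem_insert, Finset.mem_singleton] at hc
      rcases hc with rfl | rfl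
      · refine ⟨by simp, ih _ ?_ (fun i => ((p i).1 + (p i).2, (p i).2))
          (fun i => (hF i).comp_blowMap_zero) rfl⟩
        rw [← hN]
        exact Finset.sum_lt_sum (fun x _ => (pairWeight_le_some _ _).1)
          ⟨(i, j), Finset.mem_univ _, (pairWeight_le_some _ _).2 hij⟩
      · refine ⟨rfl, ih _ ?_ (fun i => ((p i).1 + (p i).2, (p i).1))
          (fun i => (hF i).comp_blowMap_none) rfl⟩
        rw [← hN]
        exact Finset.sum_lt_sum (fun x _ => (pairWeight_le_none _ _).1)
          ⟨(i, j), Finset.mem_univ _, (pairWeight_le_none _ _).2 hij⟩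

/-! ### Resolution of germs of ideals: the general case -/

/-- Each `F i` divides a power of `x * h`. -/
def DividesPow {ι : Type} (F : ι → ℂ × ℂ → ℂ) (h : ℂ × ℂ → ℂ) : Prop :=
  ∀ i, AnalyticAt ℂ (F i) 0 ∧ ∃ (N : ℕ) (G : ℂ × ℂ → ℂ), AnalyticAt ℂ G 0 ∧
    ∀ᶠ z in 𝓝 (0 : ℂ × ℂ), F i z * G z = (z.1 * h z) ^ N

/-- The data of the resolution process: `h` has regularity order `d` and each `F i` divides a power
of `x * h`. -/
structure ResolutionData {ι : Type} (F : ι → ℂ × ℂ → ℂ) (h : ℂ × ℂ → ℂ) (d : ℕ) : Prop where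
  analytic : AnalyticAt ℂ h 0
  real : IsRealGerm h
  branches : HasRealBranches h
  order : HasRegOrder h d
  divides : DividesPow F h

/-- `h` has a smooth factor transversal to the `y`-axis. -/
def HasSmoothFactor (h : ℂ × ℂ → ℂ) : Prop :=
  ∃ w g : ℂ × ℂ → ℂ, AnalyticAt ℂ w 0 ∧ AnalyticAt ℂ g 0 ∧ HasRegOrder w 1 ∧
    ∀ᶠ z in 𝓝 (0 : ℂ × ℂ), h z = w z * g z

/-- If `h = y ^ b * unit`, the `F i` are monomials. -/
theorem DividesPow.isMonomialGerm {ι : Type} {F : ι → ℂ × ℂ → ℂ} {h : ℂ × ℂ → ℂ}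
    (hF : DividesPow F h) {b : ℕ} (hb : IsMonomialGerm h 0 b) (i : ι) :
    ∃ a' b', (b = 0 → b' = 0) ∧ IsMonomialGerm (F i) a' b' := by
  obtain ⟨hFi, N, G, hG, hFG⟩ := hF i
  obtain ⟨e, he, he0, hh⟩ := hb
  obtain ⟨a', b', -, hb', h2⟩ := IsMonomialGerm.of_mul (a := N) (b := b * N) hFi hG
    ⟨fun z => e z ^ N, he.pow N, pow_ne_zero N he0, by
      filter_upwards [hFG, hh] with z h1 h2
      rw [h1, h2]; ring⟩
  exact ⟨a', b', fun h => by simpa [h] using hb', h2⟩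

/-- When h is a unit, each F i divides a power of x, hence is a power of x times a unit; the
smallest exponent generates. -/
theorem DividesPow.monoAt {ι : Type} [Finite ι] [Nonempty ι] {F : ι → ℂ × ℂ → ℂ} {h : ℂ × ℂ → ℂ}
    (hF : DividesPow F h) (hh : AnalyticAt ℂ h 0) (h0 : h 0 ≠ 0) : MonoAt F 0 := by
  have h1 := hF.isMonomialGerm (b := 0) ⟨h, hh, h0, by simp⟩
  choose a b hb hab using h1
  obtain ⟨j, hj⟩ := Finite.exists_min a
  exact monoAt_of_isMonomialGerm hab j fun i => ⟨hj i, by rw [hb i rfl, hb j rfl]⟩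

theorem DividesPow.shear {ι : Type} {F : ι → ℂ × ℂ → ℂ} {h : ℂ × ℂ → ℂ} (hF : DividesPow F h)
    {a : ℂ → ℂ} (ha : AnalyticAt ℂ a 0) (ha0 : a 0 = 0) :
    DividesPow (fun i z => F i (shear a z)) fun z => h (shear a z) := by
  have hs : AnalyticAt ℂ (_root_.shear a) 0 := ha.shear
  have hs0 := shear_apply_zero ha0
  have t : Filter.Tendsto (_root_.shear a) (𝓝 0) (𝓝 0) := by simpa [hs0] using hs.continuousAt.tendsto
  refine fun i => ⟨(hF i).1.comp_of_eq hs hs0, ?_⟩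
  obtain ⟨-, N, G, hG, hFG⟩ := hF i
  exact ⟨N, fun z => G (_root_.shear a z), hG.comp_of_eq hs hs0, t.eventually hFG⟩

/-- The coordinate x pulls back to the new exceptional coordinate, so x * h becomes w.1 ^ (M + 1) *
h', which divides (w.1 * h') ^ (M + 1). -/
theorem DividesPow.blowMap_some {ι : Type} {F : ι → ℂ × ℂ → ℂ} {h h' : ℂ × ℂ → ℂ}
    (hF : DividesPow F h) (hh' : AnalyticAt ℂ h' 0) {M : ℕ} {c : ℂ}
    (hM : ∀ᶠ w in 𝓝 (0 : ℂ × ℂ), h (blowMap (some c) w) = w.1 ^ M * h' w) :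
    DividesPow (fun i w => F i (blowMap (some c) w)) h' := by
  refine fun i => ⟨(hF i).1.comp_of_eq (analyticAt_blowMap _ _) (blowMap_zero _), ?_⟩
  obtain ⟨-, N, G, hG, hFG⟩ := hF i
  refine ⟨(M + 1) * N, fun w => G (blowMap (some c) w) * h' w ^ (M * N),
    (hG.comp_of_eq (analyticAt_blowMap _ _) (blowMap_zero _)).mul (hh'.pow _), ?_⟩
  filter_upwards [(tendsto_blowMap (some c)).eventually hFG, hM] with w h1 h2
  rw [← mul_assoc, h1, h2]
  simp only [_root_.blowMap_some]
  ring

/-- Here x pulls back to w.1 * w.2. The factor w.2 is the strict transform of the old exceptional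
curve and has to be moved into the new h. -/
theorem DividesPow.blowMap_none {ι : Type} {F : ι → ℂ × ℂ → ℂ} {h h' : ℂ × ℂ → ℂ}
    (hF : DividesPow F h) (hh' : AnalyticAt ℂ h' 0) {M : ℕ}
    (hM : ∀ᶠ w in 𝓝 (0 : ℂ × ℂ), h (blowMap none w) = w.1 ^ M * h' w) :
    DividesPow (fun i w => F i (blowMap none w)) fun w => w.2 * h' w := by
  refine fun i => ⟨(hF i).1.comp_of_eq (analyticAt_blowMap _ _) (blowMap_zero _), ?_⟩
  obtain ⟨-, N, G, hG, hFG⟩ := hF i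
  refine ⟨(M + 1) * N, fun w => G (blowMap none w) * (w.2 * h' w) ^ (M * N),
    (hG.comp_of_eq (analyticAt_blowMap _ _) (blowMap_zero _)).mul
      ((analyticAt_snd.mul hh').pow _), ?_⟩
  filter_upwards [(tendsto_blowMap none).eventually hFG, hM] with w h1 h2
  rw [← mul_assoc, h1, h2]
  simp only [_root_.blowMap_none]
  ring

theorem IsRealGerm.strictTransform {h h' : ℂ × ℂ → ℂ} (hr : IsRealGerm h) {M : ℕ} {c : Option ℂ}
    (hc : c.map star = c) (hh' : AnalyticAt ℂ h' 0)
    (hM : ∀ᶠ w in 𝓝 (0 : ℂ × ℂ), h (blowMap c w) = w.1 ^ M * h' w) : IsRealGerm h' := by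
  have hc' : ∀ᶠ w in 𝓝 (0 : ℂ × ℂ), ContinuousAt (fun w => star (h' (star w))) w := by
    filter_upwards [tendsto_star_zero.eventually hh'.eventually_continuousAt] with w hw
    exact continuous_star.continuousAt.comp
      (ContinuousAt.comp (g := h') hw continuous_star.continuousAt)
  have h1 := eventually_eq_of_pow_mul_eq (M := M) hh'.eventually_continuousAt hc' (by
    filter_upwards [hM, tendsto_star_zero.eventually hM,
      (tendsto_blowMap c).eventually hr] with w h1 h2 h3
    rw [blowMap_star hc, h3, h1] at h2
    have := congrArg star h2
    simpa using this)
  filter_upwards [h1] with w hw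
  rw [hw, star_star]

theorem HasRegOrder.snd : HasRegOrder (fun z : ℂ × ℂ => z.2) 1 :=
  ⟨fun _ => 1, analyticAt_const, one_ne_zero, by simp⟩

namespace ResolutionData

variable {ι : Type} {F : ι → ℂ × ℂ → ℂ} {h h' : ℂ × ℂ → ℂ} {d e M : ℕ}

theorem not_eventually_zero (H : HasRegOrder h d) : ¬ ∀ᶠ y in 𝓝 (0 : ℂ), h (0, y) = 0 := fun h0 => by
  obtain ⟨y, h1, h2⟩ := (H.not_eventually_zero.and (nhdsWithin_le_nhds h0)).exists
  exact h1 h2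

theorem blowMap_some (H : ResolutionData F h d) {c : ℂ} (hc : star c = c)
    (hh' : AnalyticAt ℂ h' 0)
    (hM : ∀ᶠ w in 𝓝 (0 : ℂ × ℂ), h (blowMap (some c) w) = w.1 ^ M * h' w)
    (he : HasRegOrder h' e) : ResolutionData (fun i w => F i (blowMap (some c) w)) h' e where
  analytic := hh'
  real := H.real.strictTransform (c := some c) (by simpa using hc) hh' hM
  branches := H.branches.strictTransform (c := some c) hh' hM (not_eventually_zero he)
    (by simpa using hc)
  order := he
  divides := H.divides.blowMap_some hh' hM

theorem blowMap_none (H : ResolutionData F h d) (hh' : AnalyticAt ℂ h' 0)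
    (hM : ∀ᶠ w in 𝓝 (0 : ℂ × ℂ), h (blowMap none w) = w.1 ^ M * h' w)
    (he : HasRegOrder h' e) :
    ResolutionData (fun i w => F i (blowMap none w)) (fun w => w.2 * h' w) (e + 1) where
  analytic := analyticAt_snd.mul hh'
  real := by
    filter_upwards [H.real.strictTransform (c := none) rfl hh' hM] with w hw
    simp [hw]
  branches := HasRealBranches.snd.mul
    (H.branches.strictTransform (c := none) hh' hM (not_eventually_zero he) rfl)
  order := by rw [add_comm]; exact HasRegOrder.snd.mul he
  divides := H.divides.blowMap_none hh' hM

theorem shear (H : ResolutionData F h d) {a : ℂ → ℂ} (ha : AnalyticAt ℂ a 0) (ha0 : a 0 = 0)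
    (hreal : ∀ᶠ x in 𝓝 (0 : ℂ), a (star x) = star (a x)) :
    ResolutionData (fun i z => F i (shear a z)) (fun z => h (shear a z)) d := by
  have hs : AnalyticAt ℂ (_root_.shear a) 0 := ha.shear
  have hs0 := shear_apply_zero ha0
  have t : Filter.Tendsto (_root_.shear a) (𝓝 0) (𝓝 0) := by
    simpa [hs0] using hs.continuousAt.tendsto
  have tfst : Filter.Tendsto (Prod.fst : ℂ × ℂ → ℂ) (𝓝 0) (𝓝 0) := continuous_fst.tendsto' _ _ rfl
  have hst : ∀ᶠ z in 𝓝 (0 : ℂ × ℂ), _root_.shear a (star z) = star (_root_.shear a z) := by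
    filter_upwards [tfst.eventually hreal] with z hz
    refine Prod.ext rfl ?_
    change star z.2 + a (star z.1) = star (z.2 + a z.1)
    rw [hz, star_add]
  have hst' : ∀ᶠ z in 𝓝 (0 : ℂ × ℂ), _root_.shear (fun x => -a x) (star z) =
      star (_root_.shear (fun x => -a x) z) := by
    filter_upwards [tfst.eventually hreal] with z hz
    refine Prod.ext rfl ?_
    change star z.2 + -a (star z.1) = star (z.2 + -a z.1)
    rw [hz, star_add, star_neg]
  exact
    { analytic := H.analytic.comp_of_eq hs hs0
      real := by
        filter_upwards [hst, t.eventually H.real] with z h1 h2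
        rw [h1, h2]
      branches := H.branches.comp hs0 (shear_apply_zero (a := fun x => -a x) (by simp [ha0]))
        hs.eventually_continuousAt
        (AnalyticAt.shear (z := 0) ha.neg).eventually_continuousAt
        (by simp [_root_.shear]) (by simp [_root_.shear]) hst'
      order := by
        obtain ⟨b, hb, hb0, h1⟩ := H.order
        exact ⟨b, hb, hb0, by simpa [_root_.shear, ha0] using h1⟩
      divides := H.divides.shear ha ha0 }

end ResolutionData

theorem eventually_eq_of_pow_mul_eq_one_var {f g : ℂ → ℂ} (hf : AnalyticAt ℂ f 0)
    (hg : AnalyticAt ℂ g 0) {k : ℕ} (h : ∀ᶠ x in 𝓝 (0 : ℂ), x ^ k * f x = x ^ k * g x) :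
    ∀ᶠ x in 𝓝 (0 : ℂ), f x = g x := by
  refine (hf.frequently_eq_iff_eventually_eq hg).mp (Filter.Eventually.frequently ?_)
  filter_upwards [nhdsWithin_le_nhds h, self_mem_nhdsWithin] with x hx hx0
  exact mul_left_cancel₀ (pow_ne_zero k hx0) hx

/-! ### Orders of strict transforms -/

theorem hasRegOrder_of_eval {h : ℂ × ℂ → ℂ} {q : Polynomial ℂ} (hq : q ≠ 0)
    (h1 : ∀ᶠ v in 𝓝 (0 : ℂ), h (0, v) = q.eval v) : HasRegOrder h (q.rootMultiplicity 0) := by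
  obtain ⟨p, hp, hp0⟩ := Polynomial.exists_eq_pow_rootMultiplicity_mul_and_not_dvd q hq 0
  have hp0 : p.eval 0 ≠ 0 := fun h => hp0 (Polynomial.dvd_iff_isRoot.mpr h)
  refine ⟨fun v => p.eval v, ?_, hp0, ?_⟩
  · have h2 : AnalyticAt ℂ (fun y => Polynomial.aeval y p) (0 : ℂ) :=
      AnalyticAt.aeval_polynomial (analyticAt_id (z := (0 : ℂ))) p
    simpa only [Polynomial.coe_aeval_eq_eval] using h2
  · filter_upwards [h1] with v hv
    rw [hv]
    conv_lhs => rw [hp]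
    simp

theorem excForm_ne_zero {M : ℕ} {p : Polynomial ℂ} (hp : p ≠ 0) (c : Option ℂ) :
    excForm M p c ≠ 0 := by
  cases c with
  | none => exact fun h => hp (Polynomial.reflect_eq_zero_iff.mp h)
  | some c => exact fun h => hp (Polynomial.comp_X_add_C_eq_zero_iff.mp h)

theorem rootMultiplicity_le_natDegree {p : Polynomial ℂ} (c : ℂ) :
    p.rootMultiplicity c ≤ p.natDegree := by
  rw [← Polynomial.count_roots, ← IsAlgClosed.card_roots_eq_natDegree (p := p)]
  exact Multiset.count_le_card _ _

theorem rootMultiplicity_reflect_le {M : ℕ} {p : Polynomial ℂ} (hp : p ≠ 0) (hM : p.natDegree ≤ M) :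
    (p.reflect M).rootMultiplicity 0 + p.natDegree ≤ M := by
  have h1 : (p.reflect M).coeff (M - p.natDegree) ≠ 0 := by
    rw [Polynomial.coeff_reflect, Polynomial.revAt_le (Nat.sub_le _ _), Nat.sub_sub_self hM]
    exact Polynomial.leadingCoeff_ne_zero.mpr hp
  rw [Polynomial.rootMultiplicity_eq_natTrailingDegree']
  have := Polynomial.natTrailingDegree_le_of_ne_zero h1
  omega

/-- The strict transform and its order. -/
theorem HasInitialForm.exists_some {h : ℂ × ℂ → ℂ} {M : ℕ} {p : Polynomial ℂ}
    (hp : HasInitialForm h M p) (hp0 : p ≠ 0) (c : ℂ) : ∃ h' : ℂ × ℂ → ℂ, AnalyticAt ℂ h' 0 ∧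
      (∀ᶠ w in 𝓝 (0 : ℂ × ℂ), h (blowMap (some c) w) = w.1 ^ M * h' w) ∧
      HasRegOrder h' (p.rootMultiplicity c) ∧ h' 0 = p.eval c := by
  obtain ⟨h', h1, h2, h3⟩ := hp.2 (some c)
  refine ⟨h', h1, h2, ?_, ?_⟩
  · rw [Polynomial.rootMultiplicity_eq_rootMultiplicity]
    exact hasRegOrder_of_eval (excForm_ne_zero hp0 (some c) (M := M)) h3
  · have : h' (0, 0) = _ := h3.self_of_nhds
    rw [← Prod.zero_eq_mk] at this
    rw [this]
    simp [excForm]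

theorem HasInitialForm.exists_none {h : ℂ × ℂ → ℂ} {M : ℕ} {p : Polynomial ℂ}
    (hp : HasInitialForm h M p) (hp0 : p ≠ 0) : ∃ (h' : ℂ × ℂ → ℂ) (e : ℕ), AnalyticAt ℂ h' 0 ∧
      (∀ᶠ w in 𝓝 (0 : ℂ × ℂ), h (blowMap none w) = w.1 ^ M * h' w) ∧
      HasRegOrder h' e ∧ e + p.natDegree ≤ M := by
  obtain ⟨h', h1, h2, h3⟩ := hp.2 none
  exact ⟨h', _, h1, h2, hasRegOrder_of_eval (excForm_ne_zero hp0 none (M := M)) h3,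
    rootMultiplicity_reflect_le hp0 hp.1⟩

/-- At a slope that is no root of p the strict transform is a unit by its value on the exceptional
curve; at a non-real root it is a unit because h has real branches. The ideal is monomial at both,
which leaves the real roots and the vertical direction. -/
theorem ResolutionData.exists_of_initialForm {ι : Type} [Finite ι] [Nonempty ι]
    {F : ι → ℂ × ℂ → ℂ} {h : ℂ × ℂ → ℂ} {d M : ℕ} {p : Polynomial ℂ} (H : ResolutionData F h d)
    (hp0 : p ≠ 0) (hp : HasInitialForm h M p)
    (h1 : ∀ (c : ℂ) (h' : ℂ × ℂ → ℂ), AnalyticAt ℂ h' 0 →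
      (∀ᶠ w in 𝓝 (0 : ℂ × ℂ), h (blowMap (some c) w) = w.1 ^ M * h' w) →
      ResolutionData (fun i w => F i (blowMap (some c) w)) h' (p.rootMultiplicity c) →
      ∃ n, Resolvable (fun i w => F i (blowMap (some c) w)) n)
    (h2 : ∀ (h' : ℂ × ℂ → ℂ) (e : ℕ), e + p.natDegree ≤ M → HasSmoothFactor h' →
      ResolutionData (fun i w => F i (blowMap none w)) h' (e + 1) →
      ∃ n, Resolvable (fun i w => F i (blowMap none w)) n) : ∃ n, Resolvable F n := by
  classical
  refine Resolvable.exists_of_blowMap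
    (insert none ((p.roots.toFinset.filter fun c => star c = c).image some)) (fun c hc => ?_)
    fun c hc => ?_
  · simp only [Finset.mem_insert, Finset.mem_image, Finset.mem_filter, Multiset.mem_toFinset,
      not_or, not_exists, not_and] at hc
    obtain ⟨c, rfl⟩ := Option.ne_none_iff_exists'.mp hc.1
    obtain ⟨h', ha, hM, ho, h0⟩ := hp.exists_some hp0 c
    refine (H.divides.blowMap_some ha hM).monoAt ha ?_
    by_cases hr : p.eval c = 0
    · have hc' : star c ≠ c := fun hs =>
        hc.2 c ⟨(Polynomial.mem_roots hp0).mpr hr, hs⟩ rfl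
      exact H.branches.strictTransform_ne_zero ha hM (ResolutionData.not_eventually_zero ho) hc'
    · rwa [h0]
  · simp only [Finset.mem_insert, Finset.mem_image, Finset.mem_filter, Multiset.mem_toFinset] at hc
    rcases hc with rfl | ⟨c, ⟨-, hs⟩, rfl⟩
    · obtain ⟨h', e, ha, hM, ho, he⟩ := hp.exists_none hp0
      exact ⟨rfl, h2 _ e he ⟨fun z => z.2, h', analyticAt_snd, ha, HasRegOrder.snd, by simp⟩
        (H.blowMap_none ha hM ho)⟩
    · obtain ⟨h', ha, hM, ho, -⟩ := hp.exists_some hp0 c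
      exact ⟨by simpa using hs, h1 c h' ha hM (H.blowMap_some hs ha hM ho)⟩

theorem HasSmoothFactor.exists_order {h : ℂ × ℂ → ℂ} {d : ℕ} (hs : HasSmoothFactor h)
    (hd : HasRegOrder h d) : ∃ (w g : ℂ × ℂ → ℂ) (e : ℕ), AnalyticAt ℂ w 0 ∧ AnalyticAt ℂ g 0 ∧
      HasRegOrder w 1 ∧ HasRegOrder g e ∧ d = 1 + e ∧
      ∀ᶠ z in 𝓝 (0 : ℂ × ℂ), h z = w z * g z := by
  obtain ⟨w, g, hw, hg, hw1, h1⟩ := hs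
  obtain ⟨d', e, h2, h3, h4⟩ := HasRegOrder.of_mul hw hg (hd.congr h1)
  obtain rfl := h2.unique hw1
  exact ⟨w, g, e, hw, hg, hw1, h3, h4.symm, h1⟩

/-- The smooth factor has order 1 on the y-axis and vanishes at 0, so its initial form is linear
with nonzero coefficient at y. The positive degree of p improves the bound on the order in the
vertical direction by one. -/
theorem HasSmoothFactor.exists_hasInitialForm {h : ℂ × ℂ → ℂ} {d : ℕ} (hs : HasSmoothFactor h)
    (hd : HasRegOrder h d) : ∃ M p, p ≠ 0 ∧ HasInitialForm h M p ∧ 1 ≤ p.natDegree := by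
  obtain ⟨w, g, e, hw, hg, hw1, hge, -, h1⟩ := hs.exists_order hd
  obtain ⟨M, p, hp0, hp⟩ := hw.exists_hasInitialForm hw1
  obtain ⟨N, q, hq0, hq⟩ := hg.exists_hasInitialForm hge
  refine ⟨M + N, p * q, mul_ne_zero hp0 hq0, (hp.mul hq).congr (h1.mono fun _ => Eq.symm), ?_⟩
  rw [Polynomial.natDegree_mul hp0 hq0]
  have hM0 : M ≠ 0 := by
    rintro rfl
    obtain ⟨w', -, h2, -, h3⟩ := hp.exists_some hp0 0
    have h4 := h2.self_of_nhds
    rw [blowMap_zero, hw1.eq_zero one_ne_zero, pow_zero, one_mul, h3] at h4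
    have h5 := hp.1
    obtain ⟨a, ha⟩ : ∃ a, p = Polynomial.C a :=
      ⟨_, Polynomial.eq_C_of_natDegree_le_zero h5⟩
    rw [ha, Polynomial.eval_C] at h4
    exact hp0 (by rw [ha, ← h4, Polynomial.C_0])
  obtain ⟨h5, h6⟩ := hp.le_regOrder hw1
  have h7 : M = 1 := by omega
  subst h7
  have := Polynomial.le_natDegree_of_ne_zero (h6 rfl)
  omega

/-- A smooth factor persists as long as the order does not drop. -/
theorem HasSmoothFactor.strictTransform {h h' : ℂ × ℂ → ℂ} {d : ℕ} {c : ℂ}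
    (hs : HasSmoothFactor h) (hd : HasRegOrder h d) (hh' : AnalyticAt ℂ h' 0)
    (hM : ∀ᶠ w in 𝓝 (0 : ℂ × ℂ), h (blowMap (some c) w) = w.1 ^ d * h' w)
    (hd' : HasRegOrder h' d) : HasSmoothFactor h' := by
  obtain ⟨w, g, e, hw, hg, hw1, hge, rfl, h1⟩ := hs.exists_order hd
  obtain ⟨M, p, hp0, hp⟩ := hw.exists_hasInitialForm hw1
  obtain ⟨N, q, hq0, hq⟩ := hg.exists_hasInitialForm hge
  obtain ⟨w', hw', hwM, hwo, -⟩ := hp.exists_some hp0 c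
  obtain ⟨g', hg', hgM, hgo, -⟩ := hq.exists_some hq0 c
  have hM1 := (hp.le_regOrder hw1).1
  have hN1 := (hq.le_regOrder hge).1
  have hp1 := (rootMultiplicity_le_natDegree (p := p) c).trans hp.1
  have hq1 := (rootMultiplicity_le_natDegree (p := q) c).trans hq.1
  -- A priori d may exceed the sum of the multiplicities of the two factors by j. But the product of
  -- their strict transforms is not divisible by the exceptional coordinate, so j = 0.
  obtain ⟨j, hj⟩ : ∃ j, 1 + e = M + N + j := ⟨1 + e - (M + N), by omega⟩
  have h2 : ∀ᶠ z in 𝓝 (0 : ℂ × ℂ), z.1 ^ j * h' z = w' z * g' z := by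
    refine eventually_eq_of_pow_mul_eq (M := M + N)
      ((analyticAt_fst.pow j).mul hh').eventually_continuousAt
      (hw'.mul hg').eventually_continuousAt ?_
    filter_upwards [hM, hwM, hgM, (tendsto_blowMap (some c)).eventually h1] with z k1 k2 k3 k4
    rw [k1, k2, k3, hj] at k4
    rw [← mul_assoc, ← pow_add, k4]
    ring
  have hprod := hwo.mul hgo
  obtain rfl : j = 0 := by
    by_contra hj0
    obtain ⟨y, h3, h4⟩ := (hprod.not_eventually_zero.and
      (nhdsWithin_le_nhds (tendsto_prodMk_zero.eventually h2))).exists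
    rw [← h4] at h3
    simp [hj0] at h3
  have h3 : ∀ᶠ z in 𝓝 (0 : ℂ × ℂ), h' z = w' z * g' z := by simpa using h2
  have h4 := (hd'.congr h3).unique hprod
  -- The multiplicities of c in the two forms are at most 1 and e, and they add up to 1 + e, so both
  -- bounds are attained.
  have h5 : p.rootMultiplicity c = 1 := by omega
  exact ⟨w', g', hw', hg', h5 ▸ hwo, h3⟩

/-! ### Coefficients of Weierstrass polynomials -/

/-- If a polynomial in `y` is divisible by `x ^ d`, so are its coefficients. -/
theorem exists_coeff_eq_pow_mul {d : ℕ} (n : ℕ) {b : ℕ → ℂ → ℂ} {g : ℂ × ℂ → ℂ}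
    (hb : ∀ k < n, AnalyticAt ℂ (b k) 0) (hg : AnalyticAt ℂ g 0)
    (h : ∀ᶠ z in 𝓝 (0 : ℂ × ℂ), ∑ k ∈ Finset.range n, b k z.1 * z.2 ^ k = z.1 ^ d * g z) :
    ∀ k < n, ∃ r : ℂ → ℂ, AnalyticAt ℂ r 0 ∧ ∀ᶠ x in 𝓝 (0 : ℂ), b k x = x ^ d * r x := by
  induction n generalizing b g with
  | zero => intro k hk; omega
  | succ n ih =>
    have h0 : ∀ᶠ x in 𝓝 (0 : ℂ), b 0 x = x ^ d * g (x, 0) := by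
      filter_upwards [tendsto_prodMk_zero'.eventually h] with x hx
      rw [Finset.sum_range_succ'] at hx
      simpa using hx
    have hg0 : AnalyticAt ℂ (fun z : ℂ × ℂ => g (z.1, 0)) 0 :=
      hg.comp_of_eq (analyticAt_fst.prod analyticAt_const) rfl
    obtain ⟨g', hg', h2⟩ := (hg.sub hg0).exists_eq_snd_mul
      (Filter.Eventually.of_forall fun x => by simp)
    have tfst : Filter.Tendsto (Prod.fst : ℂ × ℂ → ℂ) (𝓝 0) (𝓝 0) := continuous_fst.tendsto' _ _ rfl
    have h3 := ih (b := fun k => b (k + 1)) (g := g') (fun k hk => hb _ (by omega)) hg' (by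
      refine eventually_eq_of_snd_mul_eq ?_ ((analyticAt_fst.pow d).mul hg') ?_
      · refine Finset.analyticAt_fun_sum _ fun k hk => AnalyticAt.mul ?_ (analyticAt_snd.pow k)
        exact (hb (k + 1) (by have := Finset.mem_range.mp hk; omega)).comp_of_eq analyticAt_fst rfl
      · filter_upwards [h, h2, tfst.eventually h0] with z k1 k2 k3
        simp only [Pi.sub_apply] at k2
        rw [Finset.sum_range_succ', pow_zero, mul_one, k3] at k1
        rw [mul_left_comm, ← k2, mul_sub, ← k1, add_sub_cancel_right, Finset.mul_sum]
        exact Finset.sum_congr rfl fun k _ => by ring)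
    intro k hk
    cases k with
    | zero => exact ⟨_, hg.comp_prodMk_zero', h0⟩
    | succ k => exact h3 k (by omega)

/-- The coefficients of a Weierstrass polynomial after a shear. -/
def shearCoeff (d : ℕ) (c : ℕ → ℂ → ℂ) (a : ℂ → ℂ) (j : ℕ) (x : ℂ) : ℂ :=
  a x ^ (d - j) * d.choose j + ∑ k ∈ Finset.range d, c k x * (a x ^ (k - j) * k.choose j)

theorem weierstrassPoly_shear (d : ℕ) (c : ℕ → ℂ → ℂ) (a : ℂ → ℂ) (z : ℂ × ℂ) :
    weierstrassPoly d c (shear a z) = weierstrassPoly d (shearCoeff d c a) z := by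
  have h1 : ∀ k < d, (z.2 + a z.1) ^ k =
      ∑ j ∈ Finset.range d, z.2 ^ j * (a z.1 ^ (k - j) * k.choose j) := by
    intro k hk
    rw [add_pow]
    simp only [mul_assoc]
    refine Finset.sum_subset (Finset.range_mono (by omega)) fun j _ hj => ?_
    rw [Finset.mem_range, not_lt] at hj
    rw [Nat.choose_eq_zero_of_lt (by omega), Nat.cast_zero, mul_zero, mul_zero]
  simp only [weierstrassPoly, shear, shearCoeff]
  rw [add_pow, Finset.sum_range_succ]
  simp only [Nat.sub_self, pow_zero, mul_one, Nat.choose_self, Nat.cast_one]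
  rw [add_right_comm, add_comm]
  congr 1
  simp only [add_mul, Finset.sum_add_distrib]
  congr 1
  · exact Finset.sum_congr rfl fun j _ => by ring
  · rw [Finset.sum_congr rfl fun k hk => by rw [h1 k (Finset.mem_range.mp hk), Finset.mul_sum]]
    rw [Finset.sum_comm]
    refine Finset.sum_congr rfl fun j _ => ?_
    rw [Finset.sum_mul]
    exact Finset.sum_congr rfl fun k _ => by ring

theorem analyticAt_shearCoeff {d : ℕ} {c : ℕ → ℂ → ℂ} {a : ℂ → ℂ} (hc : ∀ k, AnalyticAt ℂ (c k) 0)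
    (ha : AnalyticAt ℂ a 0) (j : ℕ) : AnalyticAt ℂ (shearCoeff d c a j) 0 :=
  ((ha.pow _).mul analyticAt_const).add (Finset.analyticAt_fun_sum _ fun k _ =>
    (hc k).mul ((ha.pow _).mul analyticAt_const))

/-- The coefficient below the leading one depends on the shear linearly and is removed by the choice
a = -c d / (d + 1). -/
theorem shearCoeff_pred {d : ℕ} (c : ℕ → ℂ → ℂ) (a : ℂ → ℂ) (x : ℂ) :
    shearCoeff (d + 1) c a d x = (d + 1) * a x + c d x := by
  rw [shearCoeff, Finset.sum_eq_single_of_mem d (by simp)]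
  · simp [mul_comm]
  · intro k hk hkd
    have := Finset.mem_range.mp hk
    rw [Nat.choose_eq_zero_of_lt (by omega), Nat.cast_zero, mul_zero, mul_zero]

namespace ResolutionData

variable {ι : Type} [Finite ι] [Nonempty ι]

theorem exists_resolvable_of_order_zero {F : ι → ℂ × ℂ → ℂ} {h : ℂ × ℂ → ℂ}
    (H : ResolutionData F h 0) : ∃ k, Resolvable F k :=
  ⟨0, .monomial (H.divides.monoAt H.analytic H.order.ne_zero_of_zero)⟩

/-- The induction step for germs in Weierstrass form without term of degree `d - 1`. -/
theorem exists_resolvable_of_weierstrass {n : ℕ}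
    (IH : ∀ (F : ι → ℂ × ℂ → ℂ) (h : ℂ × ℂ → ℂ) (d : ℕ), ResolutionData F h d →
      (2 * d ≤ n ∨ 2 * d ≤ n + 1 ∧ HasSmoothFactor h) → ∃ k, Resolvable F k) {d j : ℕ} (hj : j < d)
    (m : ℕ) : ∀ (F : ι → ℂ × ℂ → ℂ) (h : ℂ × ℂ → ℂ) (c : ℕ → ℂ → ℂ) (V : ℂ × ℂ → ℂ) (b : ℂ → ℂ),
      ResolutionData F h d → (2 * d ≤ n + 1 ∨ 2 * d ≤ n + 2 ∧ HasSmoothFactor h) →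
      (∀ k < d, AnalyticAt ℂ (c k) 0) → AnalyticAt ℂ V 0 → V 0 ≠ 0 →
      (∀ᶠ z in 𝓝 (0 : ℂ × ℂ), h z = weierstrassPoly d c z * V z) →
      (∀ᶠ x in 𝓝 (0 : ℂ), c (d - 1) x = 0) →
      AnalyticAt ℂ b 0 → b 0 ≠ 0 → (∀ᶠ x in 𝓝 (0 : ℂ), c j x = x ^ m * b x) →
      ∃ k, Resolvable F k := by
  induction m using Nat.strong_induction_on with
  | _ m ihm =>
  intro F h c V b H hn hc hV hV0 hh hcd hb hb0 hcj
  -- For d = 1 the only coefficient is the one that vanishes identically, while the j-th is assumed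
  -- to be nonzero.
  have hd2 : 2 ≤ d := by
    by_contra hlt
    obtain rfl : j = d - 1 := by omega
    have h1 : ∀ᶠ x in 𝓝 (0 : ℂ), x ^ m * b x = x ^ m * 0 := by
      filter_upwards [hcd, hcj] with x k1 k2
      rw [← k2, k1, mul_zero]
    exact hb0 (eventually_eq_of_pow_mul_eq_one_var hb analyticAt_const h1).self_of_nhds
  obtain ⟨M, p, hp0, hp, hD⟩ : ∃ M p, p ≠ 0 ∧ HasInitialForm h M p ∧
      (HasSmoothFactor h → 1 ≤ p.natDegree) := by
    by_cases hs : HasSmoothFactor h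
    · obtain ⟨M, p, h1, h2, h3⟩ := hs.exists_hasInitialForm H.order
      exact ⟨M, p, h1, h2, fun _ => h3⟩
    · obtain ⟨M, p, h1, h2⟩ := H.analytic.exists_hasInitialForm H.order
      exact ⟨M, p, h1, h2, fun h => absurd h hs⟩
  -- If M < d, the order drops at finite slopes. In the vertical direction it is at most M + 1 ≤ d
  -- and the old exceptional curve supplies a smooth factor; if h already had one, the degree of p
  -- lowers the order further.
  rcases (hp.le_regOrder H.order).1.lt_or_eq with hMd | rfl
  · refine H.exists_of_initialForm hp0 hp (fun c h' _ _ R => ?_) fun h' e he hs R => ?_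
    · refine IH _ _ _ R (Or.inl ?_)
      have := (rootMultiplicity_le_natDegree (p := p) c).trans hp.1
      omega
    · refine IH _ _ _ R (Or.inr ⟨?_, hs⟩)
      rcases hn with hn | ⟨hn, hs'⟩
      · omega
      · have := hD hs'
        omega
  -- the initial form has degree `M = d`
  obtain ⟨h₀, hh₀, hM₀, -, -⟩ := hp.exists_some hp0 0
  have hVb : AnalyticAt ℂ (fun w => V (blowMap (some 0) w)) 0 :=
    hV.comp_of_eq (analyticAt_blowMap _ _) (blowMap_zero _)
  have hVb0 : V (blowMap (some 0) 0) ≠ 0 := by simpa using hV0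
  have tb := tendsto_blowMap (some 0)
  -- At slope 0 the pullback of h is divisible by x ^ M. Dividing by the unit and comparing
  -- coefficients of y shows that x ^ M divides c k x * x ^ k, so c k is divisible by x ^ (M - k).
  have hpeel := exists_coeff_eq_pow_mul (d := M) M (b := fun k x => c k x * x ^ k)
    (g := fun w => h₀ w * (V (blowMap (some 0) w))⁻¹ - w.2 ^ M)
    (fun k hk => (hc k hk).mul (analyticAt_id.pow k))
    ((hh₀.mul (hVb.inv hVb0)).sub (analyticAt_snd.pow M)) (by
      filter_upwards [hM₀, tb.eventually hh, hVb.continuousAt.eventually_ne hVb0] with w k1 k2 k3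
      rw [k2] at k1
      rw [mul_sub, ← mul_assoc, ← k1, mul_assoc, mul_inv_cancel₀ k3, mul_one, weierstrassPoly]
      simp only [_root_.blowMap_some, add_zero]
      rw [mul_pow, add_sub_cancel_left]
      exact Finset.sum_congr rfl fun k _ => by ring)
  choose! r hr hrc using hpeel
  have hcr : ∀ k < M, ∀ᶠ x in 𝓝 (0 : ℂ), c k x = x ^ (M - k) * r k x := by
    intro k hk
    refine eventually_eq_of_pow_mul_eq_one_var (k := k) (hc k hk)
      ((analyticAt_id.pow _).mul (hr k hk)) ?_
    filter_upwards [hrc k hk] with x hx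
    rw [mul_comm, hx, ← mul_assoc, ← pow_add, Nat.add_sub_cancel' hk.le]
  have hcr' : ∀ᶠ x in 𝓝 (0 : ℂ), ∀ k ∈ Finset.range M, c k x = x ^ (M - k) * r k x :=
    (Filter.eventually_all_finset _).mpr fun k hk => hcr k (Finset.mem_range.mp hk)
  have tfst : Filter.Tendsto (Prod.fst : ℂ × ℂ → ℂ) (𝓝 0) (𝓝 0) := continuous_fst.tendsto' _ _ rfl
  have hrd : ∀ᶠ x in 𝓝 (0 : ℂ), r (M - 1) x = 0 := by
    refine eventually_eq_of_pow_mul_eq_one_var (k := M - (M - 1)) (hr _ (by omega))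
      analyticAt_const ?_
    filter_upwards [hcd, hcr (M - 1) (by omega)] with x k1 k2
    rw [← k2, k1, mul_zero]
  -- As a homogeneous sum, h has an initial form `q` whose coefficients can be read off: `V 0` in
  -- degree M and 0 in degree M - 1. The form `p` served only to find M and the division at slope 0.
  let ρ : ℕ → ℂ × ℂ → ℂ := fun k z => if k < M then r k z.1 * V z else V z
  have hρ : ∀ k, AnalyticAt ℂ (ρ k) 0 := by
    intro k
    by_cases hk : k < M
    · simp only [ρ, if_pos hk]
      exact ((hr k hk).comp_of_eq analyticAt_fst rfl).mul hV
    · simpa only [ρ, if_neg hk] using hV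
  have hhρ : ∀ᶠ z in 𝓝 (0 : ℂ × ℂ), homogeneousSum M ρ z = h z := by
    filter_upwards [hh, tfst.eventually hcr'] with z k1 k2
    rw [k1, homogeneousSum, Finset.sum_range_succ, weierstrassPoly, add_mul, add_comm,
      Finset.sum_mul]
    congr 1
    · simp [ρ]
    · refine Finset.sum_congr rfl fun k hk => ?_
      rw [k2 k hk]
      simp only [ρ, if_pos (Finset.mem_range.mp hk)]
      ring
  set q : Polynomial ℂ := ∑ k ∈ Finset.range (M + 1), Polynomial.monomial k (ρ k 0) with hq
  have hqf : HasInitialForm h M q := (hasInitialForm_homogeneousSum hρ).congr hhρ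
  have hqc : ∀ k ≤ M, q.coeff k = ρ k 0 := by
    intro k hk
    rw [hq, Polynomial.finsetSum_coeff, Finset.sum_eq_single_of_mem k (by simpa using hk)]
    · simp
    · intro l _ hlk
      simp [Polynomial.coeff_monomial, hlk]
  have hqM : q.coeff M = V 0 := by rw [hqc M le_rfl]; simp [ρ]
  have hq0 : q ≠ 0 := fun h => hV0 (by rw [← hqM, h, Polynomial.coeff_zero])
  have hqd : q.natDegree = M :=
    le_antisymm hqf.1 (Polynomial.le_natDegree_of_ne_zero (by rwa [hqM]))
  refine H.exists_of_initialForm hq0 hqf (fun c₀ h' hh' hM' R => ?_) fun h' e he hs R => ?_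
  · rcases ((rootMultiplicity_le_natDegree (p := q) c₀).trans_eq hqd).lt_or_eq with hlt | heq
    · exact IH _ _ _ R (Or.inl (by omega))
    rw [heq] at R
    -- The order stays M only if q is a constant times (X - c₀) ^ M. Its coefficient in degree M - 1
    -- is a nonzero multiple of c₀ and vanishes.
    have hc0 : c₀ = 0 := by
      obtain ⟨s, hs⟩ := heq ▸ Polynomial.pow_rootMultiplicity_dvd q c₀
      have hs0 : s ≠ 0 := by rintro rfl; simp [hs] at hq0
      have hsd : s.natDegree = 0 := by
        have := congrArg Polynomial.natDegree hs
        rw [((Polynomial.monic_X_sub_C c₀).pow M).natDegree_mul' hs0, Polynomial.natDegree_pow,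
          Polynomial.natDegree_X_sub_C, hqd] at this
        omega
      rw [Polynomial.eq_C_of_natDegree_eq_zero hsd] at hs hs0
      have hs0' : s.coeff 0 ≠ 0 := fun h => hs0 (by rw [h, Polynomial.C_0])
      have h1 := hqc (M - 1) (by omega)
      have h2 : ρ (M - 1) 0 = 0 := by
        simp only [ρ, if_pos (show M - 1 < M by omega)]
        rw [show r (M - 1) (0 : ℂ × ℂ).1 = 0 from hrd.self_of_nhds, zero_mul]
      rw [h2, hs, Polynomial.coeff_mul_C, sub_eq_add_neg, ← Polynomial.C_neg,
        Polynomial.coeff_X_add_C_pow, mul_eq_zero, or_iff_left hs0', mul_eq_zero,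
        or_iff_left (by exact_mod_cast (Nat.choose_pos (by omega)).ne')] at h1
      simpa using (pow_eq_zero_iff (show M - (M - 1) ≠ 0 by omega)).mp h1
    subst hc0
    have hjm := le_of_pow_mul_eq (hr j hj).continuousAt hb.continuousAt hb0 (by
      filter_upwards [hcj, hcr j hj] with x k1 k2
      rw [← k1, k2])
    -- The strict transform is again in Weierstrass form without term of degree M - 1, with
    -- coefficients `r`. The exponent of the j-th one drops by M - j > 0, so this case cannot recur
    -- forever.
    refine ihm (m - (M - j)) (by omega) _ h' r (fun w => V (blowMap (some 0) w)) b R ?_ hr hVb hVb0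
      ?_ hrd hb hb0 ?_
    · exact hn.imp_right fun ⟨h1, h2⟩ => ⟨h1, h2.strictTransform H.order hh' hM' R.order⟩
    · refine eventually_eq_of_pow_mul_eq (M := M) hh'.eventually_continuousAt
        (AnalyticAt.eventually_continuousAt (AnalyticAt.mul ((analyticAt_snd.pow M).add
          (Finset.analyticAt_fun_sum _ fun k hk => AnalyticAt.mul
            ((hr k (Finset.mem_range.mp hk)).comp_of_eq analyticAt_fst rfl)
            (analyticAt_snd.pow k))) hVb)) ?_
      filter_upwards [hM', tb.eventually hh, tfst.eventually hcr'] with w k1 k2 k3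
      rw [← k1, k2, ← mul_assoc]
      congr 1
      simp only [weierstrassPoly, _root_.blowMap_some, add_zero, mul_add, Finset.mul_sum, mul_pow]
      congr 1
      refine Finset.sum_congr rfl fun k hk => ?_
      have hkM := Finset.mem_range.mp hk
      rw [k3 k hk, ← Nat.sub_add_cancel hkM.le, pow_add, Nat.sub_add_cancel hkM.le]
      ring
    · refine eventually_eq_of_pow_mul_eq_one_var (k := M - j) (hr j hj)
        ((analyticAt_id.pow _).mul hb) ?_
      filter_upwards [hcj, hcr j hj] with x k1 k2
      rw [← k2, k1, ← mul_assoc, ← pow_add, Nat.add_sub_cancel' hjm.1]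
  -- The initial form has full degree M, so no strict transform of h passes through the vertical
  -- direction: `e = 0`, and the new order is 1 < d.
  · exact IH _ _ _ R (Or.inr ⟨by omega, hs⟩)

/-- Germs of ideals that divide a power of `x * h`, where `h` has only real branches, can be
resolved by blowing up real points. -/
theorem exists_resolvable (n : ℕ) : ∀ (F : ι → ℂ × ℂ → ℂ) (h : ℂ × ℂ → ℂ) (d : ℕ),
    ResolutionData F h d → (2 * d ≤ n ∨ 2 * d ≤ n + 1 ∧ HasSmoothFactor h) →
      ∃ k, Resolvable F k := by
  -- The number n bounds the invariant: twice the order, less one if there is a smooth factor.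
  induction n with
  | zero =>
    intro F h d H hd
    obtain rfl : d = 0 := by omega
    exact H.exists_resolvable_of_order_zero
  | succ n IH =>
    intro F h d H hn
    cases d with
    | zero => exact H.exists_resolvable_of_order_zero
    | succ d =>
    obtain ⟨c, hc, hc0, ⟨V, hV, hV0, hh⟩, hreal⟩ := H.analytic.weierstrass_preparation H.order
    -- The Tschirnhausen shear. It is real because the Weierstrass coefficients of a real germ are
    -- real.
    let a : ℂ → ℂ := fun x => -(c d x) / (d + 1)
    have ha : AnalyticAt ℂ a 0 := (hc d).neg.div analyticAt_const (Nat.cast_add_one_ne_zero d)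
    have ha0 : a 0 = 0 := by simp [a, hc0 d (by omega)]
    have har : ∀ᶠ x in 𝓝 (0 : ℂ), a (star x) = star (a x) := by
      filter_upwards [hreal H.real d] with x hx
      simp only [a, hx]
      simp
    have hs : AnalyticAt ℂ (_root_.shear a) 0 := AnalyticAt.shear (z := 0) ha
    have hs0 := shear_apply_zero ha0
    have t : Filter.Tendsto (_root_.shear a) (𝓝 0) (𝓝 0) := by
      simpa [hs0] using hs.continuousAt.tendsto
    have Hs := H.shear ha ha0 har
    suffices ∃ k, Resolvable (fun i z => F i (_root_.shear a z)) k by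
      obtain ⟨k, hk⟩ := this
      exact ⟨k, hk.of_shear ha ha0 har⟩
    have hns : 2 * (d + 1) ≤ n + 1 ∨
        2 * (d + 1) ≤ n + 2 ∧ HasSmoothFactor fun z => h (_root_.shear a z) := by
      refine hn.imp_right fun ⟨h1, w, g, hw, hg, ⟨b, hb, hb0, hw1⟩, hwg⟩ => ⟨h1, ?_⟩
      exact ⟨fun z => w (_root_.shear a z), fun z => g (_root_.shear a z), hw.comp_of_eq hs hs0,
        hg.comp_of_eq hs hs0, ⟨b, hb, hb0, by simpa [_root_.shear, ha0] using hw1⟩,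
        t.eventually hwg⟩
    have hVs : AnalyticAt ℂ (fun z => V (_root_.shear a z)) 0 := hV.comp_of_eq hs hs0
    have hVs0 : V (_root_.shear a 0) ≠ 0 := by rwa [hs0]
    have hc' := analyticAt_shearCoeff (d := d + 1) hc ha
    have hhs : ∀ᶠ z in 𝓝 (0 : ℂ × ℂ), h (_root_.shear a z) =
        weierstrassPoly (d + 1) (shearCoeff (d + 1) c a) z * V (_root_.shear a z) := by
      filter_upwards [t.eventually hh] with z hz
      rw [hz, weierstrassPoly_shear]
    -- If all coefficients vanish, h is a power of y times a unit and the generators are monomials.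
    -- Otherwise a coefficient that is not identically zero drives the inner induction.
    by_cases hall : ∀ k ∈ Finset.range (d + 1), ∀ᶠ x in 𝓝 (0 : ℂ), shearCoeff (d + 1) c a k x = 0
    · have hmono : IsMonomialGerm (fun z => h (_root_.shear a z)) 0 (d + 1) := by
        refine ⟨_, hVs, hVs0, ?_⟩
        have tfst : Filter.Tendsto (Prod.fst : ℂ × ℂ → ℂ) (𝓝 0) (𝓝 0) :=
          continuous_fst.tendsto' _ _ rfl
        filter_upwards [hhs, tfst.eventually ((Filter.eventually_all_finset _).mpr hall)] with z k1 k2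
        rw [k1, weierstrassPoly, Finset.sum_eq_zero fun k hk => by rw [k2 k hk, zero_mul]]
        ring
      have h1 := Hs.divides.isMonomialGerm hmono
      choose p q hpq using h1
      exact Resolvable.exists_of_isMonomialGerm (fun i => (p i, q i)) fun i => (hpq i).2
    · obtain ⟨j, hj1⟩ := not_forall.mp hall
      obtain ⟨hj, hj1⟩ := Classical.not_imp.mp hj1
      obtain ⟨m, b, hb, hb0, hm⟩ := (hc' j).exists_eventuallyEq_pow_smul_nonzero_iff.mpr hj1
      refine exists_resolvable_of_weierstrass IH (Finset.mem_range.mp hj) m _ _ _ _ b Hs hns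
        (fun k _ => hc' k) hVs hVs0 hhs ?_ hb hb0 (by simpa using hm)
      refine Filter.Eventually.of_forall fun x => ?_
      rw [Nat.add_sub_cancel, shearCoeff_pred]
      have : (d + 1 : ℂ) ≠ 0 := Nat.cast_add_one_ne_zero d
      simp only [a]
      field_simp
      ring

end ResolutionData

/-! ### From real convergent series to a resolvable germ -/

theorem Resolvable.congr {ι : Type} {F G : ι → ℂ × ℂ → ℂ} {n : ℕ} (h : Resolvable F n)
    (hFG : ∀ i, ∀ᶠ z in 𝓝 (0 : ℂ × ℂ), F i z = G i z) : Resolvable G n := by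
  induction h generalizing G with
  | monomial h => exact .monomial (h.congr hFG)
  | blowup a ha ha0 hreal k hk h ih =>
    refine .blowup a ha ha0 hreal k hk fun c => ih c fun i => ?_
    have hs : AnalyticAt ℂ (shear a) 0 := AnalyticAt.shear (z := 0) ha
    have t : Filter.Tendsto (shear a) (𝓝 0) (𝓝 0) := by
      simpa [shear_apply_zero ha0] using hs.continuousAt.tendsto
    exact (t.comp (tendsto_blowMap c)).eventually (hFG i)

theorem ConvergentSeries.ne_zero_coeff_complexify {f : ConvergentSeries ℝ} {j : ℕ}
    (h : MvPowerSeries.coeff (monomialExp (0, j)) f.1 ≠ 0) :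
    ¬ ∀ᶠ y in 𝓝 (0 : ℂ), seriesEval (complexify f).1 (0, y) = 0 := by
  rw [ConvergentSeries.eventually_zero_left_iff]
  intro h0
  have := h0 j
  rw [coeff_complexify] at this
  exact h (by exact_mod_cast this)

theorem ConvergentSeries.eventually_seriesEval_X_pow (a : ℕ) :
    ∀ᶠ z in 𝓝 (0 : ℂ × ℂ), seriesEval (X ℂ ^ a).1 z = z.1 ^ a := by
  induction a with
  | zero => exact Filter.Eventually.of_forall fun z => by rw [pow_zero, pow_zero, seriesEval_one]
  | succ a ih =>
    filter_upwards [ih, eventually_seriesEval_mul (X ℂ ^ a) (X ℂ)] with z h1 h2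
    rw [pow_succ, pow_succ, h2, h1, seriesEval_X]

/-- The germs of the nonzero series of the family `g` can be resolved by blowing up real points. -/
theorem exists_resolvable_of_series {m : ℕ} (g : Fin m → ConvergentSeries ℝ)
    (hJ : Ideal.span (Set.range g) ≠ ⊥)
    (hirr : ∀ p : ConvergentSeries ℝ, Irreducible p → p ∣ ∏ i, g i →
      Irreducible (complexify p)) :
    ∃ n, Resolvable (fun (i : {i // g i ≠ 0}) z => seriesEval (complexify (g i)).1 z) n := by
  classical
  have hne : Nonempty {i // g i ≠ 0} := by
    by_contra h
    refine hJ (Ideal.span_eq_bot.mpr ?_)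
    rintro _ ⟨i, rfl⟩
    by_contra hi
    exact h ⟨i, hi⟩
  set S := Finset.univ.filter fun i => g i ≠ 0
  set P := ∏ i ∈ S, g i with hP
  have hP0 : P ≠ 0 := Finset.prod_ne_zero_iff.mpr fun i hi => (Finset.mem_filter.mp hi).2
  have hPdvd : P ∣ ∏ i, g i := Finset.prod_dvd_prod_of_subset _ _ _ (Finset.filter_subset _ _)
  -- Splitting off the power of x leaves a series that is regular in y. The power itself needs no
  -- place in h, as x is a factor of x * h.
  obtain ⟨a, f, hf, j, hj⟩ := ConvergentSeries.exists_eq_X_pow_mul hP0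
  have hf0 : f ≠ 0 := fun h => hP0 (by rw [hf, h, mul_zero])
  have hfP : f ∣ P := ⟨_, by rw [hf, mul_comm]⟩
  set h : ℂ × ℂ → ℂ := fun z => seriesEval (complexify f).1 z with hh
  have ha : AnalyticAt ℂ h 0 := ConvergentSeries.analyticAt_seriesEval _
  obtain ⟨d, hd⟩ := ha.exists_hasRegOrder (ConvergentSeries.ne_zero_coeff_complexify hj)
  refine ResolutionData.exists_resolvable (2 * d) _ h d ⟨ha, ?_, ?_, hd, fun i => ?_⟩ (Or.inl le_rfl)
  · exact Filter.Eventually.of_forall (ConvergentSeries.seriesEval_complexify_star f)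
  · exact ConvergentSeries.hasRealBranches_complexify hf0 fun p hp hpf =>
      hirr p hp ((hpf.trans hfP).trans hPdvd)
  · refine ⟨ConvergentSeries.analyticAt_seriesEval _, a + 1, ?_⟩
    obtain ⟨q, hq⟩ : g i ∣ P := Finset.dvd_prod_of_mem g (by simp [S, i.2])
    -- From g i * q = x ^ a * f, multiplication by x * f ^ a gives (x * f) ^ (a + 1).
    refine ⟨fun z => seriesEval (complexify q).1 z * (z.1 * h z ^ a),
      (ConvergentSeries.analyticAt_seriesEval _).mul (analyticAt_fst.mul (ha.pow a)), ?_⟩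
    have hX : ∀ᶠ z in 𝓝 (0 : ℂ × ℂ),
        seriesEval (ConvergentSeries.X ℂ ^ a).1 z = z.1 ^ a :=
      ConvergentSeries.eventually_seriesEval_X_pow a
    have e : complexify (g i) * complexify q = ConvergentSeries.X ℂ ^ a * complexify f := by
      rw [← map_mul, ← hq, hf, map_mul, map_pow, ConvergentSeries.complexify_X]
    filter_upwards [hX, ConvergentSeries.eventually_seriesEval_mul (complexify (g i)) (complexify q),
      ConvergentSeries.eventually_seriesEval_mul (ConvergentSeries.X ℂ ^ a) (complexify f)]
      with z h1 h2 h3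
    rw [← mul_assoc, ← h2, e, h3, h1]
    ring

/-! ### Affine coordinates on the projective line `Option ℂ` -/

/-- The point of the projective line with coordinate `v` in the chart centered at `c`. -/
def lineDir : Option ℂ → ℂ → Option ℂ
  | some c, v => some (v + c)
  | none, v => if v = 0 then none else some v⁻¹

/-- The chart of the projective line centered at `c`. -/
def lineCoord : Option ℂ → Option ℂ → ℂ
  | some c, some s => s - c
  | some _, none => 0
  | none, some s => s⁻¹
  | none, none => 0

/-- The domain of the chart of the projective line centered at `c`. -/
def lineDomain : Option ℂ → Set (Option ℂ)
  | some _ => {d | d ≠ none}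
  | none => {d | d ≠ some 0}

theorem mem_lineDomain_self (c : Option ℂ) : c ∈ lineDomain c := by
  cases c <;> simp [lineDomain]

theorem lineCoord_self (c : Option ℂ) : lineCoord c c = 0 := by
  cases c <;> simp [lineCoord]

theorem lineDir_mem (c : Option ℂ) (v : ℂ) : lineDir c v ∈ lineDomain c := by
  cases c with
  | some c => simp [lineDomain, lineDir]
  | none => by_cases hv : v = 0 <;> simp [lineDomain, lineDir, hv]

theorem lineCoord_lineDir (c : Option ℂ) (v : ℂ) : lineCoord c (lineDir c v) = v := by
  cases c with
  | some c => simp [lineCoord, lineDir]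
  | none => by_cases hv : v = 0 <;> simp [lineCoord, lineDir, hv]

theorem lineDir_lineCoord {c d : Option ℂ} (hd : d ∈ lineDomain c) :
    lineDir c (lineCoord c d) = d := by
  cases c <;> cases d <;> simp_all [lineCoord, lineDir, lineDomain]

theorem isOpen_lineDir_mem (c c' : Option ℂ) : IsOpen {v | lineDir c v ∈ lineDomain c'} := by
  cases c with
  | some c =>
    cases c' with
    | some c' => simp [lineDir, lineDomain]
    | none =>
      simpa [lineDir, lineDomain] using
        isOpen_ne_fun (continuous_id.add continuous_const) (continuous_const (y := (0 : ℂ)))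
  | none =>
    cases c' with
    | some c' =>
      have : {v | lineDir none v ∈ lineDomain (some c')} = {v : ℂ | v ≠ 0} := by
        ext v; by_cases hv : v = 0 <;> simp [lineDir, lineDomain, hv]
      rw [this]; exact isOpen_ne
    | none => simp only [lineDir_mem, Set.ofPred_true, isOpen_univ]

theorem analyticAt_lineCoord_lineDir {c c' : Option ℂ} {v : ℂ} (hv : lineDir c v ∈ lineDomain c') :
    AnalyticAt ℂ (fun w => lineCoord c' (lineDir c w)) v := by
  cases c with
  | some c =>
    cases c' with
    | some c' => exact (analyticAt_id.add analyticAt_const).sub analyticAt_const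
    | none =>
      refine (analyticAt_id.add analyticAt_const).inv fun h => hv ?_
      exact congrArg some h
  | none =>
    cases c' with
    | some c' =>
      have hv0 : v ≠ 0 := fun h => hv (by simp [lineDir, h])
      refine ((analyticAt_id.inv hv0).sub analyticAt_const).congr (f := fun w => w⁻¹ - c') ?_
      filter_upwards [isOpen_ne.mem_nhds hv0] with w hw
      simp [lineDir, lineCoord, hw]
    | none =>
      simp only [lineCoord_lineDir]
      exact analyticAt_id

theorem lineCoord_map_star (c d : Option ℂ) :
    lineCoord (c.map star) (d.map star) = star (lineCoord c d) := by
  cases c <;> cases d <;> simp [lineCoord]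

theorem map_star_mem_lineDomain {c d : Option ℂ} (h : d ∈ lineDomain c) :
    d.map star ∈ lineDomain (c.map star) := by
  cases c <;> cases d <;> simp_all [lineDomain]

/-- The projective line as a one-point compactification. -/
def lineOnePoint (d : Option ℂ) : OnePoint ℂ := d

theorem continuous_lineOnePoint_lineDir (c : Option ℂ) :
    Continuous fun v => lineOnePoint (lineDir c v) := by
  cases c with
  | some c => exact OnePoint.continuous_coe.comp (continuous_id.add continuous_const)
  | none =>
    have h0 : ∀ v : ℂ, v ≠ 0 → lineOnePoint (lineDir none v) = ((v⁻¹ : ℂ) : OnePoint ℂ) := by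
      intro v hv
      simp only [lineDir, if_neg hv]
      rfl
    refine continuous_iff_continuousAt.mpr fun v => ?_
    by_cases hv : v = 0
    · subst hv
      rw [← continuousWithinAt_compl_self]
      have h1 : lineOnePoint (lineDir none 0) = OnePoint.infty := by
        simp only [lineDir, if_pos]; rfl
      rw [ContinuousWithinAt, h1]
      have h2 : Filter.Tendsto (fun v : ℂ => ((v⁻¹ : ℂ) : OnePoint ℂ)) (𝓝[≠] 0)
          (𝓝 OnePoint.infty) := by
        refine OnePoint.tendsto_coe_infty.comp ?_
        have := Filter.tendsto_inv₀_nhdsNE_zero (α := ℂ)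
        rwa [Metric.cobounded_eq_cocompact, ← Filter.coclosedCompact_eq_cocompact] at this
      refine h2.congr' ?_
      filter_upwards [self_mem_nhdsWithin] with w hw
      exact (h0 w hw).symm
    · have : ContinuousAt (fun v : ℂ => ((v⁻¹ : ℂ) : OnePoint ℂ)) v :=
        OnePoint.continuous_coe.continuousAt.comp (continuousAt_inv₀ hv)
      refine this.congr ?_
      filter_upwards [isOpen_ne.mem_nhds hv] with w hw
      exact (h0 w hw).symm

theorem lineDomain_mem_nhds (c : Option ℂ) :
    {d : OnePoint ℂ | d ∈ lineDomain c} ∈ 𝓝 (lineOnePoint c) := by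
  cases c with
  | some c => exact (isOpen_ne (x := (OnePoint.infty : OnePoint ℂ))).mem_nhds (by exact Option.some_ne_none c)
  | none => exact (isOpen_ne (x := ((0 : ℂ) : OnePoint ℂ))).mem_nhds (by exact (Option.some_ne_none _).symm)

/-- Properness of the blow-up uses this: once directions converge in the compact projective line, so
do their coordinates in the chart at the limit. -/
theorem tendsto_lineCoord (c : Option ℂ) :
    Filter.Tendsto (fun d : OnePoint ℂ => lineCoord c d) (𝓝 (lineOnePoint c)) (𝓝 0) := by
  cases c with
  | some c =>
    have : ContinuousAt (fun d : OnePoint ℂ => lineCoord (some c) d) (c : OnePoint ℂ) := by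
      rw [OnePoint.continuousAt_coe]
      exact (continuous_id.sub continuous_const).continuousAt (f := fun s => s - c)
    rw [← lineCoord_self (some c)]
    exact this
  | none =>
    rw [← lineCoord_self none]
    change Filter.Tendsto (fun d : OnePoint ℂ => lineCoord none d) (𝓝 OnePoint.infty) _
    change ContinuousAt (fun d : OnePoint ℂ => lineCoord none d) OnePoint.infty
    rw [OnePoint.continuousAt_infty']
    rw [Filter.coclosedCompact_eq_cocompact, ← Metric.cobounded_eq_cocompact]
    have := Filter.tendsto_inv₀_cobounded (α := ℂ)
    exact this

/-- The coordinate on `ℂ²` that cuts out the exceptional curve in the chart of `blowMap c`. -/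
def blowCoord : Option ℂ → ℂ × ℂ → ℂ
  | some _, z => z.1
  | none, z => z.2

/-- The direction of a point of `ℂ²`. -/
def lineSlope (z : ℂ × ℂ) : Option ℂ := if z.1 = 0 then none else some (z.2 / z.1)

theorem analyticAt_blowCoord (c : Option ℂ) (z : ℂ × ℂ) : AnalyticAt ℂ (blowCoord c) z := by
  cases c with
  | some c => exact analyticAt_fst
  | none => exact analyticAt_snd

theorem blowCoord_zero (c : Option ℂ) : blowCoord c 0 = 0 := by
  cases c <;> rfl

theorem blowCoord_blowMap (c : Option ℂ) (w : ℂ × ℂ) : blowCoord c (blowMap c w) = w.1 := by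
  cases c <;> rfl

theorem blowCoord_star (c : Option ℂ) (z : ℂ × ℂ) :
    blowCoord (c.map star) (star z) = star (blowCoord c z) := by
  cases c <;> rfl

theorem blowMap_of_fst_eq_zero (c : Option ℂ) {w : ℂ × ℂ} (h : w.1 = 0) : blowMap c w = 0 := by
  cases c <;> ext <;> simp [blowMap, h]

theorem lineSlope_blowMap (c : Option ℂ) {w : ℂ × ℂ} (h : w.1 ≠ 0) :
    lineSlope (blowMap c w) = lineDir c w.2 := by
  cases c with
  | some c =>
    have : w.1 * (w.2 + c) / w.1 = w.2 + c := by field_simp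
    simp [lineSlope, blowMap, lineDir, h, this]
  | none =>
    by_cases h2 : w.2 = 0
    · simp [lineSlope, blowMap, lineDir, h2]
    · have : w.1 / (w.1 * w.2) = w.2⁻¹ := by field_simp
      simp [lineSlope, blowMap, lineDir, h, h2, this]

theorem lineSlope_mem_lineDomain {c : Option ℂ} {z : ℂ × ℂ} (hz : z ≠ 0) :
    lineSlope z ∈ lineDomain c ↔ z ∈ blowDomain c := by
  cases c with
  | some c => by_cases h : z.1 = 0 <;> simp [lineSlope, lineDomain, blowDomain, h]
  | none =>
    by_cases h : z.1 = 0
    · have : z.2 ≠ 0 := fun h2 => hz (Prod.ext h h2)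
      simp [lineSlope, lineDomain, blowDomain, h, this]
    · simp [lineSlope, lineDomain, blowDomain, h]

theorem blowInv_eq_lineCoord {c : Option ℂ} {z : ℂ × ℂ} (hz : z ∈ blowDomain c) :
    blowInv c z = (blowCoord c z, lineCoord c (lineSlope z)) := by
  cases c with
  | some c =>
    have h : z.1 ≠ 0 := hz
    simp [blowInv, blowCoord, lineCoord, lineSlope, h]
  | none =>
    by_cases h : z.1 = 0 <;> simp [blowInv, blowCoord, lineCoord, lineSlope, h]

theorem lineSlope_star (z : ℂ × ℂ) : lineSlope (star z) = (lineSlope z).map star := by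
  have h1 : (star z).1 = star z.1 := rfl
  have h2 : (star z).2 = star z.2 := rfl
  by_cases h : z.1 = 0
  · simp [lineSlope, h1, h]
  · simp [lineSlope, h1, h2, h]

/-! ### The blow-up of a real point of a complex surface -/

/-- A point of a surface and coordinates centered at it that are compatible with complex
conjugation. -/
structure BlowupCenter (Y : RealSurface) where
  point : Y
  chart : OpenPartialHomeomorph Y (ℂ × ℂ)
  chart_mem : chart ∈ IsManifold.maximalAtlas 𝓘(ℂ, ℂ × ℂ) ω Y
  point_mem : point ∈ chart.source
  chart_point : chart point = 0
  conj_mem : ∀ y ∈ chart.source, Y.conj y ∈ chart.source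
  chart_conj : ∀ y ∈ chart.source, chart (Y.conj y) = star (chart y)

namespace BlowupCenter

open scoped Classical in
/-- The direction in which a point lies, as seen from the center. -/
def slope {Y : RealSurface} (P : BlowupCenter Y) (y : Y) : Option ℂ :=
  -- The default direction `none` outside the chart is arbitrary, but being fixed by conjugation it
  -- keeps `slope_conj` true everywhere.
  if y ∈ P.chart.source then lineSlope (P.chart y) else none

/-- The points of the blow-up: the points of the surface with a direction, which for all but the
center is the one in which they lie. -/
def Carrier {Y : RealSurface} (P : BlowupCenter Y) : Type :=
  {b : Y × Option ℂ // b.1 = P.point ∨ b.2 = P.slope b.1}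

/-- The blow-up map. -/
def proj {Y : RealSurface} (P : BlowupCenter Y) (b : P.Carrier) : Y := b.1.1

/-- The direction of a point of the blow-up. -/
def dir {Y : RealSurface} (P : BlowupCenter Y) (b : P.Carrier) : Option ℂ := b.1.2

open scoped Classical in
/-- The point of the blow-up over `y`, with direction `d` if `y` is the center. -/
def pt {Y : RealSurface} (P : BlowupCenter Y) (y : Y) (d : Option ℂ) : P.Carrier :=
  ⟨(y, if y = P.point then d else P.slope y), by by_cases h : y = P.point <;> simp [h]⟩

theorem slope_of_mem {Y : RealSurface} (P : BlowupCenter Y) {y : Y} (hy : y ∈ P.chart.source) :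
    P.slope y = lineSlope (P.chart y) := if_pos hy

theorem proj_pt {Y : RealSurface} (P : BlowupCenter Y) (y : Y) (d : Option ℂ) :
    P.proj (P.pt y d) = y := rfl

theorem dir_pt_point {Y : RealSurface} (P : BlowupCenter Y) (d : Option ℂ) :
    P.dir (P.pt P.point d) = d := if_pos rfl

theorem dir_pt {Y : RealSurface} (P : BlowupCenter Y) {y : Y} (hy : y ≠ P.point) (d : Option ℂ) :
    P.dir (P.pt y d) = P.slope y := if_neg hy

theorem dir_eq {Y : RealSurface} (P : BlowupCenter Y) {b : P.Carrier} (hb : P.proj b ≠ P.point) :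
    P.dir b = P.slope (P.proj b) := b.2.resolve_left hb

theorem ext {Y : RealSurface} {P : BlowupCenter Y} {b b' : P.Carrier}
    (h1 : P.proj b = P.proj b') (h2 : P.dir b = P.dir b') : b = b' :=
  Subtype.ext (Prod.ext h1 h2)

theorem pt_proj_dir {Y : RealSurface} (P : BlowupCenter Y) (b : P.Carrier) :
    P.pt (P.proj b) (P.dir b) = b := by
  refine ext rfl ?_
  by_cases h : P.proj b = P.point
  · rw [h, dir_pt_point]
  · rw [P.dir_pt h, P.dir_eq h]

theorem pt_proj {Y : RealSurface} (P : BlowupCenter Y) {b : P.Carrier}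
    (hb : P.proj b ≠ P.point) (d : Option ℂ) : P.pt (P.proj b) d = b :=
  ext rfl (by rw [P.dir_pt hb, P.dir_eq hb])

theorem chart_eq_zero_iff {Y : RealSurface} (P : BlowupCenter Y) {y : Y}
    (hy : y ∈ P.chart.source) : P.chart y = 0 ↔ y = P.point := by
  rw [← P.chart_point]
  exact P.chart.injOn.eq_iff hy P.point_mem

theorem chart_symm_zero {Y : RealSurface} (P : BlowupCenter Y) : P.chart.symm 0 = P.point := by
  rw [← P.chart_point, P.chart.left_inv P.point_mem]

/-- The chart of the blow-up that a chart of the surface induces away from the center. -/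
def liftChart {Y : RealSurface} (P : BlowupCenter Y) (e : OpenPartialHomeomorph Y (ℂ × ℂ)) :
    PartialEquiv P.Carrier (ℂ × ℂ) where
  toFun b := e (P.proj b)
  invFun w := P.pt (e.symm w) none
  source := {b | P.proj b ∈ e.source ∧ P.proj b ≠ P.point}
  target := {w | w ∈ e.target ∧ e.symm w ≠ P.point}
  map_source' b hb := ⟨e.map_source hb.1, by rw [e.left_inv hb.1]; exact hb.2⟩
  map_target' w hw := ⟨e.map_target hw.1, hw.2⟩
  left_inv' b hb := by rw [e.left_inv hb.1, P.pt_proj hb.2]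
  right_inv' w hw := by rw [proj_pt, e.right_inv hw.1]

/-- The coordinates around the point of the exceptional curve with direction `c`. -/
def excCoord {Y : RealSurface} (P : BlowupCenter Y) (c : Option ℂ) (b : P.Carrier) : ℂ × ℂ :=
  (blowCoord c (P.chart (P.proj b)), lineCoord c (P.dir b))

theorem dir_pt_blowMap {Y : RealSurface} (P : BlowupCenter Y) {c : Option ℂ} {w : ℂ × ℂ}
    (hw : blowMap c w ∈ P.chart.target) :
    P.dir (P.pt (P.chart.symm (blowMap c w)) (lineDir c w.2)) = lineDir c w.2 := by
  by_cases h : P.chart.symm (blowMap c w) = P.point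
  · rw [h, dir_pt_point]
  · rw [P.dir_pt h, P.slope_of_mem (P.chart.map_target hw), P.chart.right_inv hw,
      lineSlope_blowMap]
    intro h0
    exact h (by rw [blowMap_of_fst_eq_zero c h0, P.chart_symm_zero])

theorem blowMap_excCoord {Y : RealSurface} (P : BlowupCenter Y) {c : Option ℂ} {b : P.Carrier}
    (hb : P.proj b ∈ P.chart.source) (hd : P.dir b ∈ lineDomain c) :
    blowMap c (P.excCoord c b) = P.chart (P.proj b) := by
  by_cases h : P.proj b = P.point
  · rw [h, P.chart_point, blowMap_of_fst_eq_zero]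
    simp only [excCoord, h, P.chart_point, blowCoord_zero]
  · have h0 : P.chart (P.proj b) ≠ 0 := fun h' => h ((P.chart_eq_zero_iff hb).mp h')
    rw [P.dir_eq h, P.slope_of_mem hb, lineSlope_mem_lineDomain h0] at hd
    rw [excCoord, P.dir_eq h, P.slope_of_mem hb, ← blowInv_eq_lineCoord hd, blowMap_blowInv hd]

/-- The chart around the point of the exceptional curve with direction `c`. -/
def excChart {Y : RealSurface} (P : BlowupCenter Y) (c : Option ℂ) :
    PartialEquiv P.Carrier (ℂ × ℂ) where
  toFun := P.excCoord c
  invFun w := P.pt (P.chart.symm (blowMap c w)) (lineDir c w.2)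
  source := {b | P.proj b ∈ P.chart.source ∧ P.dir b ∈ lineDomain c}
  target := {w | blowMap c w ∈ P.chart.target}
  map_source' b hb := by
    change blowMap c (P.excCoord c b) ∈ P.chart.target
    rw [P.blowMap_excCoord hb.1 hb.2]
    exact P.chart.map_source hb.1
  map_target' w hw := ⟨P.chart.map_target hw, by
    rw [P.dir_pt_blowMap hw]; exact lineDir_mem c w.2⟩
  left_inv' b hb := by
    rw [P.blowMap_excCoord hb.1 hb.2, P.chart.left_inv hb.1, excCoord, lineDir_lineCoord hb.2,
      P.pt_proj_dir]
  right_inv' w hw := by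
    rw [excCoord, P.dir_pt_blowMap hw, proj_pt, P.chart.right_inv hw, blowCoord_blowMap,
      lineCoord_lineDir]

/-- The charts of the blow-up. -/
def charts {Y : RealSurface} (P : BlowupCenter Y) : Set (PartialEquiv P.Carrier (ℂ × ℂ)) :=
  P.liftChart '' IsManifold.maximalAtlas 𝓘(ℂ, ℂ × ℂ) ω Y ∪ Set.range P.excChart

/-- The transition function between two charts is holomorphic on an open set. -/
def Compatible {M : Type} (e e' : PartialEquiv M (ℂ × ℂ)) : Prop :=
  IsOpen (e.symm.trans e').source ∧ ∀ w ∈ (e.symm.trans e').source, AnalyticAt ℂ (e.symm.trans e') w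

theorem analyticAt_transition {Y : RealSurface} {e e' : OpenPartialHomeomorph Y (ℂ × ℂ)}
    (he : e ∈ IsManifold.maximalAtlas 𝓘(ℂ, ℂ × ℂ) ω Y)
    (he' : e' ∈ IsManifold.maximalAtlas 𝓘(ℂ, ℂ × ℂ) ω Y) {w : ℂ × ℂ} (hw : w ∈ e.target)
    (hw' : e.symm w ∈ e'.source) : AnalyticAt ℂ (fun z => e' (e.symm z)) w :=
  analyticAt_of_mem_contDiffGroupoid (IsManifold.compatible_of_mem_maximalAtlas he he') ⟨hw, hw'⟩

theorem isOpen_symm_preimage {Y : RealSurface} (e : OpenPartialHomeomorph Y (ℂ × ℂ)) {s : Set Y}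
    (hs : IsOpen s) : IsOpen {w | w ∈ e.target ∧ e.symm w ∈ s} :=
  e.symm.continuousOn.isOpen_inter_preimage e.open_target hs

theorem liftChart_compatible_liftChart {Y : RealSurface} (P : BlowupCenter Y)
    {e e' : OpenPartialHomeomorph Y (ℂ × ℂ)}
    (he : e ∈ IsManifold.maximalAtlas 𝓘(ℂ, ℂ × ℂ) ω Y)
    (he' : e' ∈ IsManifold.maximalAtlas 𝓘(ℂ, ℂ × ℂ) ω Y) :
    Compatible (P.liftChart e) (P.liftChart e') := by
  have h : ((P.liftChart e).symm.trans (P.liftChart e')).source =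
      {w | w ∈ e.target ∧ e.symm w ∈ {P.point}ᶜ ∩ e'.source} := by
    ext w
    change (w ∈ e.target ∧ e.symm w ≠ P.point) ∧ (e.symm w ∈ e'.source ∧ e.symm w ≠ P.point) ↔
      w ∈ e.target ∧ (e.symm w ≠ P.point ∧ e.symm w ∈ e'.source)
    tauto
  refine ⟨?_, ?_⟩
  · rw [h]
    exact isOpen_symm_preimage e (isOpen_compl_singleton.inter e'.open_source)
  · rintro w ⟨hw, hw'⟩
    exact analyticAt_transition he he' hw.1 hw'.1

theorem liftChart_compatible_excChart {Y : RealSurface} (P : BlowupCenter Y)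
    {e : OpenPartialHomeomorph Y (ℂ × ℂ)}
    (he : e ∈ IsManifold.maximalAtlas 𝓘(ℂ, ℂ × ℂ) ω Y) (c : Option ℂ) :
    Compatible (P.liftChart e) (P.excChart c) := by
  have hmem : ∀ w, e.symm w ≠ P.point → e.symm w ∈ P.chart.source →
      (P.slope (e.symm w) ∈ lineDomain c ↔ P.chart (e.symm w) ∈ blowDomain c) := by
    intro w hw hw'
    rw [P.slope_of_mem hw', lineSlope_mem_lineDomain]
    rwa [Ne, P.chart_eq_zero_iff hw']
  have h : ((P.liftChart e).symm.trans (P.excChart c)).source =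
      {w | w ∈ e.target ∧ e.symm w ∈ {P.point}ᶜ ∩ (P.chart.source ∩ P.chart ⁻¹' blowDomain c)} := by
    ext w
    change (w ∈ e.target ∧ e.symm w ≠ P.point) ∧ (e.symm w ∈ P.chart.source ∧
      P.dir (P.pt (e.symm w) none) ∈ lineDomain c) ↔
      w ∈ e.target ∧ (e.symm w ≠ P.point ∧ e.symm w ∈ P.chart.source ∧
        P.chart (e.symm w) ∈ blowDomain c)
    constructor
    · rintro ⟨⟨h1, h2⟩, h3, h4⟩
      rw [P.dir_pt h2, hmem w h2 h3] at h4
      exact ⟨h1, h2, h3, h4⟩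
    · rintro ⟨h1, h2, h3, h4⟩
      refine ⟨⟨h1, h2⟩, h3, ?_⟩
      rwa [P.dir_pt h2, hmem w h2 h3]
  have ho : IsOpen ((P.liftChart e).symm.trans (P.excChart c)).source := by
    rw [h]
    exact isOpen_symm_preimage e (isOpen_compl_singleton.inter
      (P.chart.continuousOn.isOpen_inter_preimage P.chart.open_source (isOpen_blowDomain c)))
  refine ⟨ho, fun w hw => ?_⟩
  have hev := ho.mem_nhds hw
  rw [h] at hw hev
  obtain ⟨h1, -, h3, h4⟩ := hw
  refine AnalyticAt.congr (f := fun z => blowInv c (P.chart (e.symm z)))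
    ((analyticAt_blowInv h4).comp_of_eq (analyticAt_transition he P.chart_mem h1 h3) rfl) ?_
  filter_upwards [hev] with z hz
  obtain ⟨-, h2, h3, h4⟩ := hz
  change _ = P.excCoord c (P.pt (e.symm z) none)
  rw [excCoord, proj_pt, P.dir_pt h2, P.slope_of_mem h3]
  exact blowInv_eq_lineCoord h4

theorem excChart_compatible_liftChart {Y : RealSurface} (P : BlowupCenter Y)
    {e : OpenPartialHomeomorph Y (ℂ × ℂ)}
    (he : e ∈ IsManifold.maximalAtlas 𝓘(ℂ, ℂ × ℂ) ω Y) (c : Option ℂ) :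
    Compatible (P.excChart c) (P.liftChart e) := by
  refine ⟨?_, ?_⟩
  · exact (isOpen_symm_preimage P.chart
      (e.open_source.inter isOpen_compl_singleton)).preimage (continuous_blowMap c)
  · rintro w ⟨hw, hw'⟩
    exact (analyticAt_transition P.chart_mem he hw hw'.1).comp (analyticAt_blowMap c w)

theorem excChart_compatible_excChart {Y : RealSurface} (P : BlowupCenter Y) (c c' : Option ℂ) :
    Compatible (P.excChart c) (P.excChart c') := by
  have h : ((P.excChart c).symm.trans (P.excChart c')).source =
      blowMap c ⁻¹' P.chart.target ∩ Prod.snd ⁻¹' {v | lineDir c v ∈ lineDomain c'} := by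
    ext w
    change blowMap c w ∈ P.chart.target ∧ (P.chart.symm (blowMap c w) ∈ P.chart.source ∧
      P.dir (P.pt (P.chart.symm (blowMap c w)) (lineDir c w.2)) ∈ lineDomain c') ↔
      blowMap c w ∈ P.chart.target ∧ lineDir c w.2 ∈ lineDomain c'
    refine and_congr_right fun hw => ?_
    rw [P.dir_pt_blowMap hw, and_iff_right (P.chart.map_target hw)]
  have ho : IsOpen ((P.excChart c).symm.trans (P.excChart c')).source := by
    rw [h]
    exact (P.chart.open_target.preimage (continuous_blowMap c)).inter
      ((isOpen_lineDir_mem c c').preimage continuous_snd)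
  refine ⟨ho, fun w hw => ?_⟩
  have hev := ho.mem_nhds hw
  rw [h] at hw hev
  refine AnalyticAt.congr
    (f := fun z => (blowCoord c' (blowMap c z), lineCoord c' (lineDir c z.2)))
    (((analyticAt_blowCoord c' _).comp (analyticAt_blowMap c w)).prod
      ((analyticAt_lineCoord_lineDir hw.2).comp_of_eq analyticAt_snd rfl)) ?_
  filter_upwards [hev] with z hz
  change _ = P.excCoord c' (P.pt (P.chart.symm (blowMap c z)) (lineDir c z.2))
  rw [excCoord, proj_pt, P.dir_pt_blowMap hz.1, P.chart.right_inv hz.1]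

theorem charts_compatible {Y : RealSurface} (P : BlowupCenter Y)
    {e e' : PartialEquiv P.Carrier (ℂ × ℂ)} (he : e ∈ P.charts) (he' : e' ∈ P.charts) :
    Compatible e e' := by
  rcases he with ⟨e, he, rfl⟩ | ⟨c, rfl⟩ <;> rcases he' with ⟨e', he', rfl⟩ | ⟨c', rfl⟩
  · exact P.liftChart_compatible_liftChart he he'
  · exact P.liftChart_compatible_excChart he c'
  · exact P.excChart_compatible_liftChart he' c
  · exact P.excChart_compatible_excChart c c'

open scoped Classical in
/-- The charted space structure of the blow-up. -/
def core {Y : RealSurface} (P : BlowupCenter Y) : ChartedSpaceCore (ℂ × ℂ) P.Carrier where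
  atlas := P.charts
  chartAt b := if P.proj b = P.point then P.excChart (P.dir b)
    else P.liftChart (chartAt (ℂ × ℂ) (P.proj b))
  mem_chart_source b := by
    split_ifs with h
    · exact ⟨by rw [h]; exact P.point_mem, mem_lineDomain_self _⟩
    · exact ⟨mem_chart_source _ _, h⟩
  chart_mem_atlas b := by
    split_ifs with h
    · exact Or.inr ⟨_, rfl⟩
    · exact Or.inl ⟨_, IsManifold.chart_mem_maximalAtlas _, rfl⟩
  open_source _ _ he he' := (P.charts_compatible he he').1
  continuousOn_toFun _ _ he he' w hw :=
    ((P.charts_compatible he he').2 w hw).continuousAt.continuousWithinAt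

instance {Y : RealSurface} (P : BlowupCenter Y) : TopologicalSpace P.Carrier :=
  P.core.toTopologicalSpace

instance {Y : RealSurface} (P : BlowupCenter Y) : ChartedSpace (ℂ × ℂ) P.Carrier :=
  P.core.toChartedSpace

/-- A chart of the blow-up as a local homeomorphism. -/
def homeo {Y : RealSurface} (P : BlowupCenter Y) (e : PartialEquiv P.Carrier (ℂ × ℂ))
    (he : e ∈ P.charts) : OpenPartialHomeomorph P.Carrier (ℂ × ℂ) :=
  P.core.openPartialHomeomorph e he

instance {Y : RealSurface} (P : BlowupCenter Y) : IsManifold 𝓘(ℂ, ℂ × ℂ) ω P.Carrier where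
  compatible := by
    rintro _ _ ⟨_, ⟨e, rfl⟩, he⟩ ⟨_, ⟨e', rfl⟩, he'⟩
    simp only [Set.mem_iUnion, Set.mem_singleton_iff] at he he'
    obtain ⟨he, rfl⟩ := he
    obtain ⟨he', rfl⟩ := he'
    exact mem_contDiffGroupoid_of_analyticAt (P.charts_compatible he he').2
      (P.charts_compatible he' he).2

theorem homeo_mem {Y : RealSurface} (P : BlowupCenter Y) {e : PartialEquiv P.Carrier (ℂ × ℂ)}
    (he : e ∈ P.charts) : P.homeo e he ∈ IsManifold.maximalAtlas 𝓘(ℂ, ℂ × ℂ) ω P.Carrier := by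
  refine IsManifold.subset_maximalAtlas ?_
  change _ ∈ ⋃ _, _
  simp only [Set.mem_iUnion, Set.mem_singleton_iff]
  exact ⟨e, he, rfl⟩

end BlowupCenter

theorem trans_mem_maximalAtlas {X : Type} [TopologicalSpace X] [ChartedSpace (ℂ × ℂ) X]
    {e : OpenPartialHomeomorph X (ℂ × ℂ)} {f : OpenPartialHomeomorph (ℂ × ℂ) (ℂ × ℂ)}
    (he : e ∈ IsManifold.maximalAtlas 𝓘(ℂ, ℂ × ℂ) ω X) (hf : f ∈ contDiffGroupoid ω 𝓘(ℂ, ℂ × ℂ)) :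
    e.trans f ∈ IsManifold.maximalAtlas 𝓘(ℂ, ℂ × ℂ) ω X := by
  refine mem_maximalAtlas_iff.mpr fun e' he' => ?_
  have h := mem_maximalAtlas_iff.mp he e' he'
  constructor
  · rw [OpenPartialHomeomorph.trans_symm_eq_symm_trans_symm, OpenPartialHomeomorph.trans_assoc]
    exact (contDiffGroupoid ω 𝓘(ℂ, ℂ × ℂ)).trans ((contDiffGroupoid ω 𝓘(ℂ, ℂ × ℂ)).symm hf) h.1
  · rw [← OpenPartialHomeomorph.trans_assoc]
    exact (contDiffGroupoid ω 𝓘(ℂ, ℂ × ℂ)).trans h.2 hf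

theorem AnalyticAt.contMDiffAt_prod {f : ℂ × ℂ → ℂ × ℂ} {z : ℂ × ℂ} (h : AnalyticAt ℂ f z) :
    ContMDiffAt 𝓘(ℂ, ℂ × ℂ) 𝓘(ℂ, ℂ × ℂ) ω f z :=
  contMDiffAt_iff_contDiffAt.mpr h.contDiffAt

/-! ### Topology, properness and real structure of the blow-up -/

namespace BlowupCenter

/-- The chart `liftChart` as a local homeomorphism. -/
def liftHomeo {Y : RealSurface} (P : BlowupCenter Y) {e : OpenPartialHomeomorph Y (ℂ × ℂ)}
    (he : e ∈ IsManifold.maximalAtlas 𝓘(ℂ, ℂ × ℂ) ω Y) :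
    OpenPartialHomeomorph P.Carrier (ℂ × ℂ) :=
  P.homeo (P.liftChart e) (Or.inl ⟨e, he, rfl⟩)

/-- The chart `excChart` as a local homeomorphism. -/
def excHomeo {Y : RealSurface} (P : BlowupCenter Y) (c : Option ℂ) :
    OpenPartialHomeomorph P.Carrier (ℂ × ℂ) :=
  P.homeo (P.excChart c) (Or.inr ⟨c, rfl⟩)

theorem liftHomeo_mem {Y : RealSurface} (P : BlowupCenter Y)
    {e : OpenPartialHomeomorph Y (ℂ × ℂ)} (he : e ∈ IsManifold.maximalAtlas 𝓘(ℂ, ℂ × ℂ) ω Y) :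
    P.liftHomeo he ∈ IsManifold.maximalAtlas 𝓘(ℂ, ℂ × ℂ) ω P.Carrier := P.homeo_mem _

theorem excHomeo_mem {Y : RealSurface} (P : BlowupCenter Y) (c : Option ℂ) :
    P.excHomeo c ∈ IsManifold.maximalAtlas 𝓘(ℂ, ℂ × ℂ) ω P.Carrier := P.homeo_mem _

theorem mem_excHomeo_source {Y : RealSurface} (P : BlowupCenter Y) {b : P.Carrier}
    (hb : P.proj b ∈ P.chart.source) : b ∈ (P.excHomeo (P.dir b)).source :=
  ⟨hb, mem_lineDomain_self _⟩

theorem excCoord_pt_point {Y : RealSurface} (P : BlowupCenter Y) (c : Option ℂ) :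
    P.excCoord c (P.pt P.point c) = 0 := by
  rw [excCoord, P.dir_pt_point, proj_pt, P.chart_point, blowCoord_zero, lineCoord_self]
  rfl

theorem coe_chartAt_of_eq {Y : RealSurface} (P : BlowupCenter Y) {b : P.Carrier}
    (hb : P.proj b = P.point) :
    (chartAt (ℂ × ℂ) b : P.Carrier → ℂ × ℂ) = P.excCoord (P.dir b) := by
  classical
  have h : P.core.chartAt b = P.excChart (P.dir b) := if_pos hb
  change (P.core.chartAt b : P.Carrier → ℂ × ℂ) = _
  rw [h]
  rfl

theorem chartAt_source_of_eq {Y : RealSurface} (P : BlowupCenter Y) {b : P.Carrier}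
    (hb : P.proj b = P.point) :
    (chartAt (ℂ × ℂ) b).source = (P.excHomeo (P.dir b)).source := by
  classical
  have h : P.core.chartAt b = P.excChart (P.dir b) := if_pos hb
  change (P.core.chartAt b).source = _
  rw [h]
  rfl

theorem coe_chartAt_of_ne {Y : RealSurface} (P : BlowupCenter Y) {b : P.Carrier}
    (hb : P.proj b ≠ P.point) :
    (chartAt (ℂ × ℂ) b : P.Carrier → ℂ × ℂ) = fun z => chartAt (ℂ × ℂ) (P.proj b) (P.proj z) := by
  classical
  have h : P.core.chartAt b = P.liftChart (chartAt (ℂ × ℂ) (P.proj b)) := if_neg hb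
  change (P.core.chartAt b : P.Carrier → ℂ × ℂ) = _
  rw [h]
  rfl

theorem chartAt_source_of_ne {Y : RealSurface} (P : BlowupCenter Y) {b : P.Carrier}
    (hb : P.proj b ≠ P.point) :
    (chartAt (ℂ × ℂ) b).source =
      {z | P.proj z ∈ (chartAt (ℂ × ℂ) (P.proj b)).source ∧ P.proj z ≠ P.point} := by
  classical
  have h : P.core.chartAt b = P.liftChart (chartAt (ℂ × ℂ) (P.proj b)) := if_neg hb
  change (P.core.chartAt b).source = _
  rw [h]
  rfl

theorem contMDiff_proj {Y : RealSurface} (P : BlowupCenter Y) :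
    ContMDiff 𝓘(ℂ, ℂ × ℂ) 𝓘(ℂ, ℂ × ℂ) ω P.proj := by
  intro b
  by_cases hb : P.proj b = P.point
  · set c := P.dir b
    have hs : P.proj b ∈ P.chart.source := by rw [hb]; exact P.point_mem
    have hbs := P.mem_excHomeo_source hs
    have h1 : ContMDiffAt 𝓘(ℂ, ℂ × ℂ) 𝓘(ℂ, ℂ × ℂ) ω (P.excHomeo c) b :=
      contMDiffAt_of_mem_maximalAtlas (P.excHomeo_mem c) hbs
    have h2 : ContMDiffAt 𝓘(ℂ, ℂ × ℂ) 𝓘(ℂ, ℂ × ℂ) ω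
        (fun z => P.chart.symm (blowMap c (P.excHomeo c z))) b := by
      refine ContMDiffAt.comp (g := P.chart.symm) b ?_
        ((analyticAt_blowMap c _).contMDiffAt_prod.comp b h1)
      refine contMDiffAt_symm_of_mem_maximalAtlas P.chart_mem ?_
      change blowMap c (P.excCoord c b) ∈ _
      rw [P.blowMap_excCoord hs hbs.2]
      exact P.chart.map_source hs
    refine h2.congr_of_eventuallyEq ?_
    filter_upwards [(P.excHomeo c).open_source.mem_nhds hbs] with z hz
    change _ = P.chart.symm (blowMap c (P.excCoord c z))
    rw [P.blowMap_excCoord hz.1 hz.2, P.chart.left_inv hz.1]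
  · have he := IsManifold.chart_mem_maximalAtlas (I := 𝓘(ℂ, ℂ × ℂ)) (n := ω) (P.proj b)
    have hbs : b ∈ (P.liftHomeo he).source := ⟨mem_chart_source _ _, hb⟩
    have h1 : ContMDiffAt 𝓘(ℂ, ℂ × ℂ) 𝓘(ℂ, ℂ × ℂ) ω (P.liftHomeo he) b :=
      contMDiffAt_of_mem_maximalAtlas (P.liftHomeo_mem he) hbs
    have h2 : ContMDiffAt 𝓘(ℂ, ℂ × ℂ) 𝓘(ℂ, ℂ × ℂ) ω
        (fun z => (chartAt (ℂ × ℂ) (P.proj b)).symm (P.liftHomeo he z)) b :=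
      (contMDiffAt_symm_of_mem_maximalAtlas he (OpenPartialHomeomorph.map_source _ hbs.1)).comp b h1
    refine h2.congr_of_eventuallyEq ?_
    filter_upwards [(P.liftHomeo he).open_source.mem_nhds hbs] with z hz
    exact (OpenPartialHomeomorph.left_inv _ hz.1).symm

theorem continuous_proj {Y : RealSurface} (P : BlowupCenter Y) : Continuous P.proj :=
  P.contMDiff_proj.continuous

theorem contMDiffAt_pt {Y : RealSurface} (P : BlowupCenter Y) {y : Y} (hy : y ≠ P.point) :
    ContMDiffAt 𝓘(ℂ, ℂ × ℂ) 𝓘(ℂ, ℂ × ℂ) ω (fun y => P.pt y none) y := by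
  have he := IsManifold.chart_mem_maximalAtlas (I := 𝓘(ℂ, ℂ × ℂ)) (n := ω) y
  have hys := mem_chart_source (ℂ × ℂ) y
  have hm : chartAt (ℂ × ℂ) y y ∈ (P.liftHomeo he).target := by
    refine ⟨OpenPartialHomeomorph.map_source _ hys, ?_⟩
    rwa [OpenPartialHomeomorph.left_inv _ hys]
  have h1 : ContMDiffAt 𝓘(ℂ, ℂ × ℂ) 𝓘(ℂ, ℂ × ℂ) ω
      (fun z => (P.liftHomeo he).symm (chartAt (ℂ × ℂ) y z)) y :=
    (contMDiffAt_symm_of_mem_maximalAtlas (P.liftHomeo_mem he) hm).comp y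
      (contMDiffAt_of_mem_maximalAtlas he hys)
  refine h1.congr_of_eventuallyEq ?_
  filter_upwards [(chartAt (ℂ × ℂ) y).open_source.mem_nhds hys] with z hz
  change _ = P.pt ((chartAt (ℂ × ℂ) y).symm (chartAt (ℂ × ℂ) y z)) none
  rw [OpenPartialHomeomorph.left_inv _ hz]

theorem isBiholomorphicOver_proj {Y : RealSurface} (P : BlowupCenter Y) :
    IsBiholomorphicOver P.proj {P.point}ᶜ :=
  ⟨fun y => P.pt y none, fun _ hy => (P.contMDiffAt_pt hy).contMDiffWithinAt, fun _ _ => rfl,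
    fun _ hb => P.pt_proj hb none⟩

theorem continuousAt_dir {Y : RealSurface} (P : BlowupCenter Y) {b : P.Carrier}
    (hb : P.proj b ∈ P.chart.source) : ContinuousAt (fun z => lineOnePoint (P.dir z)) b := by
  have hbs := P.mem_excHomeo_source hb
  have h : ContinuousAt (fun z => lineOnePoint (lineDir (P.dir b) (P.excHomeo (P.dir b) z).2)) b :=
    (continuous_lineOnePoint_lineDir _).continuousAt.comp
      (continuous_snd.continuousAt.comp ((P.excHomeo (P.dir b)).continuousAt hbs))
  refine h.congr ?_
  filter_upwards [(P.excHomeo (P.dir b)).open_source.mem_nhds hbs] with z hz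
  exact congrArg lineOnePoint (lineDir_lineCoord hz.2)

/-- Points with different images are separated below. Two points over the center have different
directions, and the direction is continuous near them with values in the Hausdorff projective line.
-/
instance {Y : RealSurface} (P : BlowupCenter Y) : T2Space P.Carrier := by
  refine t2Space_iff_disjoint_nhds.mpr fun b b' hbb => ?_
  by_cases h : P.proj b = P.proj b'
  · have hd : P.dir b ≠ P.dir b' := fun hd => hbb (ext h hd)
    have hb : P.proj b = P.point := by
      by_contra hb
      exact hd (by rw [P.dir_eq hb, P.dir_eq (h ▸ hb), h])
    have hm : P.proj b ∈ P.chart.source := by rw [hb]; exact P.point_mem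
    exact (P.continuousAt_dir hm).disjoint (disjoint_nhds_nhds.mpr hd)
      (P.continuousAt_dir (h ▸ hm))
  · exact P.continuous_proj.continuousAt.disjoint (disjoint_nhds_nhds.mpr h)
      P.continuous_proj.continuousAt

/-- Countably many charts suffice off the center, and the two charts at `none` and `some 0` cover
the exceptional curve. -/
instance {Y : RealSurface} (P : BlowupCenter Y) : SecondCountableTopology P.Carrier := by
  obtain ⟨t, hts, htc, htu⟩ := TopologicalSpace.countable_cover_nhdsWithin
    (f := fun y : Y => (chartAt (ℂ × ℂ) y).source) (s := {P.point}ᶜ)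
    fun y _ => mem_nhdsWithin_of_mem_nhds (chart_source_mem_nhds _ y)
  refine ChartedSpace.secondCountable_of_countable_cover (ℂ × ℂ)
    (s := (fun y => P.pt y none) '' t ∪ {P.pt P.point none, P.pt P.point (some 0)}) ?_
    ((htc.image _).union (Set.to_countable _))
  refine Set.eq_univ_of_forall fun b => Set.mem_iUnion₂.mpr ?_
  by_cases hb : P.proj b = P.point
  · have key : ∀ c : Option ℂ, P.dir b ∈ lineDomain c →
        b ∈ (chartAt (ℂ × ℂ) (P.pt P.point c)).source := by
      intro c hc
      rw [P.chartAt_source_of_eq rfl, P.dir_pt_point]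
      exact ⟨by rw [hb]; exact P.point_mem, hc⟩
    by_cases hd : P.dir b = none
    · exact ⟨_, Or.inr (Or.inl rfl), key none (by simp [hd, lineDomain])⟩
    · exact ⟨_, Or.inr (Or.inr rfl), key (some 0) hd⟩
  · obtain ⟨y, hy, hby⟩ := Set.mem_iUnion₂.mp (htu hb)
    refine ⟨_, Or.inl ⟨y, hy, rfl⟩, ?_⟩
    rw [P.chartAt_source_of_ne (b := P.pt y none) (hts hy)]
    exact ⟨hby, hb⟩

/-- An ultrafilter whose image converges to the center has a limit of directions by compactness of
the projective line, and converges in the chart at that limit. Over other points the inverse map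
`pt` is continuous. -/
theorem isProperMap_proj {Y : RealSurface} (P : BlowupCenter Y) : IsProperMap P.proj := by
  refine isProperMap_iff_ultrafilter.mpr ⟨P.continuous_proj, fun 𝒰 y hy => ?_⟩
  by_cases hyp : y = P.point
  · obtain ⟨c, hc⟩ : ∃ c : Option ℂ,
        Filter.Tendsto (fun b => lineOnePoint (P.dir b)) 𝒰 (𝓝 (lineOnePoint c)) := by
      obtain ⟨c, -, hc⟩ := isCompact_univ.ultrafilter_le_nhds
        (𝒰.map fun b => lineOnePoint (P.dir b)) (by simp)
      exact ⟨c, hc⟩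
    subst hyp
    refine ⟨P.pt P.point c, rfl, ?_⟩
    have hd : P.dir (P.pt P.point c) = c := P.dir_pt_point c
    have hs : P.pt P.point c ∈ (P.excHomeo c).source :=
      ⟨P.point_mem, by rw [hd]; exact mem_lineDomain_self c⟩
    have h0 : P.excHomeo c (P.pt P.point c) = 0 := P.excCoord_pt_point c
    have hev : ∀ᶠ b in (𝒰 : Filter P.Carrier), b ∈ (P.excHomeo c).source :=
      (hy.eventually (P.chart.open_source.mem_nhds P.point_mem)).and
        (hc.eventually (lineDomain_mem_nhds c))
    have hlim : Filter.Tendsto (P.excHomeo c) 𝒰 (𝓝 0) := by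
      refine Filter.Tendsto.prodMk_nhds (x := (0 : ℂ)) (y := (0 : ℂ)) ?_ ((tendsto_lineCoord c).comp hc)
      have h1 := (P.chart.continuousAt P.point_mem).tendsto.comp hy
      rw [P.chart_point] at h1
      have h2 := (analyticAt_blowCoord c 0).continuousAt.tendsto.comp h1
      rwa [blowCoord_zero] at h2
    have hsym := ((P.excHomeo c).continuousAt_symm ((P.excHomeo c).map_source hs)).tendsto
    rw [h0] at hsym
    have h2 := hsym.comp hlim
    rw [← h0, (P.excHomeo c).left_inv hs] at h2
    refine (Filter.tendsto_id'.mp (h2.congr' ?_))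
    filter_upwards [hev] with b hb
    exact (P.excHomeo c).left_inv hb
  · refine ⟨P.pt y none, rfl, ?_⟩
    have h2 : Filter.Tendsto (fun b => P.pt (P.proj b) none) 𝒰 (𝓝 (P.pt y none)) :=
      (P.contMDiffAt_pt hyp).continuousAt.tendsto.comp hy
    refine (Filter.tendsto_id'.mp (h2.congr' ?_))
    filter_upwards [hy.eventually (isOpen_ne.mem_nhds hyp)] with b hb
    exact P.pt_proj hb none

theorem conj_point {Y : RealSurface} (P : BlowupCenter Y) : Y.conj P.point = P.point := by
  rw [← P.chart_eq_zero_iff (P.conj_mem _ P.point_mem), P.chart_conj _ P.point_mem, P.chart_point,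
    star_zero]

theorem slope_conj {Y : RealSurface} (P : BlowupCenter Y) (y : Y) :
    P.slope (Y.conj y) = (P.slope y).map star := by
  by_cases hy : y ∈ P.chart.source
  · rw [P.slope_of_mem hy, P.slope_of_mem (P.conj_mem y hy), P.chart_conj y hy, lineSlope_star]
  · have hy' : Y.conj y ∉ P.chart.source := fun h => hy (by
      have := P.conj_mem _ h
      rwa [Y.conj_involutive y] at this)
    rw [slope, slope, if_neg hy, if_neg hy', Option.map_none]

/-- The conjugation on the blow-up. -/
def conj {Y : RealSurface} (P : BlowupCenter Y) (b : P.Carrier) : P.Carrier :=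
  ⟨(Y.conj (P.proj b), (P.dir b).map star), by
    rcases b.2 with h | h
    · left
      change Y.conj b.1.1 = _
      rw [h, P.conj_point]
    · right
      change b.1.2.map star = P.slope (Y.conj b.1.1)
      rw [h, P.slope_conj]⟩

theorem proj_conj {Y : RealSurface} (P : BlowupCenter Y) (b : P.Carrier) :
    P.proj (P.conj b) = Y.conj (P.proj b) := rfl

theorem dir_conj {Y : RealSurface} (P : BlowupCenter Y) (b : P.Carrier) :
    P.dir (P.conj b) = (P.dir b).map star := rfl

theorem conj_involutive {Y : RealSurface} (P : BlowupCenter Y) : Function.Involutive P.conj := by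
  intro b
  refine ext (Y.conj_involutive _) ?_
  rw [dir_conj, dir_conj]
  cases P.dir b <;> simp

theorem conj_eq_point_iff {Y : RealSurface} (P : BlowupCenter Y) {y : Y} :
    Y.conj y = P.point ↔ y = P.point := by
  rw [← P.conj_point, Y.conj_involutive.injective.eq_iff, P.conj_point]

theorem conj_mem_excHomeo_source {Y : RealSurface} (P : BlowupCenter Y) {c : Option ℂ}
    {b : P.Carrier} (hb : b ∈ (P.excHomeo c).source) :
    P.conj b ∈ (P.excHomeo (c.map star)).source :=
  ⟨P.conj_mem _ hb.1, map_star_mem_lineDomain hb.2⟩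

theorem excHomeo_conj {Y : RealSurface} (P : BlowupCenter Y) {c : Option ℂ}
    {b : P.Carrier} (hb : b ∈ (P.excHomeo c).source) :
    P.excHomeo (c.map star) (P.conj b) = star (P.excHomeo c b) := by
  change P.excCoord _ _ = star (P.excCoord c b)
  rw [excCoord, excCoord, proj_conj, dir_conj, P.chart_conj _ hb.1, blowCoord_star,
    lineCoord_map_star]
  rfl

theorem continuous_conj {Y : RealSurface} (P : BlowupCenter Y) : Continuous P.conj := by
  refine continuous_iff_continuousAt.mpr fun b => ?_
  by_cases hb : P.proj b = P.point
  · set c := P.dir b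
    have hs : b ∈ (P.excHomeo c).source := P.mem_excHomeo_source (by rw [hb]; exact P.point_mem)
    have hs' := P.conj_mem_excHomeo_source hs
    have h : ContinuousAt (fun z => (P.excHomeo (c.map star)).symm (star (P.excHomeo c z))) b := by
      refine ContinuousAt.comp ?_ (continuous_star.continuousAt.comp ((P.excHomeo c).continuousAt hs))
      refine (P.excHomeo (c.map star)).continuousAt_symm ?_
      rw [← P.excHomeo_conj hs]
      exact (P.excHomeo (c.map star)).map_source hs'
    refine h.congr ?_
    filter_upwards [(P.excHomeo c).open_source.mem_nhds hs] with z hz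
    rw [← P.excHomeo_conj hz, (P.excHomeo _).left_inv (P.conj_mem_excHomeo_source hz)]
  · have hb' : Y.conj (P.proj b) ≠ P.point := fun h => hb (P.conj_eq_point_iff.mp h)
    have h1 : ContinuousAt (fun z => Y.conj (P.proj z)) b :=
      (Y.conj_antiholomorphic.1.comp P.continuous_proj).continuousAt
    have h : ContinuousAt (fun z => P.pt (Y.conj (P.proj z)) none) b :=
      ContinuousAt.comp (f := fun z => Y.conj (P.proj z)) (g := fun y => P.pt y none)
        (P.contMDiffAt_pt hb').continuousAt h1
    refine h.congr ?_
    filter_upwards [h1.eventually (isOpen_ne.mem_nhds hb')] with z hz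
    exact P.pt_proj (b := P.conj z) hz none

theorem isAntiholomorphic_conj {Y : RealSurface} (P : BlowupCenter Y) :
    IsAntiholomorphic P.conj := by
  refine ⟨P.continuous_conj, fun b => ?_⟩
  by_cases hb : P.proj b = P.point
  · set c := P.dir b with hc
    have hs : b ∈ (P.excHomeo c).source := P.mem_excHomeo_source (by rw [hb]; exact P.point_mem)
    have hb' : P.proj (P.conj b) = P.point := P.conj_eq_point_iff.mpr hb
    rw [P.coe_chartAt_of_eq hb', P.dir_conj, ← hc]
    refine (contMDiffAt_of_mem_maximalAtlas (P.excHomeo_mem c) hs).congr_of_eventuallyEq ?_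
    filter_upwards [(P.excHomeo c).open_source.mem_nhds hs] with z hz
    change star (P.excHomeo (c.map star) (P.conj z)) = _
    rw [P.excHomeo_conj hz, star_star]
  · have hb' : P.proj (P.conj b) ≠ P.point := fun h => hb (P.conj_eq_point_iff.mp h)
    rw [P.coe_chartAt_of_ne hb']
    exact (Y.conj_antiholomorphic.2 (P.proj b)).comp b (P.contMDiff_proj b)

/-- The blow-up as a surface with a real structure. -/
def surface {Y : RealSurface} (P : BlowupCenter Y) : RealSurface where
  carrier := P.Carrier
  conj := P.conj
  conj_antiholomorphic := P.isAntiholomorphic_conj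
  conj_involutive := P.conj_involutive

/-- The swap of the two coordinates of `ℂ²`. -/
def swapHomeo : OpenPartialHomeomorph (ℂ × ℂ) (ℂ × ℂ) :=
  (Homeomorph.prodComm ℂ ℂ).toOpenPartialHomeomorph

theorem swapHomeo_mem : swapHomeo ∈ contDiffGroupoid ω 𝓘(ℂ, ℂ × ℂ) :=
  mem_contDiffGroupoid_of_analyticAt
    (fun z _ => (analyticAt_snd.prod analyticAt_fst : AnalyticAt ℂ (fun w : ℂ × ℂ => (w.2, w.1)) z))
    (fun z _ => (analyticAt_snd.prod analyticAt_fst : AnalyticAt ℂ (fun w : ℂ × ℂ => (w.2, w.1)) z))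

/-- The chart at `none` puts the exceptional coordinate in the first place, while the second
standard chart has it in the second; hence the swap. -/
theorem isBlowupAt_proj {Y : RealSurface} (P : BlowupCenter Y) :
    IsBlowupAt (Y := P.Carrier) P.proj P.point := by
  have hsw : ((P.excHomeo none).trans swapHomeo).source = (P.excHomeo none).source := by
    ext b
    simp [swapHomeo]
  refine ⟨P.contMDiff_proj, P.isBiholomorphicOver_proj, P.chart, P.chart_mem, P.point_mem,
    P.chart_point, P.excHomeo (some 0), P.excHomeo_mem _, (P.excHomeo none).trans swapHomeo,
    trans_mem_maximalAtlas (P.excHomeo_mem _) swapHomeo_mem, ?_, ?_, ?_, ?_, ?_, ?_, ?_⟩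
  · rw [hsw]
    ext b
    change (P.proj b ∈ P.chart.source ∧ P.dir b ≠ none) ∨
      (P.proj b ∈ P.chart.source ∧ P.dir b ≠ some 0) ↔ P.proj b ∈ P.chart.source
    have : P.dir b ≠ none ∨ P.dir b ≠ some 0 := by
      by_cases h : P.dir b = none
      · right; simp [h]
      · exact Or.inl h
    tauto
  · ext w
    change (w.1, w.1 * (w.2 + 0)) ∈ P.chart.target ↔ _
    rw [add_zero]
    rfl
  · ext w
    rw [OpenPartialHomeomorph.trans_target]
    change w ∈ Set.univ ∧ (w.2 * w.1, w.2) ∈ P.chart.target ↔ _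
    rw [mul_comm]
    simp
  · intro b hb
    rw [← P.blowMap_excCoord hb.1 hb.2]
    change (_, _ * (_ + 0)) = _
    rw [add_zero]
    rfl
  · intro b hb
    rw [hsw] at hb
    rw [← P.blowMap_excCoord hb.1 hb.2]
    change (_ * _, _) = (_ * _, _)
    rw [mul_comm]
    rfl
  · intro b hb
    rw [hsw]
    change (P.proj b ∈ P.chart.source ∧ P.dir b ≠ some 0) ↔ lineCoord (some 0) (P.dir b) ≠ 0
    have h1 := hb.1
    have h2 : P.dir b ≠ none := hb.2
    obtain ⟨s, hs⟩ := Option.ne_none_iff_exists'.mp h2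
    rw [and_iff_right h1, hs]
    simp [lineCoord]
  · rintro b ⟨hb, hb'⟩
    rw [hsw] at hb'
    have h2 : P.dir b ≠ none := hb.2
    obtain ⟨s, hs⟩ := Option.ne_none_iff_exists'.mp h2
    have e1 := P.blowMap_excCoord hb.1 hb.2
    change (lineCoord none (P.dir b), (P.chart (P.proj b)).2) =
      ((lineCoord (some 0) (P.dir b))⁻¹, (P.excCoord (some 0) b).1 * (P.excCoord (some 0) b).2)
    rw [← e1]
    change (_, _ * (_ + 0)) = _
    rw [add_zero, hs]
    simp [lineCoord]

end BlowupCenter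

/-! ### Towers of blow-ups -/

/-- The properties of a tower of blow-ups over `o` that are established along with it. -/
structure IsTowerMap {X : RealSurface} (o : X) (Y : RealSurface) (π : Y → X) : Prop where
  tower : IsRealBlowupTower o Y π
  holomorphic : ContMDiff 𝓘(ℂ, ℂ × ℂ) 𝓘(ℂ, ℂ × ℂ) ω π
  proper : IsProperMap π
  biholomorphic : IsBiholomorphicOver π {o}ᶜ
  frequently_ne : ∀ y, ∃ᶠ z in 𝓝 y, π z ≠ o

theorem RealSurface.frequently_ne (X : RealSurface) (o y : X) : ∃ᶠ z in 𝓝 y, z ≠ o := by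
  by_cases h : y = o
  · subst h
    set χ := chartAt (ℂ × ℂ) y
    have hy : y ∈ χ.source := mem_chart_source _ y
    have h1 : Filter.Tendsto χ.symm (𝓝 (χ y)) (𝓝 y) := by
      have := χ.continuousAt_symm (χ.map_source hy)
      rwa [ContinuousAt, χ.left_inv hy] at this
    refine h1.frequently (p := fun z => z ≠ y) ?_
    have h2 : ∃ᶠ w in 𝓝 (χ y), w ≠ χ y :=
      mem_closure_iff_frequently.mp (dense_compl_singleton (χ y) _)
    refine (h2.and_eventually (χ.open_target.mem_nhds (χ.map_source hy))).mono ?_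
    rintro w ⟨hw, hwt⟩ h0
    exact hw (by rw [← h0, χ.right_inv hwt])
  · exact (continuousAt_id.eventually_ne h).frequently

theorem IsTowerMap.refl {X : RealSurface} (o : X) : IsTowerMap o X id :=
  ⟨.refl, contMDiff_id, isProperMap_id, ⟨id, contMDiffOn_id, fun _ _ => rfl, fun _ _ => rfl⟩,
    fun y => X.frequently_ne o y⟩

/-- In its charts the exceptional curve is a line `w.1 = 0`, which has empty interior. -/
theorem BlowupCenter.frequently_proj_ne {Y : RealSurface} (P : BlowupCenter Y) (b : P.Carrier) :
    ∃ᶠ z in 𝓝 b, P.proj z ≠ P.point := by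
  by_cases hb : P.proj b = P.point
  · set c := P.dir b
    set H := P.excHomeo c
    have hs : b ∈ H.source := P.mem_excHomeo_source (by rw [hb]; exact P.point_mem)
    have h1 : Filter.Tendsto H.symm (𝓝 (H b)) (𝓝 b) := by
      have := H.continuousAt_symm (H.map_source hs)
      rwa [ContinuousAt, H.left_inv hs] at this
    refine h1.frequently (p := fun z => P.proj z ≠ P.point) ?_
    have h2 : ∃ᶠ x in 𝓝 (H b).1, x ≠ 0 :=
      mem_closure_iff_frequently.mp (dense_compl_singleton (0 : ℂ) _)
    have h3 : Filter.Tendsto (fun x => (x, (H b).2)) (𝓝 (H b).1) (𝓝 (H b)) :=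
      (continuous_id.prodMk continuous_const).tendsto (H b).1
    have h4 : ∃ᶠ w in 𝓝 (H b), w.1 ≠ 0 := h3.frequently (p := fun w => w.1 ≠ 0) h2
    refine (h4.and_eventually (H.open_target.mem_nhds (H.map_source hs))).mono ?_
    rintro w ⟨hw, hwt⟩ h0
    have hwt : blowMap c w ∈ P.chart.target := hwt
    have h0 : P.chart.symm (blowMap c w) = P.point := h0
    have h5 := P.chart.right_inv hwt
    rw [h0, P.chart_point] at h5
    rw [← blowCoord_blowMap c w, ← h5, blowCoord_zero] at hw
    exact hw rfl
  · exact (P.continuous_proj.continuousAt.eventually_ne hb).frequently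

theorem BlowupCenter.isTowerMap {X Y : RealSurface} {o : X} {π : Y → X} (P : BlowupCenter Y)
    (h : IsTowerMap o Y π) (ho : π P.point = o) : IsTowerMap o P.surface (π ∘ P.proj) where
  tower := .blowup (Z := P.surface) P.proj P.point h.tower P.conj_point ho P.isBlowupAt_proj
    P.proj_conj
  holomorphic := h.holomorphic.comp P.contMDiff_proj
  proper := h.proper.comp P.isProperMap_proj
  biholomorphic := by
    obtain ⟨s, hs, h1, h2⟩ := h.biholomorphic
    have hne : ∀ x ∈ ({o}ᶜ : Set X), s x ≠ P.point := by
      intro x hx h0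
      exact hx (by rw [Set.mem_singleton_iff, ← h1 x hx, h0, ho])
    refine ⟨fun x => P.pt (s x) none, fun x hx => ?_, fun x hx => h1 x hx, fun b hb => ?_⟩
    · exact (P.contMDiffAt_pt (hne x hx)).comp_contMDiffWithinAt x (hs x hx)
    · change P.pt (s (π (P.proj b))) none = b
      rw [h2 (P.proj b) hb]
      exact P.pt_proj (fun h0 => hb ((congrArg π h0).trans ho)) none
  frequently_ne b := by
    have key : ∀ z : P.Carrier, P.proj z ≠ P.point → ∃ᶠ w in 𝓝 z, π (P.proj w) ≠ o := by
      intro z hz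
      have h1 := (P.contMDiffAt_pt hz).continuousAt.tendsto
      rw [P.pt_proj hz] at h1
      exact h1.frequently (p := fun w => π (P.proj w) ≠ o) (h.frequently_ne (P.proj z))
    exact frequently_frequently_nhds.mp ((P.frequently_proj_ne b).mono key)

/-- Coordinates at a real point that are equivariant near it yield a center for a blow-up. -/
theorem exists_blowupCenter {Y : RealSurface} {φ : OpenPartialHomeomorph Y (ℂ × ℂ)} {p : Y}
    (hφ : φ ∈ IsManifold.maximalAtlas 𝓘(ℂ, ℂ × ℂ) ω Y) (hp : p ∈ φ.source) (h0 : φ p = 0)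
    (hc : Y.conj p = p) (hev : ∀ᶠ z in 𝓝 p, φ (Y.conj z) = star (φ z)) :
    ∃ P : BlowupCenter Y, P.point = p ∧ (P.chart.symm : ℂ × ℂ → Y) = φ.symm := by
  obtain ⟨s, hs, hso, hps⟩ := eventually_nhds_iff.mp hev
  have hcont := Y.conj_antiholomorphic.1
  set U := φ.source ∩ s
  have hU : IsOpen U := φ.open_source.inter hso
  -- Intersecting with the preimage under the involution makes the domain invariant, as a
  -- `BlowupCenter` demands.
  set V := U ∩ Y.conj ⁻¹' U
  have hV : IsOpen V := hU.inter (hU.preimage hcont)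
  have hsrc : (φ.restr V).source = V := by
    rw [OpenPartialHomeomorph.restr_source, hV.interior_eq]
    exact Set.inter_eq_right.mpr fun z hz => hz.1.1
  refine ⟨⟨p, φ.restr V, restr_mem_maximalAtlas _ hφ hV, ?_, h0, ?_, ?_⟩, rfl, rfl⟩
  · rw [hsrc]
    refine ⟨⟨hp, hps⟩, ?_⟩
    rw [Set.mem_preimage, hc]
    exact ⟨hp, hps⟩
  · rw [hsrc]
    intro y hy
    exact ⟨hy.2, by rw [Set.mem_preimage, Y.conj_involutive y]; exact hy.1⟩
  · rw [hsrc]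
    intro y hy
    exact hs y hy.1.2

/-- In suitable coordinates at `y`, the ideal generated by the `F i` can be resolved by `n`
blow-ups of real points; unless `n = 0` this point is real and lies over `o`. -/
def ResolvableAt {X Y : RealSurface} (o : X) (π : Y → X) {ι : Type} (F : ι → Y → ℂ) (y : Y)
    (n : ℕ) : Prop :=
  ∃ φ ∈ IsManifold.maximalAtlas 𝓘(ℂ, ℂ × ℂ) ω Y, y ∈ φ.source ∧ φ y = 0 ∧
    Resolvable (fun i w => F i (φ.symm w)) n ∧
    (n ≠ 0 → π y = o ∧ Y.conj y = y ∧ ∀ᶠ z in 𝓝 y, φ (Y.conj z) = star (φ z))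

theorem ResolvableAt.blowup_of_ne {X Y : RealSurface} {o : X} {π : Y → X} {ι : Type}
    {F : ι → Y → ℂ} {n : ℕ} (P : BlowupCenter Y) {b : P.Carrier} (hb : P.proj b ≠ P.point)
    (h : ResolvableAt o π F (P.proj b) n) :
    ResolvableAt (Y := P.surface) o (π ∘ P.proj) (fun i => F i ∘ P.proj) b n := by
  obtain ⟨φ, hφ, hy, h0, hres, hreal⟩ := h
  refine ⟨P.liftHomeo hφ, P.liftHomeo_mem hφ, ⟨hy, hb⟩, h0, hres, fun hn => ?_⟩
  obtain ⟨h1, h2, h3⟩ := hreal hn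
  refine ⟨h1, ?_, P.continuous_proj.continuousAt.eventually h3⟩
  have h4 : P.proj (P.conj b) = P.proj b := h2
  have h5 := P.pt_proj (b := P.conj b) (by rwa [h4]) none
  rw [h4, P.pt_proj hb] at h5
  exact h5.symm

/-- Blowing up a point at which the ideal is not yet monomial. -/
theorem ResolvableAt.exists_blowup {X Y : RealSurface} {o : X} {π : Y → X} {ι : Type}
    {F : ι → Y → ℂ} {n : ℕ} {p : Y} (hn : n ≠ 0) (h : ResolvableAt o π F p n) :
    ∃ (P : BlowupCenter Y) (k : Option ℂ →₀ ℕ), P.point = p ∧ π p = o ∧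
      k.sum (fun _ n => n) + 1 = n ∧ ∀ c, ResolvableAt (Y := P.surface) o (π ∘ P.proj)
        (fun i => F i ∘ P.proj) (P.pt P.point c) (k c) := by
  obtain ⟨φ, hφ, hy, h0, hres, hreal⟩ := h
  obtain ⟨h1, h2, h3⟩ := hreal hn
  generalize hG : (fun i w => F i (φ.symm w)) = G at hres
  cases hres with
  | monomial => exact absurd rfl hn
  | blowup a ha ha0 hareal k hk h =>
    subst hG
    obtain ⟨f, hf, hf0, hfa, hfs⟩ := exists_shearHomeo ha
    have hf1 : f 0 = 0 := by rw [hfa, shear_apply_zero ha0]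
    have hf2 : f.symm 0 = 0 := by
      have := f.left_inv hf0
      rwa [hf1] at this
    have hft : (0 : ℂ × ℂ) ∈ f.target := by
      have := f.map_source hf0
      rwa [hf1] at this
    have hlim : Filter.Tendsto φ (𝓝 p) (𝓝 0) := by
      have := φ.continuousAt hy
      rwa [ContinuousAt, h0] at this
    -- The blow-up takes place in the coordinates in which the shear has been undone. They remain
    -- compatible with conjugation because the shear is real.
    obtain ⟨P, hP, hPs⟩ := exists_blowupCenter (φ := φ.trans f.symm) (p := p)
      (trans_mem_maximalAtlas hφ ((contDiffGroupoid ω 𝓘(ℂ, ℂ × ℂ)).symm hf))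
      ⟨hy, by change φ p ∈ f.target; rwa [h0]⟩ (by simp [h0, hf2]) h2 (by
        have h4 : ∀ᶠ z in 𝓝 p, a (star (φ z).1) = star (a (φ z).1) :=
          ((continuous_fst.tendsto (0 : ℂ × ℂ)).comp hlim).eventually hareal
        filter_upwards [h3, h4] with z h5 h6
        simp only [OpenPartialHomeomorph.coe_trans, Function.comp, h5, hfs]
        refine Prod.ext rfl ?_
        change star (φ z).2 + -a (star (φ z).1) = star ((φ z).2 + -a (φ z).1)
        rw [h6, star_add, star_neg])
    refine ⟨P, k, hP, h1, rfl, fun c => ?_⟩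
    have hd : P.dir (P.pt P.point c) = c := P.dir_pt_point c
    have hs : P.pt P.point c ∈ (P.excHomeo c).source :=
      ⟨P.point_mem, by rw [hd]; exact mem_lineDomain_self c⟩
    refine ⟨P.excHomeo c, P.excHomeo_mem c, hs, P.excCoord_pt_point c, ?_, fun hkc => ?_⟩
    · have e : ∀ w, P.proj ((P.excHomeo c).symm w) = φ.symm (shear a (blowMap c w)) := by
        intro w
        change P.chart.symm (blowMap c w) = _
        rw [hPs, ← hfa]
        rfl
      have := h c
      simp only [← e] at this
      exact this
    · have hc := hk c hkc
      refine ⟨(congrArg π hP).trans h1, ?_, ?_⟩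
      · refine BlowupCenter.ext P.conj_point ?_
        change (P.dir (P.pt P.point c)).map star = P.dir (P.pt P.point c)
        rw [hd, hc]
      · filter_upwards [(P.excHomeo c).open_source.mem_nhds hs] with z hz
        have := P.excHomeo_conj hz
        rwa [hc] at this

/-- If the ideal can be resolved at all points, there is a tower of blow-ups after which it is
monomial at all points. -/
theorem exists_tower {X : RealSurface} {o : X} {ι : Type} (G : ι → X → ℂ) (N : ℕ) :
    ∀ {Y : RealSurface} {π : Y → X}, IsTowerMap o Y π → ∀ k : Y →₀ ℕ,
      k.sum (fun _ n => n) = N → (∀ y, ResolvableAt o π (fun i => G i ∘ π) y (k y)) →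
      ∃ (Z : RealSurface) (ρ : Z → X), IsTowerMap o Z ρ ∧
        ∀ z, ResolvableAt o ρ (fun i => G i ∘ ρ) z 0 := by
  classical
  induction N using Nat.strong_induction_on with
  | _ N ih =>
  intro Y π hπ k hN hk
  by_cases hk0 : k = 0
  · subst hk0
    exact ⟨Y, π, hπ, hk⟩
  obtain ⟨p, hp⟩ := Finsupp.ne_iff.mp hk0
  obtain ⟨P, k', rfl, ho, hsum, hres⟩ := (hk p).exists_blowup hp
  let f₁ : Y ↪ P.Carrier := ⟨fun y => P.pt y none, fun y y' h => congrArg P.proj h⟩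
  let f₂ : Option ℂ ↪ P.Carrier := ⟨fun c => P.pt P.point c, fun c c' h => by
    have := congrArg P.dir h
    rwa [P.dir_pt_point, P.dir_pt_point] at this⟩
  have h1 := Finsupp.add_sum_erase' k P.point (fun _ n => n) fun _ => rfl
  -- The blow-ups owed at the center are replaced by those owed on the exceptional curve, one fewer
  -- in total; those at other points are carried over. The embedding `f₁` also takes a value at the
  -- center, which is harmless since the count was erased there.
  set K : P.Carrier →₀ ℕ :=
    Finsupp.embDomain f₁ (k.erase P.point) + Finsupp.embDomain f₂ k' with hK
  have hKsum : K.sum (fun _ n => n) < N := by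
    rw [hK, Finsupp.sum_add_index' (fun _ => rfl) (fun _ _ _ => rfl), Finsupp.sum_embDomain,
      Finsupp.sum_embDomain]
    omega
  have hK1 : ∀ b : P.Carrier, P.proj b = P.point → K b = k' (P.dir b) := by
    intro b hb
    have e1 : Finsupp.embDomain f₁ (k.erase P.point) b = 0 := by
      rw [Finsupp.embDomain_apply]
      split_ifs with h
      · have h3 : h.choose = P.point := by
          have := congrArg P.proj h.choose_spec
          rwa [hb] at this
        rw [h3, Finsupp.erase_same]
      · rfl
    have e2 : f₂ (P.dir b) = b := by
      change P.pt P.point (P.dir b) = b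
      rw [← hb, P.pt_proj_dir]
    rw [hK, Finsupp.add_apply, e1, zero_add]
    nth_rewrite 1 [← e2]
    rw [Finsupp.embDomain_apply_self]
  have hK2 : ∀ b : P.Carrier, P.proj b ≠ P.point → K b = k (P.proj b) := by
    intro b hb
    have e1 : f₁ (P.proj b) = b := P.pt_proj hb none
    have e2 : Finsupp.embDomain f₂ k' b = 0 := by
      refine Finsupp.embDomain_of_notMem_range _ _ _ ?_
      rintro ⟨c, hc⟩
      exact hb (by rw [← hc]; rfl)
    rw [hK, Finsupp.add_apply, e2, add_zero]
    nth_rewrite 1 [← e1]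
    rw [Finsupp.embDomain_apply_self, Finsupp.erase_ne hb]
  have hcast : ∀ (b b' : P.surface) (n n' : ℕ), b = b' → n = n' →
      ResolvableAt o (fun z : P.surface => π (P.proj z)) (fun i z => G i (π (P.proj z))) b n →
      ResolvableAt o (fun z : P.surface => π (P.proj z)) (fun i z => G i (π (P.proj z))) b' n' := by
    rintro b _ n _ rfl rfl h
    exact h
  refine ih _ hKsum (P.isTowerMap hπ ho) K rfl fun b => ?_
  by_cases hb : P.proj b = P.point
  · refine hcast _ b _ _ ?_ (hK1 b hb).symm (hres (P.dir b))
    have := P.pt_proj_dir b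
    rwa [hb] at this
  · exact hcast b b _ _ rfl (hK2 b hb).symm ((hk (P.proj b)).blowup_of_ne P hb)

/-! ### Monomial stalks and ideals on the polydisc -/

theorem isMonomialAt_of_eventuallyEq {Y : Type} [TopologicalSpace Y] [ChartedSpace (ℂ × ℂ) Y]
    [IsManifold 𝓘(ℂ, ℂ × ℂ) ω Y] {ι : Type} {F : ι → Y → ℂ} {y : Y}
    {φ : OpenPartialHomeomorph Y (ℂ × ℂ)} (hφ : φ ∈ IsManifold.maximalAtlas 𝓘(ℂ, ℂ × ℂ) ω Y)
    (hy : y ∈ φ.source) (h0 : φ y = 0) (a b : ℕ) {c : ι → Y → ℂ}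
    (hc : ∀ i, ContMDiffAt 𝓘(ℂ, ℂ × ℂ) 𝓘(ℂ, ℂ) ω (c i) y) (hne : ∃ i, c i y ≠ 0)
    (hF : ∀ i, ∀ᶠ z in 𝓝 y, F i z = c i z * ((φ z).1 ^ a * (φ z).2 ^ b)) : IsMonomialAt F y := by
  refine ⟨φ, hφ, hy, h0, a, b, ?_⟩
  set M : Y → ℂ := fun z => (φ z).1 ^ a * (φ z).2 ^ b
  have hM : ContMDiffAt 𝓘(ℂ, ℂ × ℂ) 𝓘(ℂ, ℂ) ω M y := by
    have h1 : ContDiffAt ℂ ω (fun w : ℂ × ℂ => w.1 ^ a * w.2 ^ b) (φ y) :=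
      ((contDiff_fst.pow a).mul (contDiff_snd.pow b)).contDiffAt
    exact ContMDiffAt.comp (g := fun w : ℂ × ℂ => w.1 ^ a * w.2 ^ b) y h1.contMDiffAt
      (contMDiffAt_of_mem_maximalAtlas hφ hy)
  -- Each generator is a multiple of the monomial, and the one with a unit coefficient can be solved
  -- for the monomial.
  refine le_antisymm (Ideal.span_le.mpr ?_) (Ideal.span_le.mpr ?_)
  · rintro h ⟨i, hi⟩
    have e : h = ⟨(c i : (𝓝 y).Germ ℂ), c i, hc i, rfl⟩ * ⟨(M : (𝓝 y).Germ ℂ), M, hM, rfl⟩ := by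
      refine Subtype.ext (hi.trans ?_)
      exact Filter.Germ.coe_eq.mpr (hF i)
    rw [SetLike.mem_coe, e]
    exact Ideal.mul_mem_left _ _ (Ideal.subset_span ⟨(), rfl⟩)
  · rintro h ⟨⟨⟩, hi⟩
    obtain ⟨i, hci⟩ := hne
    have hinv : ContMDiffAt 𝓘(ℂ, ℂ × ℂ) 𝓘(ℂ, ℂ) ω (fun z => (c i z)⁻¹) y :=
      ContMDiffAt.comp (g := fun w : ℂ => w⁻¹) y (contDiffAt_inv ℂ hci).contMDiffAt (hc i)
    have hFi : ContMDiffAt 𝓘(ℂ, ℂ × ℂ) 𝓘(ℂ, ℂ) ω (F i) y :=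
      ((hc i).smul hM).congr_of_eventuallyEq (hF i)
    have e : h = ⟨((fun z => (c i z)⁻¹ : Y → ℂ) : (𝓝 y).Germ ℂ), _, hinv, rfl⟩ *
        ⟨(F i : (𝓝 y).Germ ℂ), F i, hFi, rfl⟩ := by
      refine Subtype.ext (hi.trans ?_)
      refine Filter.Germ.coe_eq.mpr ?_
      filter_upwards [hF i, (hc i).continuousAt.eventually_ne hci] with z h1 h2
      rw [h1, inv_mul_cancel_left₀ h2]
    rw [SetLike.mem_coe, e]
    exact Ideal.mul_mem_left _ _ (Ideal.subset_span ⟨i, rfl⟩)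

/-- An ideal that is resolved by no blow-ups is monomial; adding zeros to its generators does not
change this. -/
theorem ResolvableAt.isMonomialAt {X Y : RealSurface} {o : X} {π : Y → X} {ι : Type} {p : ι → Prop}
    {F : ι → Y → ℂ} {y : Y} (h : ResolvableAt o π (fun i : {i // p i} => F i) y 0)
    (hF : ∀ i, ¬ p i → ∀ z, F i z = 0) : IsMonomialAt F y := by
  classical
  obtain ⟨φ, hφ, hy, h0, hres, -⟩ := h
  have hmono : MonoAt (fun (i : {i // p i}) w => F i (φ.symm w)) 0 := by
    generalize hn : (0 : ℕ) = n at hres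
    cases hres with
    | monomial h => exact h
    | blowup => omega
  obtain ⟨e, he, h0e, he0, a, b, c, hc, ⟨⟨i, hi⟩, hne⟩, hev⟩ := hmono
  have he1 : e (φ y) = 0 := by rw [h0, he0]
  rw [← h0] at hc hne hev h0e
  refine isMonomialAt_of_eventuallyEq (trans_mem_maximalAtlas hφ he) ⟨hy, h0e⟩ he1 a b
    (c := fun i z => if h : p i then c ⟨i, h⟩ (φ z) else 0) (fun i => ?_) ⟨i, ?_⟩ fun i => ?_
  · by_cases h : p i
    · simp only [dif_pos h]
      exact ContMDiffAt.comp (g := c ⟨i, h⟩) y (hc ⟨i, h⟩).contDiffAt.contMDiffAt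
        (contMDiffAt_of_mem_maximalAtlas hφ hy)
    · simp only [dif_neg h]
      exact contMDiffAt_const
  · simpa only [dif_pos hi] using hne
  · by_cases h : p i
    · filter_upwards [(φ.continuousAt hy).eventually (hev ⟨i, h⟩), φ.open_source.mem_nhds hy]
        with z h1 h2
      rw [φ.left_inv h2] at h1
      rw [h1, dif_pos h]
      rfl
    · exact Filter.Eventually.of_forall fun z => by rw [hF i h, dif_neg h, zero_mul]

theorem polydisc_chart_symm {r : ℝ} (y : polydiscOpens r) {w : ℂ × ℂ}
    (hw : w ∈ (chartAt (ℂ × ℂ) y).target) : ((chartAt (ℂ × ℂ) y).symm w : ℂ × ℂ) = w :=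
  (chartAt (ℂ × ℂ) y).right_inv hw

/-- Resolvability of an ideal at a point of the polydisc. -/
theorem resolvableAt_polydisc {r : ℝ} {o y : polydisc r} {ι : Type} {F : ι → ℂ × ℂ → ℂ} {n : ℕ}
    (h : Resolvable (fun i w => F i (w + (show polydiscOpens r from y).1)) n)
    (hn : n ≠ 0 → y = o ∧ (show polydiscOpens r from y).1 = 0) :
    ResolvableAt o id (fun i (z : polydiscOpens r) => F i z.1) y n := by
  set q : ℂ × ℂ := (show polydiscOpens r from y).1
  set χ := chartAt (ℂ × ℂ) y
  have hy : y ∈ χ.source := mem_chart_source _ y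
  have hχ : χ ∈ IsManifold.maximalAtlas 𝓘(ℂ, ℂ × ℂ) ω (polydisc r) :=
    IsManifold.chart_mem_maximalAtlas y
  refine ⟨χ.trans (translationHomeo q), trans_mem_maximalAtlas hχ (translationHomeo_mem q),
    ⟨hy, Set.mem_univ _⟩, ?_, h.congr fun i => ?_, fun h0 => ⟨(hn h0).1, ?_, ?_⟩⟩
  · change translationHomeo q q = 0
    rw [translationHomeo_apply, sub_self]
  · have h1 : Filter.Tendsto (fun w : ℂ × ℂ => w + q) (𝓝 0) (𝓝 q) := by
      have h2 : Continuous fun w : ℂ × ℂ => w + q := continuous_id.add continuous_const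
      simpa only [zero_add] using h2.tendsto 0
    have h2 : χ.target ∈ 𝓝 q := χ.open_target.mem_nhds (χ.map_source hy)
    filter_upwards [h1.eventually h2] with w hw
    have e : ((translationHomeo q).symm w : ℂ × ℂ) = w + q := by
      change w + - -q = w + q
      rw [neg_neg]
    change F i (w + q) = F i (show polydiscOpens r from χ.symm ((translationHomeo q).symm w)).1
    rw [e]
    exact congrArg (F i) (polydisc_chart_symm (r := r) y hw).symm
  · refine Subtype.ext ?_
    change star q = q
    rw [(hn h0).2, star_zero]
  · refine Filter.Eventually.of_forall fun z => ?_
    change translationHomeo q (star (show polydiscOpens r from z).1) =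
      star (translationHomeo q (show polydiscOpens r from z).1)
    rw [translationHomeo_apply, translationHomeo_apply, (hn h0).2, sub_zero, sub_zero]

theorem isAnalyticSubset_polydiscOrigin {r : ℝ} (hr : 0 < r) :
    IsAnalyticSubset ({polydiscOrigin hr} : Set (polydisc r)) := by
  intro x
  have hval := contMDiff_subtype_val (I := 𝓘(ℂ, ℂ × ℂ)) (n := ω) (U := polydiscOpens r)
  refine ⟨Set.univ, isOpen_univ, trivial, 2,
    ![fun z : polydiscOpens r => z.1.1, fun z : polydiscOpens r => z.1.2], fun i => ?_, ?_⟩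
  · refine ContMDiff.contMDiffOn ?_
    fin_cases i
    · exact ContMDiff.comp (g := fun w : ℂ × ℂ => w.1) contDiff_fst.contMDiff hval
    · exact ContMDiff.comp (g := fun w : ℂ × ℂ => w.2) contDiff_snd.contMDiff hval
  · ext z
    simp only [Set.inter_univ, Set.mem_singleton_iff, Set.mem_univ, true_and, Fin.forall_fin_two]
    change z = polydiscOrigin hr ↔ (show polydiscOpens r from z).1.1 = 0 ∧
      (show polydiscOpens r from z).1.2 = 0
    constructor
    · rintro rfl
      exact ⟨rfl, rfl⟩
    · rintro ⟨h1, h2⟩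
      exact Subtype.ext (Prod.ext h1 h2)

theorem interior_eq_empty_of_frequently {X : Type} [TopologicalSpace X] {s : Set X}
    (h : ∀ x, ∃ᶠ z in 𝓝 x, z ∉ s) : interior s = ∅ :=
  Set.eq_empty_of_forall_notMem fun x hx => h x (by
    filter_upwards [mem_interior_iff_mem_nhds.mp hx] with z hz
    exact not_not.mpr hz)

theorem IsTowerMap.isProperBimeromorphic {r : ℝ} {hr : 0 < r} {Y : RealSurface}
    {π : Y → polydisc r} (h : IsTowerMap (polydiscOrigin hr) Y π) : IsProperBimeromorphic π where
  holomorphic := h.holomorphic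
  proper := h.proper
  bimeromorphic := ⟨{polydiscOrigin hr}, isAnalyticSubset_polydiscOrigin hr,
    interior_eq_empty_of_frequently fun x => (polydisc r).frequently_ne _ x,
    interior_eq_empty_of_frequently h.frequently_ne, h.biholomorphic⟩

end

/-! ### Assembly on a small polydisc -/

theorem mainTheorem4 {m : ℕ} (g : Fin m → ConvergentSeries ℝ)
    (hJ : Ideal.span (Set.range g) ≠ ⊥)
    (hirr : ∀ p : ConvergentSeries ℝ, Irreducible p → p ∣ ∏ i, g i →
      Irreducible (complexify p)) :
    ∃ (r : ℝ) (hr : 0 < r),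
      (∀ i, ∀ z ∈ polydiscOpens r, Summable (seriesTerm (complexify (g i)).1 z)) ∧
      ∃ (Y : RealSurface) (π : Y → polydisc r),
        IsRealBlowupTower (polydiscOrigin hr) Y π ∧
        IsMonomialization (fun i => polydiscFun r (complexify (g i))) π := by
  classical
  obtain ⟨n, hn⟩ := exists_resolvable_of_series g hJ hirr
  obtain ⟨ε, hε, hmono⟩ := Metric.mem_nhdsWithin_iff.mp hn.eventually_monoAt
  choose R hR hconv using fun i => ConvergentSeries.exists_convergesOn (complexify (g i))
  -- The radius must lie within the domains of convergence and within the ball on which the ideal is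
  -- monomial off the origin.
  obtain ⟨r, hr, hrε, hrR⟩ : ∃ r, 0 < r ∧ r ≤ ε ∧ ∀ i, r ≤ R i := by
    have h1 : ∀ᶠ r in 𝓝[>] (0 : ℝ), ∀ i, r < R i :=
      Filter.eventually_all.mpr fun i => (eventually_lt_nhds (hR i)).filter_mono nhdsWithin_le_nhds
    have h2 : ∀ᶠ r in 𝓝[>] (0 : ℝ), r < ε := (eventually_lt_nhds hε).filter_mono nhdsWithin_le_nhds
    obtain ⟨r, ⟨h1, h2⟩, h3⟩ := ((h1.and h2).and self_mem_nhdsWithin).exists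
    exact ⟨r, h3, h2.le, fun i => (h1 i).le⟩
  refine ⟨r, hr, fun i z hz => (hconv i).summable (hR i).le
    ((mem_ball_zero_iff.mp hz).le.trans (hrR i)), ?_⟩
  -- Zero series do not divide a power of x * h and are left out; they do not change the ideal and
  -- return in `ResolvableAt.isMonomialAt`. All `n` blow-ups are owed at the origin and none
  -- elsewhere.
  set F : {i // g i ≠ 0} → ℂ × ℂ → ℂ := fun i z => seriesEval (complexify (g i)).1 z
  obtain ⟨Y, π, hπ, hres⟩ := exists_tower
    (fun (i : {i // g i ≠ 0}) => polydiscFun r (complexify (g i))) n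
    (IsTowerMap.refl (polydiscOrigin hr)) (Finsupp.single (polydiscOrigin hr) n)
    (Finsupp.sum_single_index rfl) (by
      intro y
      by_cases hy : y = polydiscOrigin hr
      · subst hy
        rw [Finsupp.single_eq_same]
        refine resolvableAt_polydisc (F := F) ?_ fun _ => ⟨rfl, rfl⟩
        have e : (show polydiscOpens r from polydiscOrigin hr).1 = 0 := rfl
        simpa only [e, add_zero] using hn
      · rw [Finsupp.single_eq_of_ne hy]
        refine resolvableAt_polydisc (F := F) (.monomial ?_) fun h => absurd rfl h
        set q : ℂ × ℂ := (show polydiscOpens r from y).1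
        have hq : q ∈ Metric.ball (0 : ℂ × ℂ) ε ∩ {0}ᶜ := by
          refine ⟨Metric.ball_subset_ball hrε (show polydiscOpens r from y).2, fun h => hy ?_⟩
          exact Subtype.ext h
        have e : ∀ w, translationHomeo (-q) w = w + q := fun w => by
          rw [translationHomeo_apply, sub_neg_eq_add]
        have h1 : MonoAt F (translationHomeo (-q) 0) := by
          rw [e, zero_add]
          exact hmono hq
        simpa only [e] using h1.comp (translationHomeo_mem (-q)) (Set.mem_univ _))
  refine ⟨Y, π, hπ.tower, hπ.isProperBimeromorphic, fun y => ?_⟩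
  refine (hres y).isMonomialAt (p := fun i => g i ≠ 0)
    (F := fun i => polydiscFun r (complexify (g i)) ∘ π) fun i hi z => ?_
  change seriesEval (complexify (g i)).1 _ = 0
  rw [not_not.mp hi, map_zero]
  simp [seriesEval, seriesTerm]
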